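/- Cohomology is singular cohomology with rational coefficients (classical topology), and the Poincaré polynomial of a space $X$ is $H_X=\sum_{\alpha\ge 0}\dim_{\mathbb Q}H^\alpha(X)\,t^\alpha$. Put $h_\beta=\sum_{\alpha=0}^{\beta}t^{2\alpha}$ for $\beta\ge 0$, and $P_\alpha=h_0\cdots h_{\alpha-1}$ for $\alpha>0$, $P_0=1$, $P_\alpha=0$ for $\alpha<0$. Let $\mathbb G_k(\mathbb C^l)$ be the Grassmannian of $k$-dimensional subspaces of $\mathbb C^l$. For a partial flag $F_{1}\subsetneq\dots\subsetneq F_{n}$ of nonzero proper subspaces of $\mathbb C^l$ and non-negative integers $i_1,\dots,i_n$, the associated Schubert variety is $\{V\in\mathbb G_k(\mathbb C^l):\dim(V\cap F_\alpha)\ge i_\alpha\ \text{for all }\alpha\}$. The pair is called essential if none of these conditions is implied by the others. Fix a non-empty Schubert variety $\mathcal S$ with essential pair $(\mathcal F,\mathcal I)$, $\mathcal I=(i_1,\dots,i_\omega)$, $0<i_\alpha<k$ for all $\alpha$. An $\mathcal S$-variety $\Delta_p$ is a non-empty Schubert variety contained in $\mathcal S$ that is associated to a subflag of $\mathcal F$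 and to a tuple $(i^p_\alpha+p_\alpha)_\alpha$, where $i^p_\alpha$ is the component of $\mathcal I$ at the $\alpha$-th space $F_{j_\alpha^p}$ of the subflag (of dimension $j_\alpha^p$) and the $p_\alpha$ are non-negative integers; the numbers $r_\alpha=i_\alpha^p+p_\alpha$ are normalised by $r_1\le\dots\le r_{\omega_p}\le k\le l+r_{\omega_p}-j^p_{\omega_p}$, $r_\alpha\le j_\alpha^p$ and $r_{\alpha+1}-r_\alpha\le j_{\alpha+1}^p-j_\alpha^p$. Let $\Delta_q\subseteq\Delta_p$ be $\mathcal S$-varieties. Let $F_{j_1^{\bar p}}\subset\dots\subset F_{j_{\omega_{\bar p}}^{\bar p}}$ and $(i_\alpha^{\bar p}+\bar p_\alpha)_\alpha$, with $\omega_{\bar p}\ge 1$, be the essential pair of $\Delta_p$, obtained by deleting redundant conditions from the description of $\Delta_p$. Assume that every $F_{j_\alpha^{\bar p}}$ belongs to the flag in the description of $\Delta_q$, and let $q_\alpha^p$ be the component of $q$ at $F_{j_\alpha^{\bar p}}$. Let $\tilde\Delta_p$ be the variety of all $(Z_1,\dots,Z_{\omega_{\bar p}},V)$ with $Z_\alpha\in\mathbb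 G_{i_\alpha^{\bar p}+\bar p_\alpha}(F_{j_\alpha^{\bar p}})$, $V\in\mathbb G_k(\mathbb C^l)$ and $Z_1\subseteq\dots\subseteq Z_{\omega_{\bar p}}\subseteq V$, and let $\pi_p(Z_1,\dots,Z_{\omega_{\bar p}},V)=V$. Let $V\in\Delta_q$ satisfy $\dim(V\cap F_{j_\alpha^{\bar p}})=i_\alpha^{\bar p}+q_\alpha^p$ for all $\alpha=1,\dots,\omega_{\bar p}$, and let $F_{pq}=\pi_p^{-1}(V)$. **Proposition.** All $H^\alpha(F_{pq})$ are finite dimensional, only finitely many are nonzero, and the Poincaré polynomial $a_{pq}=H_{F_{pq}}$ is $$a_{pq}=\frac{P_{i_1^{\bar p}+q_1^p}}{P_{i_1^{\bar p}+\bar p_1}\,P_{q_1^p-\bar p_1}}\cdot\prod_{\alpha=2}^{\omega_{\bar p}}\frac{P_{i_\alpha^{\bar p}+q_\alpha^p-i_{\alpha-1}^{\bar p}-\bar p_{\alpha-1}}}{P_{i_\alpha^{\bar p}+\bar p_\alpha-i_{\alpha-1}^{\bar p}-\bar p_{\alpha-1}}\,P_{q_\alpha^p-\bar p_\alpha}}.$$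 -/

import Mathlib

open Polynomial

noncomputable section

/-! ### Singular cohomology with rational coefficients and Poincaré polynomials -/

/-- The singular chain complex of `X` with rational coefficients. -/
def ratSingularChains (X : Type) [TopologicalSpace X] : ChainComplex (ModuleCat.{0} ℚ) ℕ :=
  ((AlgebraicTopology.singularChainComplexFunctor (ModuleCat.{0} ℚ)).obj
    (ModuleCat.of ℚ ℚ)).obj (TopCat.of X)

/-- The transpose `Hom(C_j, ℚ) → Hom(C_i, ℚ)` of the singular differential `C_i → C_j`
(which is zero unless `i = j + 1`). -/
def ratCoboundary (X : Type) [TopologicalSpace X] (j i : ℕ) :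
    Module.Dual ℚ ((ratSingularChains X).X j) →ₗ[ℚ] Module.Dual ℚ ((ratSingularChains X).X i) :=
  Module.Dual.transpose ((ratSingularChains X).d i j).hom

/-- The singular cocycles of degree `n`. -/
def ratCocycles (X : Type) [TopologicalSpace X] (n : ℕ) :
    Submodule ℚ (Module.Dual ℚ ((ratSingularChains X).X n)) :=
  LinearMap.ker (ratCoboundary X n (n + 1))

/-- The singular coboundaries of degree `n`. In degree `0` the map `ratCoboundary X (0 - 1) 0` is
the transpose of the component `C_0 → C_0` of the differential, which is zero. -/
def ratCoboundaries (X : Type) [TopologicalSpace X] (n : ℕ) :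
    Submodule ℚ (Module.Dual ℚ ((ratSingularChains X).X n)) :=
  LinearMap.range (ratCoboundary X (n - 1) n)

/-- The singular cohomology `H^n(X) = H^n(X; ℚ)`: cocycles modulo coboundaries. -/
abbrev RatCohomology (X : Type) [TopologicalSpace X] (n : ℕ) : Type :=
  ratCocycles X n ⧸ (ratCoboundaries X n).comap (ratCocycles X n).subtype

/-- `a` is the Poincaré polynomial `∑ₙ dim H^n(X) tⁿ` of `X`: every `H^n(X)` is finite dimensional
and its dimension is the coefficient of `tⁿ` in `a`. -/
def IsPoincarePolynomial (X : Type) [TopologicalSpace X] (a : ℚ[X]) : Prop :=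
  ∀ n : ℕ, Module.Finite ℚ (RatCohomology X n) ∧
    a.coeff n = (Module.finrank ℚ (RatCohomology X n) : ℚ)

/-! ### The polynomials `h_β` and `P_α` -/

/-- `h_β = 1 + t² + ⋯ + t^{2β}`. -/
def hPoly (β : ℕ) : ℚ[X] := ∑ a ∈ Finset.range (β + 1), X ^ (2 * a)

/-- `P_α = h_0 ⋯ h_{α-1}` for `α > 0`, `P_0 = 1`, and `P_α = 0` for `α < 0`. -/
def PPoly (α : ℤ) : ℚ[X] := if α < 0 then 0 else ∏ β ∈ Finset.range α.toNat, hPoly β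

/-- `P_α` as a rational function in `t`. -/
def PRat (α : ℤ) : RatFunc ℚ := algebraMap ℚ[X] (RatFunc ℚ) (PPoly α)

/-! ### Grassmannians -/

/-- The Grassmannian `𝔾_k(ℂ^l)` of `k`-dimensional linear subspaces of `ℂ^l`. -/
def Gr (k l : ℕ) : Type :=
  {V : Submodule ℂ (EuclideanSpace ℂ (Fin l)) // Module.finrank ℂ V = k}

/-- The linear subspace underlying a point of the Grassmannian. -/
def Gr.space {k l : ℕ} (V : Gr k l) : Submodule ℂ (EuclideanSpace ℂ (Fin l)) := V.1

/-- The classical topology of the Grassmannian: a subspace is identified with the orthogonal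
projection onto it. -/
instance Gr.instTopologicalSpace (k l : ℕ) : TopologicalSpace (Gr k l) :=
  TopologicalSpace.induced (fun V => V.space.starProjection) inferInstance

/-! ### Flags and Schubert varieties -/

/-- `F` is a partial flag of `ℂ^l`: a strictly increasing sequence of proper nonzero subspaces. -/
structure IsPartialFlag {l n : ℕ} (F : Fin n → Submodule ℂ (EuclideanSpace ℂ (Fin l))) : Prop where
  strictMono : StrictMono F
  ne_bot : ∀ α, F α ≠ ⊥
  ne_top : ∀ α, F α ≠ ⊤

/-- `dim (V ∩ H)`. -/
def interDim {k l : ℕ} (V : Gr k l) (H : Submodule ℂ (EuclideanSpace ℂ (Fin l))) : ℕ :=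
  Module.finrank ℂ (V.space ⊓ H : Submodule ℂ (EuclideanSpace ℂ (Fin l)))

/-- The Schubert variety `{V ∈ 𝔾_k(ℂ^l) : dim (V ∩ F_α) ≥ i_α for all α}` associated to the flag
`F` and the tuple `i`. -/
def schubertVariety (k : ℕ) {l n : ℕ} (F : Fin n → Submodule ℂ (EuclideanSpace ℂ (Fin l)))
    (i : Fin n → ℕ) : Set (Gr k l) :=
  {V | ∀ α, i α ≤ interDim V (F α)}

/-- The locus `{V ∈ 𝔾_k(ℂ^l) : dim (V ∩ F_α) = i_α for all α}`. -/
def schubertStratum (k : ℕ) {l n : ℕ} (F : Fin n → Submodule ℂ (EuclideanSpace ℂ (Fin l)))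
    (i : Fin n → ℕ) : Set (Gr k l) :=
  {V | ∀ α, interDim V (F α) = i α}

/-- The pair `(F, i)` is essential: it is the minimum information defining its Schubert variety,
that is, no incidence condition `dim (V ∩ F_α) ≥ i_α` is implied by the others. -/
def IsEssential (k : ℕ) {l n : ℕ} (F : Fin n → Submodule ℂ (EuclideanSpace ℂ (Fin l)))
    (i : Fin n → ℕ) : Prop :=
  ∀ α, ∃ V : Gr k l, (∀ β, β ≠ α → i β ≤ interDim V (F β)) ∧ ¬ i α ≤ interDim V (F α)

/-- The weak numerical conditions on a pair `(F, i)`, with `j_α = dim F_α`: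
`0 ≤ i_1 ≤ ⋯ ≤ i_n ≤ k ≤ l + i_n - j_n`, `i_α ≤ j_α`, `i_β - i_α ≤ j_β - j_α` for `α ≤ β`.
(For increasing sequences with the last property, `k ≤ l + i_α - j_α` for the last `α` is the same
as for all `α`.) -/
structure IsWeaklyAdmissible (k : ℕ) {l n : ℕ}
    (F : Fin n → Submodule ℂ (EuclideanSpace ℂ (Fin l))) (i : Fin n → ℕ) : Prop where
  monotone : Monotone i
  le_k : ∀ α, i α ≤ k
  k_add_le : ∀ α, k + Module.finrank ℂ (F α) ≤ l + i α
  le_dim : ∀ α, i α ≤ Module.finrank ℂ (F α)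
  add_le_add : ∀ α β, α ≤ β →
    i β + Module.finrank ℂ (F α) ≤ i α + Module.finrank ℂ (F β)

/-- An `𝒮`-variety, where `𝒮` is the Schubert variety associated to `(F, I)`: a nonempty Schubert
subvariety of `𝒮` associated to the subflag of `F` with the positions `pos` and to the tuple
`i_α + p_α`, where `i_α` is the component of `I` at the position `pos α` and `p` is a tuple of
non-negative integers. -/
structure SVariety (k : ℕ) {l ω : ℕ} (F : Fin ω → Submodule ℂ (EuclideanSpace ℂ (Fin l)))
    (I : Fin ω → ℕ) where
  /-- the length of the subflag -/
  len : ℕ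
  /-- the positions of the subflag -/
  pos : Fin len ↪o Fin ω
  /-- the vector `p` -/
  vec : Fin len → ℕ
  weak : IsWeaklyAdmissible k (fun α => F (pos α)) (fun α => I (pos α) + vec α)
  nonempty : (schubertVariety k (fun α => F (pos α)) (fun α => I (pos α) + vec α)).Nonempty
  subset : schubertVariety k (fun α => F (pos α)) (fun α => I (pos α) + vec α) ⊆
    schubertVariety k F I

/-- The set of points of an `𝒮`-variety. -/
def SVariety.points {k l ω : ℕ} {F : Fin ω → Submodule ℂ (EuclideanSpace ℂ (Fin l))}
    {I : Fin ω → ℕ} (p : SVariety k F I) : Set (Gr k l) :=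
  schubertVariety k (fun α => F (p.pos α)) (fun α => I (p.pos α) + p.vec α)

/-- The essential pair of an `𝒮`-variety `Δ_p`: the conditions with the positions `idx` among the
conditions of `Δ_p`, which form an essential pair defining the same Schubert variety. -/
structure SVariety.EssentialPair {k l ω : ℕ}
    {F : Fin ω → Submodule ℂ (EuclideanSpace ℂ (Fin l))} {I : Fin ω → ℕ}
    (p : SVariety k F I) (n : ℕ) where
  /-- which conditions of `Δ_p` are kept -/
  idx : Fin n ↪o Fin p.len
  essential : IsEssential k (fun α => F (p.pos (idx α)))
    (fun α => I (p.pos (idx α)) + p.vec (idx α))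
  points_eq : schubertVariety k (fun α => F (p.pos (idx α)))
    (fun α => I (p.pos (idx α)) + p.vec (idx α)) = p.points

namespace SVariety.EssentialPair

variable {k l ω n : ℕ} {F : Fin ω → Submodule ℂ (EuclideanSpace ℂ (Fin l))} {I : Fin ω → ℕ}
  {p : SVariety k F I}

/-- The essential flag. -/
def flag (e : p.EssentialPair n) (α : Fin n) : Submodule ℂ (EuclideanSpace ℂ (Fin l)) :=
  F (p.pos (e.idx α))

/-- The components of `I` at the positions of the essential flag. -/
def ind (e : p.EssentialPair n) (α : Fin n) : ℕ := I (p.pos (e.idx α))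

/-- The vector obtained from `p` by deleting the components of the redundant conditions. -/
def bar (e : p.EssentialPair n) (α : Fin n) : ℕ := p.vec (e.idx α)

end SVariety.EssentialPair

/-! ### The resolution and its fibres -/

/-- The variety of all `(Z_1, …, Z_n, V)` with `Z_α ∈ 𝔾_{r_α}(F_α)`, `V ∈ 𝔾_k(ℂ^l)` and
`Z_1 ⊆ ⋯ ⊆ Z_n ⊆ V`, with the topology of a subspace of a product of Grassmannians. -/
abbrev Resolution (k : ℕ) {l n : ℕ} (F : Fin n → Submodule ℂ (EuclideanSpace ℂ (Fin l)))
    (r : Fin n → ℕ) : Type :=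
  {x : (∀ α : Fin n, Gr (r α) l) × Gr k l //
    (∀ α, (x.1 α).space ≤ F α) ∧ (∀ α β, α ≤ β → (x.1 α).space ≤ (x.1 β).space) ∧
      ∀ α, (x.1 α).space ≤ x.2.space}

/-- The projection `(Z_1, …, Z_n, V) ↦ V`. -/
def Resolution.proj (k : ℕ) {l n : ℕ} (F : Fin n → Submodule ℂ (EuclideanSpace ℂ (Fin l)))
    (r : Fin n → ℕ) (x : Resolution k F r) : Gr k l := x.1.2

/-- The fibre of the projection over `V`. -/
abbrev ResolutionFibre (k : ℕ) {l n : ℕ} (F : Fin n → Submodule ℂ (EuclideanSpace ℂ (Fin l)))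
    (r : Fin n → ℕ) (V : Gr k l) : Type :=
  {x : Resolution k F r // Resolution.proj k F r x = V}

end

/-! Over V each Z_α is a subspace of V ∩ F_α, a space of dimension i_α + q_α. Hence the fibre is a
tower of Grassmannians: Z_1 is any subspace of V ∩ F_1 of the prescribed dimension, and once Z_{α-1}
is fixed, Z_α / Z_{α-1} is any subspace of the right dimension in (V ∩ F_α) / Z_{α-1}. The Poincaré
polynomial is therefore a product of polynomials of Grassmannians, and that of the Grassmannian of
s-spaces in ℂ^N is the Gaussian binomial P_N / (P_s P_{N-s}) in t².

The product formula comes from affine cells rather than from a spectral sequence. A `Paving` is an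
ordered family of open charts N_i ≅ ℂ^S × ℂ^T in which the points outside all earlier charts are
those with zero ℂ^T-coordinate. If U is the union of the earlier charts, excision and
contractibility of ℂ^S identify the homology of (N_i ∪ U, U) with that of (ℂ^T, ℂ^T ∖ 0), which is ℚ
in degree 2|T|. Only even degrees occur, so dimensions add in the exact sequences (`HasDims.add`)
and a finite paving with codimensions b_i gives ∑ t^(2 b_i) (`Paving.isPoincarePolynomial`). This
rests on homotopy invariance (`SC.map_sub_map_mem_bdry`), excision (`SC.nonempty_excision`) and the
duality between rational cohomology and homology (`cohomologyEquiv`), all proved on explicit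
singular chains.

Grassmannians are paved by graph charts around coordinate subspaces, in reversed colexicographic
order (`AdaptedFrame.paving`). Over such a chart a shear carries the first space of a tower to the
centre of the chart and trivialises the remaining tower (`Tower.trivialisation`); pavings of base
and fibre combine lexicographically with codimensions adding (`Paving.bundle`,
`Tower.exists_paving`). The codimension of a cell counts inversions of a finite set, and a Pascal
recursion turns the resulting sum into the Gaussian binomial (`cellPoly_mul`). -/

noncomputable section

/-! ### Relative homology of subcomplexes -/

/-- A complex of rational vector spaces, the differential of degree `0` being zero. -/
structure QComplex where
  C : ℕ → Type
  [grp : ∀ n, AddCommGroup (C n)]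
  [mod : ∀ n, Module ℚ (C n)]
  d : ∀ n, C n →ₗ[ℚ] C (n - 1)
  d_zero : d 0 = 0
  d_d : ∀ n x, d (n - 1) (d n x) = 0

attribute [instance] QComplex.grp QComplex.mod

namespace QComplex

/-- A subcomplex. -/
structure Sub (K : QComplex) where
  S : ∀ n, Submodule ℚ (K.C n)
  d_mem : ∀ n x, x ∈ S n → K.d n x ∈ S (n - 1)

variable {K K' : QComplex}

instance : LE K.Sub := ⟨fun A B => ∀ n, A.S n ≤ B.S n⟩

/-- The differential of degree `n + 1`. -/
def dS (K : QComplex) (n : ℕ) : K.C (n + 1) →ₗ[ℚ] K.C n := K.d (n + 1)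

@[simp] theorem d_dS (n : ℕ) (x : K.C (n + 1)) : K.d n (K.dS n x) = 0 := K.d_d (n + 1) x

@[simp] theorem dS_dS (n : ℕ) (x : K.C (n + 2)) : K.dS n (K.dS (n + 1) x) = 0 := K.d_d (n + 2) x

theorem Sub.dS_mem (A : K.Sub) {n : ℕ} {x : K.C (n + 1)} (hx : x ∈ A.S (n + 1)) :
    K.dS n x ∈ A.S n := A.d_mem (n + 1) x hx

theorem Sub.le_rfl (A : K.Sub) : A ≤ A := fun _ => _root_.le_rfl

instance : Max K.Sub where
  max A B :=
    { S := fun n => A.S n ⊔ B.S n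
      d_mem := by
        intro n x hx
        obtain ⟨a, ha, b, hb, rfl⟩ := Submodule.mem_sup.1 hx
        rw [map_add]
        exact Submodule.add_mem_sup (A.d_mem n a ha) (B.d_mem n b hb) }

instance : Min K.Sub where
  min A B :=
    { S := fun n => A.S n ⊓ B.S n
      d_mem := fun n x hx => ⟨A.d_mem n x hx.1, B.d_mem n x hx.2⟩ }

/-- The cycles of `B` relative to `A`. -/
def cyc (B A : K.Sub) (n : ℕ) : Submodule ℚ (K.C n) :=
  B.S n ⊓ (A.S (n - 1)).comap (K.d n)

/-- The boundaries of `B` relative to `A`. -/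
def bdry (B A : K.Sub) (n : ℕ) : Submodule ℚ (K.C n) :=
  A.S n ⊔ (B.S (n + 1)).map (K.dS n)

theorem mem_cyc {B A : K.Sub} {n : ℕ} {x : K.C n} :
    x ∈ cyc B A n ↔ x ∈ B.S n ∧ K.d n x ∈ A.S (n - 1) := Iff.rfl

theorem mem_bdry {B A : K.Sub} {n : ℕ} {x : K.C n} :
    x ∈ bdry B A n ↔ ∃ a ∈ A.S n, ∃ b ∈ B.S (n + 1), a + K.dS n b = x := by
  unfold bdry
  rw [Submodule.mem_sup]
  constructor
  · rintro ⟨a, ha, _, ⟨b, hb, rfl⟩, rfl⟩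
    exact ⟨a, ha, b, hb, rfl⟩
  · rintro ⟨a, ha, b, hb, rfl⟩
    exact ⟨a, ha, _, ⟨b, hb, rfl⟩, rfl⟩

/-- Since `0 - 1 = 0`, the differential of degree 0 lands in degree 0 again; it is zero, so the
cycle condition is void. -/
theorem mem_cyc_zero {B A : K.Sub} {x : K.C 0} : x ∈ cyc B A 0 ↔ x ∈ B.S 0 := by
  rw [mem_cyc, K.d_zero]
  exact and_iff_left (zero_mem _)

theorem mem_cyc_succ {B A : K.Sub} {n : ℕ} {x : K.C (n + 1)} :
    x ∈ cyc B A (n + 1) ↔ x ∈ B.S (n + 1) ∧ K.dS n x ∈ A.S n := Iff.rfl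

theorem mem_bdry_of_mem {B A : K.Sub} {n : ℕ} {x : K.C n} (h : x ∈ A.S n) : x ∈ bdry B A n :=
  mem_bdry.2 ⟨x, h, 0, zero_mem _, by simp⟩

theorem dS_mem_bdry {B A : K.Sub} {n : ℕ} {x : K.C (n + 1)} (h : x ∈ B.S (n + 1)) :
    K.dS n x ∈ bdry B A n :=
  mem_bdry.2 ⟨0, zero_mem _, x, h, by simp⟩

theorem mem_cyc_of_d_eq_zero {B A : K.Sub} {n : ℕ} {x : K.C n} (h : x ∈ B.S n)
    (h' : K.d n x = 0) : x ∈ cyc B A n :=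
  mem_cyc.2 ⟨h, by rw [h']; exact zero_mem _⟩

theorem bdry_le_cyc {B A : K.Sub} (h : A ≤ B) (n : ℕ) : bdry B A n ≤ cyc B A n := by
  intro x hx
  obtain ⟨a, ha, b, hb, rfl⟩ := mem_bdry.1 hx
  refine mem_cyc.2 ⟨(B.S n).add_mem (h n ha) (B.dS_mem hb), ?_⟩
  simpa using A.d_mem n a ha

theorem cyc_mono {B B' A A' : K.Sub} (hB : B ≤ B') (hA : A ≤ A') (n : ℕ) :
    cyc B A n ≤ cyc B' A' n :=
  fun _ hx => ⟨hB n hx.1, hA _ hx.2⟩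

theorem bdry_mono {B B' A A' : K.Sub} (hB : B ≤ B') (hA : A ≤ A') (n : ℕ) :
    bdry B A n ≤ bdry B' A' n :=
  sup_le_sup (hA n) (Submodule.map_mono (hB _))

/-- Relative homology. -/
abbrev Hom (B A : K.Sub) (n : ℕ) : Type :=
  cyc B A n ⧸ (bdry B A n).comap (cyc B A n).subtype

/-- The relative homology vanishes. -/
def Acyclic (B A : K.Sub) : Prop := ∀ n, cyc B A n ≤ bdry B A n

/-- A linear map between chains in possibly different degrees induces a map in homology. -/
def homMap {B A : K.Sub} {B' A' : K'.Sub} {n n' : ℕ} (f : K.C n →ₗ[ℚ] K'.C n')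
    (hc : ∀ z ∈ cyc B A n, f z ∈ cyc B' A' n')
    (hb : ∀ z ∈ cyc B A n, z ∈ bdry B A n → f z ∈ bdry B' A' n') : Hom B A n →ₗ[ℚ] Hom B' A' n' :=
  Submodule.mapQ _ _ (f.restrict hc) (by
    rintro ⟨z, hz⟩ h
    exact hb z hz h)

theorem homMap_mk {B A : K.Sub} {B' A' : K'.Sub} {n n' : ℕ} (f : K.C n →ₗ[ℚ] K'.C n') (hc hb)
    (z : K.C n) (hz : z ∈ cyc B A n) :
    homMap (B' := B') (A' := A') f hc hb (Submodule.Quotient.mk ⟨z, hz⟩) =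
      Submodule.Quotient.mk ⟨f z, hc z hz⟩ := rfl

theorem hom_mk_eq_zero {B A : K.Sub} {n : ℕ} (z : K.C n) (hz : z ∈ cyc B A n) :
    (Submodule.Quotient.mk ⟨z, hz⟩ : Hom B A n) = 0 ↔ z ∈ bdry B A n := by
  rw [Submodule.Quotient.mk_eq_zero]; rfl

theorem homMap_injective {B A : K.Sub} {B' A' : K'.Sub} {n n' : ℕ} (f : K.C n →ₗ[ℚ] K'.C n')
    (hc : ∀ z ∈ cyc B A n, f z ∈ cyc B' A' n')
    (hb : ∀ z ∈ cyc B A n, z ∈ bdry B A n → f z ∈ bdry B' A' n') (hi : ∀ z ∈ cyc B A n, f z ∈ bdry B' A' n' → z ∈ bdry B A n) :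
    Function.Injective (homMap (B' := B') (A' := A') f hc hb) := by
  rw [injective_iff_map_eq_zero]
  intro x hx
  obtain ⟨⟨z, hz⟩, rfl⟩ := Submodule.Quotient.mk_surjective _ x
  rw [homMap_mk, hom_mk_eq_zero] at hx
  exact (hom_mk_eq_zero z hz).2 (hi z hz hx)

theorem homMap_surjective {B A : K.Sub} {B' A' : K'.Sub} {n n' : ℕ} (f : K.C n →ₗ[ℚ] K'.C n')
    (hc : ∀ z ∈ cyc B A n, f z ∈ cyc B' A' n')
    (hb : ∀ z ∈ cyc B A n, z ∈ bdry B A n → f z ∈ bdry B' A' n') (hs : ∀ z' ∈ cyc B' A' n', ∃ z ∈ cyc B A n, z' - f z ∈ bdry B' A' n') :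
    Function.Surjective (homMap (B' := B') (A' := A') f hc hb) := by
  intro x
  obtain ⟨⟨z', hz'⟩, rfl⟩ := Submodule.Quotient.mk_surjective _ x
  obtain ⟨z, hz, h⟩ := hs z' hz'
  refine ⟨Submodule.Quotient.mk ⟨z, hz⟩, ?_⟩
  rw [homMap_mk, eq_comm, Submodule.Quotient.eq]
  exact h

theorem nonempty_homEquiv {B A : K.Sub} {B' A' : K'.Sub} {n n' : ℕ} (f : K.C n →ₗ[ℚ] K'.C n')
    (hc : ∀ z ∈ cyc B A n, f z ∈ cyc B' A' n')
    (hb : ∀ z ∈ cyc B A n, z ∈ bdry B A n → f z ∈ bdry B' A' n')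
    (hi : ∀ z ∈ cyc B A n, f z ∈ bdry B' A' n' → z ∈ bdry B A n)
    (hs : ∀ z' ∈ cyc B' A' n', ∃ z ∈ cyc B A n, z' - f z ∈ bdry B' A' n') :
    Nonempty (Hom B A n ≃ₗ[ℚ] Hom B' A' n') :=
  ⟨LinearEquiv.ofBijective (homMap f hc hb)
    ⟨homMap_injective f hc hb hi, homMap_surjective f hc hb hs⟩⟩

/-- Mutually inverse maps up to boundaries induce an isomorphism in homology. -/
theorem nonempty_homEquiv_of_inverse {B A : K.Sub} {B' A' : K'.Sub} {n : ℕ}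
    (f : K.C n →ₗ[ℚ] K'.C n) (g : K'.C n →ₗ[ℚ] K.C n)
    (hc : ∀ z ∈ cyc B A n, f z ∈ cyc B' A' n) (hb : ∀ z ∈ bdry B A n, f z ∈ bdry B' A' n)
    (hc' : ∀ z ∈ cyc B' A' n, g z ∈ cyc B A n) (hb' : ∀ z ∈ bdry B' A' n, g z ∈ bdry B A n)
    (hgf : ∀ z ∈ cyc B A n, z - g (f z) ∈ bdry B A n)
    (hfg : ∀ z ∈ cyc B' A' n, z - f (g z) ∈ bdry B' A' n) :
    Nonempty (Hom B A n ≃ₗ[ℚ] Hom B' A' n) := by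
  refine nonempty_homEquiv f hc (fun z _ h => hb z h) (fun z hz h => ?_) (fun z' hz' => ?_)
  · have := (bdry B A n).add_mem (hgf z hz) (hb' _ h)
    simpa using this
  · exact ⟨g z', hc' z' hz', hfg z' hz'⟩

/-! #### Triples -/

section Triple

variable {A B D : K.Sub}

/-- The part of the exact sequence of the triple where H(D, B) = 0 makes the inclusion (B, A) → (D,
A) an isomorphism, as a diagram chase. -/
theorem homEquiv_of_acyclic_top (hAB : A ≤ B) (hBD : B ≤ D) (h : Acyclic D B) (n : ℕ) :
    Nonempty (Hom B A n ≃ₗ[ℚ] Hom D A n) := by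
  refine nonempty_homEquiv LinearMap.id (fun z hz => cyc_mono hBD A.le_rfl n hz)
    (fun z _ hz => bdry_mono hBD A.le_rfl n hz) (fun z hz hz' => ?_) (fun z' hz' => ?_)
  · obtain ⟨a, ha, e, he, hae⟩ := mem_bdry.1 hz'
    have hde : K.dS n e ∈ B.S n := by
      rw [show K.dS n e = z - a from eq_sub_of_add_eq' hae]
      exact (B.S n).sub_mem hz.1 (hAB n ha)
    obtain ⟨b, hb, e', he', rfl⟩ := mem_bdry.1 (h (n + 1) ⟨he, hde⟩)
    refine mem_bdry.2 ⟨a, ha, b, hb, ?_⟩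
    simpa using hae
  · obtain ⟨b, hb, e, he, rfl⟩ := mem_bdry.1 (h n (cyc_mono D.le_rfl hAB n hz'))
    refine ⟨b, ⟨hb, ?_⟩, ?_⟩
    · simpa using hz'.2
    · simpa using dS_mem_bdry he

/-- When H(D, A) = 0 the connecting map of the triple is an isomorphism; on representatives it is
the differential. -/
theorem homEquiv_connecting (hAB : A ≤ B) (hBD : B ≤ D) (h : Acyclic D A) (n : ℕ) :
    Nonempty (Hom D B (n + 1) ≃ₗ[ℚ] Hom B A n) := by
  refine nonempty_homEquiv (K := K) (K' := K) (n := n + 1) (n' := n) (K.dS n) (fun z hz => ?_)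
    (fun z _ hz => ?_) (fun z hz hz' => ?_) (fun z' hz' => ?_)
  · exact mem_cyc_of_d_eq_zero hz.2 (by simp)
  · obtain ⟨b, hb, e, he, rfl⟩ := mem_bdry.1 hz
    rw [map_add, dS_dS, add_zero]
    exact dS_mem_bdry hb
  · obtain ⟨a, ha, b, hb, hab⟩ := mem_bdry.1 hz'
    have h1 : z - b ∈ cyc D A (n + 1) := by
      refine mem_cyc_succ.2 ⟨(D.S _).sub_mem hz.1 (hBD _ hb), ?_⟩
      rw [map_sub, ← hab]
      simpa using ha
    have h2 := bdry_mono D.le_rfl hAB _ (h _ h1)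
    have h3 : b ∈ bdry D B (n + 1) := mem_bdry_of_mem hb
    simpa using (bdry D B (n + 1)).add_mem h2 h3
  · obtain ⟨a, ha, e, he, rfl⟩ := mem_bdry.1 (h n (cyc_mono hBD A.le_rfl n hz'))
    refine ⟨e, mem_cyc_succ.2 ⟨he, ?_⟩, ?_⟩
    · have := (B.S n).sub_mem hz'.1 (hAB n ha)
      simpa using this
    · exact mem_bdry_of_mem (by simpa using ha)

/-- The degree left out by `homEquiv_connecting`: H_0(D, B) is a quotient of H_0(D, A) = 0. -/
theorem cyc_zero_le_bdry (hAB : A ≤ B) (h : Acyclic D A) : cyc D B 0 ≤ bdry D B 0 := by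
  intro z hz
  exact bdry_mono D.le_rfl hAB 0 (h 0 (mem_cyc_zero.2 hz.1))

end Triple

/-! #### Excision -/

/-- The algebraic half of excision: U / (U ⊓ V) ≅ (U ⊔ V) / V already at the level of chains. -/
theorem homEquiv_inf_sup (U V : K.Sub) (n : ℕ) :
    Nonempty (Hom U (U ⊓ V) n ≃ₗ[ℚ] Hom (U ⊔ V) V n) := by
  have hU : U ≤ U ⊔ V := fun n => le_sup_left (a := U.S n)
  have hV : U ⊓ V ≤ V := fun n => inf_le_right (a := U.S n)
  refine nonempty_homEquiv LinearMap.id (fun z hz => cyc_mono hU hV n hz)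
    (fun z _ hz => bdry_mono hU hV n hz) (fun z hz hz' => ?_) (fun z' hz' => ?_)
  · obtain ⟨v, hv, e, he, hve⟩ := mem_bdry.1 hz'
    obtain ⟨u', hu', v', hv', rfl⟩ := Submodule.mem_sup.1 he
    refine mem_bdry.2 ⟨v + K.dS n v', ⟨?_, (V.S n).add_mem hv (V.dS_mem hv')⟩, u', hu', ?_⟩
    · have : v + K.dS n v' = z - K.dS n u' := by
        rw [eq_sub_iff_add_eq]
        rw [map_add] at hve
        rw [add_assoc, add_comm (K.dS n v')]
        exact hve
      rw [this]
      exact (U.S n).sub_mem hz.1 (U.dS_mem hu')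
    · rw [map_add] at hve
      rw [add_assoc, add_comm (K.dS n v')]
      exact hve
  · obtain ⟨u, hu, v, hv, rfl⟩ := Submodule.mem_sup.1 hz'.1
    refine ⟨u, ⟨hu, U.d_mem _ _ hu, ?_⟩, ?_⟩
    · have := (V.S (n - 1)).sub_mem hz'.2 (V.d_mem _ _ hv)
      simpa using this
    · exact mem_bdry_of_mem (by simpa using hv)

/-! #### Dimensions -/

/-- The dimensions of the relative homology are given by `f`. -/
def HasDims (B A : K.Sub) (f : ℕ → ℕ) : Prop :=
  ∀ n, Module.Finite ℚ (Hom B A n) ∧ Module.finrank ℚ (Hom B A n) = f n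

theorem hasDims_iff_of_equiv {B A : K.Sub} {B' A' : K'.Sub} {n n' m : ℕ}
    (h : Nonempty (Hom B A n ≃ₗ[ℚ] Hom B' A' n')) :
    (Module.Finite ℚ (Hom B A n) ∧ Module.finrank ℚ (Hom B A n) = m) ↔
      (Module.Finite ℚ (Hom B' A' n') ∧ Module.finrank ℚ (Hom B' A' n') = m) := by
  obtain ⟨e⟩ := h
  rw [e.finrank_eq]
  refine and_congr_left fun _ => ⟨fun _ => Module.Finite.equiv e, fun _ => Module.Finite.equiv e.symm⟩

theorem HasDims.of_equiv {B A : K.Sub} {B' A' : K'.Sub} {f : ℕ → ℕ} (h' : HasDims B' A' f)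
    (h : ∀ n, Nonempty (Hom B A n ≃ₗ[ℚ] Hom B' A' n)) : HasDims B A f :=
  fun n => (hasDims_iff_of_equiv (h n)).2 (h' n)

theorem dims_zero_of_le {B A : K.Sub} {n : ℕ} (h : cyc B A n ≤ bdry B A n) :
    Module.Finite ℚ (Hom B A n) ∧ Module.finrank ℚ (Hom B A n) = 0 := by
  have : Subsingleton (Hom B A n) := by
    rw [Submodule.Quotient.subsingleton_iff, Submodule.comap_subtype_eq_top]
    exact h
  exact ⟨inferInstance, Module.finrank_zero_of_subsingleton⟩

theorem cyc_le_bdry_of_dims_zero {B A : K.Sub} {n : ℕ}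
    (h : Module.Finite ℚ (Hom B A n) ∧ Module.finrank ℚ (Hom B A n) = 0) :
    cyc B A n ≤ bdry B A n := by
  obtain ⟨_, h⟩ := h
  have := Module.finrank_zero_iff.1 h
  rw [Submodule.Quotient.subsingleton_iff, Submodule.comap_subtype_eq_top] at this
  exact this

/-- In a triple with homology in even degrees only, dimensions add up. -/
theorem HasDims.add {A B D : K.Sub} (hAB : A ≤ B) (hBD : B ≤ D) {f g : ℕ → ℕ}
    (hf : HasDims B A f) (hg : HasDims D B g) (hf' : ∀ n, Odd n → f n = 0)
    (hg' : ∀ n, Odd n → g n = 0) : HasDims D A (fun n => f n + g n) := by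
  intro n
  -- In even degrees H_n(B, A) → H_n(D, A) is injective because H_{n+1}(D, B) = 0.
  have h1 : ∀ z ∈ cyc B A n, z ∈ bdry D A n → n % 2 = 0 → z ∈ bdry B A n := by
    intro z hz hz' hn
    obtain ⟨a, ha, e, he, hae⟩ := mem_bdry.1 hz'
    have hde : K.dS n e ∈ B.S n := by
      rw [show K.dS n e = z - a from eq_sub_of_add_eq' hae]
      exact (B.S n).sub_mem hz.1 (hAB n ha)
    have hodd : Odd (n + 1) := by rw [Nat.odd_iff]; omega
    have h := hg (n + 1)
    rw [hg' _ hodd] at h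
    obtain ⟨b, hb, e', he', rfl⟩ := mem_bdry.1 (cyc_le_bdry_of_dims_zero h ⟨he, hde⟩)
    refine mem_bdry.2 ⟨a, ha, b, hb, ?_⟩
    simpa using hae
  -- Exactness at H_n(D, A), valid in every degree.
  have h2 : ∀ z ∈ cyc D A n, z ∈ bdry D B n → ∃ b ∈ cyc B A n, z - b ∈ bdry D A n := by
    intro z hz hz'
    obtain ⟨b, hb, e, he, rfl⟩ := mem_bdry.1 hz'
    refine ⟨b, ⟨hb, ?_⟩, by simpa using dS_mem_bdry he⟩
    simpa using hz.2
  obtain ⟨hfF, hfn⟩ := hf n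
  obtain ⟨hgF, hgn⟩ := hg n
  rcases Nat.mod_two_eq_zero_or_one n with hn | hn
  · let F : Hom B A n →ₗ[ℚ] Hom D A n := homMap (K := K) (K' := K) LinearMap.id
      (fun z hz => cyc_mono hBD A.le_rfl n hz) (fun z _ hz => bdry_mono hBD A.le_rfl n hz)
    let G : Hom D A n →ₗ[ℚ] Hom D B n := homMap (K := K) (K' := K) LinearMap.id
      (fun z hz => cyc_mono D.le_rfl hAB n hz) (fun z _ hz => bdry_mono D.le_rfl hAB n hz)
    have hFi : Function.Injective F := homMap_injective _ _ _ (fun z hz hz' => h1 z hz hz' hn)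
    -- A relative cycle of (D, B) lifts to one of (D, A) because its boundary dies in H_{n-1}(B, A)
    -- = 0, the degree n - 1 being odd; in degree 0 there is nothing to lift.
    have hGs : Function.Surjective G := by
      refine homMap_surjective _ _ _ (fun z' hz' => ?_)
      cases n with
      | zero =>
        exact ⟨z', mem_cyc_zero.2 hz'.1, by simp⟩
      | succ n =>
        have h := hf n
        rw [hf' n (by rw [Nat.odd_iff]; omega)] at h
        have hc : K.dS n z' ∈ cyc B A n := mem_cyc_of_d_eq_zero hz'.2 (by simp)
        obtain ⟨a, ha, b, hb, hab⟩ := mem_bdry.1 (cyc_le_bdry_of_dims_zero h hc)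
        refine ⟨z' - b, mem_cyc_succ.2 ⟨(D.S _).sub_mem hz'.1 (hBD _ hb), ?_⟩, ?_⟩
        · rw [map_sub, ← hab]
          simpa using ha
        · exact mem_bdry_of_mem (by simpa using hb)
    have hker : LinearMap.ker G = LinearMap.range F := by
      ext x
      obtain ⟨⟨z, hz⟩, rfl⟩ := Submodule.Quotient.mk_surjective _ x
      rw [LinearMap.mem_ker, homMap_mk, hom_mk_eq_zero]
      constructor
      · intro h
        obtain ⟨b, hb, hzb⟩ := h2 z hz h
        refine ⟨Submodule.Quotient.mk ⟨b, hb⟩, ?_⟩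
        rw [homMap_mk, eq_comm, Submodule.Quotient.eq]
        exact hzb
      · rintro ⟨y, hy⟩
        obtain ⟨⟨b, hb⟩, rfl⟩ := Submodule.Quotient.mk_surjective _ y
        rw [homMap_mk, eq_comm, Submodule.Quotient.eq] at hy
        have h3 : z - b ∈ bdry D B n := bdry_mono D.le_rfl hAB n hy
        have h4 : b ∈ bdry D B n := mem_bdry_of_mem hb.1
        simpa using (bdry D B n).add_mem h3 h4
    have hkf : Module.Finite ℚ (LinearMap.ker G) := by rw [hker]; infer_instance
    have : Module.Finite ℚ (Hom D A n) := by
      refine @Module.Finite.of_submodule_quotient _ _ _ _ _ (LinearMap.ker G) hkf ?_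
      exact Module.Finite.equiv (G.quotKerEquivOfSurjective hGs).symm
    refine ⟨this, ?_⟩
    rw [← LinearMap.finrank_range_add_finrank_ker G, hker, LinearMap.finrank_range_of_inj hFi,
      LinearMap.range_eq_top.2 hGs, finrank_top, hfn, hgn, add_comm]
  -- In odd degrees both outer terms vanish, so exactness kills the middle one.
  · have hodd : Odd n := Nat.odd_iff.2 hn
    rw [hf' n hodd] at hfn
    rw [hg' n hodd] at hgn
    simp only [hf' n hodd, hg' n hodd, add_zero]
    refine dims_zero_of_le fun z hz => ?_
    obtain ⟨b, hb, hzb⟩ := h2 z hz (cyc_le_bdry_of_dims_zero ⟨hgF, hgn⟩ (cyc_mono D.le_rfl hAB n hz))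
    have := bdry_mono hBD A.le_rfl n (cyc_le_bdry_of_dims_zero ⟨hfF, hfn⟩ hb)
    simpa using (bdry D A n).add_mem hzb this

end QComplex

end

noncomputable section

/-! ### Semisimplicial sets and their chains -/

/-- The cosimplicial identity between coface maps, from which the face relations of tuples and of
singular simplices follow. -/
theorem Fin.succAbove_succ_succAbove_of_le {n : ℕ} {i j : Fin (n + 2)} (h : i ≤ j) (k : Fin (n + 1)) :
    j.succ.succAbove (i.succAbove k) = i.castSucc.succAbove (j.succAbove k) := by
  dsimp [Fin.succAbove]
  rcases i with ⟨i, _⟩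
  rcases j with ⟨j, _⟩
  rcases k with ⟨k, _⟩
  split_ifs <;> · simp at * <;> lia

/-- A semisimplicial set. -/
structure SemiSimp where
  obj : ℕ → Type
  face : ∀ {n}, Fin (n + 2) → obj (n + 1) → obj n
  face_face : ∀ {n} (i j : Fin (n + 2)) (x : obj (n + 2)), i ≤ j →
    face i (face j.succ x) = face j (face i.castSucc x)

namespace SemiSimp

variable (S : SemiSimp) {S' : SemiSimp}

/-- The alternating sum of the faces. -/
def bd (n : ℕ) : (S.obj (n + 1) →₀ ℚ) →ₗ[ℚ] (S.obj n →₀ ℚ) :=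
  ∑ i : Fin (n + 2), (-1 : ℚ) ^ (i : ℕ) • Finsupp.lmapDomain ℚ ℚ (S.face i)

theorem bd_single (n : ℕ) (x : S.obj (n + 1)) (a : ℚ) :
    S.bd n (Finsupp.single x a) =
      ∑ i : Fin (n + 2), (-1 : ℚ) ^ (i : ℕ) • Finsupp.single (S.face i x) a := by
  simp [bd, LinearMap.sum_apply]

theorem bd_bd_single (n : ℕ) (x : S.obj (n + 2)) (a : ℚ) :
    S.bd n (S.bd (n + 1) (Finsupp.single x a)) = 0 := by
  simp only [bd_single, map_sum, map_smul, Finset.smul_sum, smul_smul]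
  rw [← Finset.sum_product']
  let P := Fin (n + 3) × Fin (n + 2)
  let T : Finset P := {ij : P | (ij.1 : ℕ) ≤ (ij.2 : ℕ)}
  rw [Finset.univ_product_univ, ← Finset.sum_add_sum_compl T, ← eq_neg_iff_add_eq_zero,
    ← Finset.sum_neg_distrib]
  -- The face relation matches the term (i, j) with i ≤ j to the term (j + 1, i), which has the
  -- opposite sign.
  let φ : ∀ ij : P, ij ∈ T → P := fun ij hij =>
    (ij.2.succ, Fin.castLT ij.1 (lt_of_le_of_lt (Finset.mem_filter.mp hij).right (Fin.is_lt ij.2)))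
  apply Finset.sum_bij φ
  · intro ij hij
    simp_rw [T, φ, Finset.compl_filter, Finset.mem_filter_univ, Fin.val_succ,
      Fin.val_castLT] at hij ⊢
    lia
  · rintro ⟨i, j⟩ hij ⟨i', j'⟩ hij' h
    rw [Prod.mk_inj]
    exact ⟨by simpa [φ, Fin.castSucc_castLT] using! congr_arg Fin.castSucc (congr_arg Prod.snd h),
      by simpa [φ] using! congr_arg Prod.fst h⟩
  · rintro ⟨i', j'⟩ hij'
    simp_rw [T, Finset.compl_filter, Finset.mem_filter_univ, not_le] at hij'
    refine ⟨(Fin.castSucc j', i'.pred <| ?_), ?_, ?_⟩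
    · rintro rfl
      simp only [Fin.val_zero, not_lt_zero] at hij'
    · simpa [T] using! Nat.le_sub_one_of_lt hij'
    · simp only [φ, Fin.castLT_castSucc, Fin.succ_pred]
  · rintro ⟨i, j⟩ hij
    have hij' : (i : ℕ) ≤ j := by simpa [T] using! hij
    have key := S.face_face (i.castLT (hij'.trans_lt j.2)) j x hij'
    rw [Fin.castSucc_castLT] at key
    dsimp [φ]
    rw [← key, ← neg_smul]
    congr 1
    ring

theorem bd_bd (n : ℕ) (c : S.obj (n + 2) →₀ ℚ) : S.bd n (S.bd (n + 1) c) = 0 := by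
  have : S.bd n ∘ₗ S.bd (n + 1) = 0 := Finsupp.lhom_ext fun x a => S.bd_bd_single n x a
  exact LinearMap.congr_fun this c

/-- The chain complex of a semisimplicial set. -/
abbrev complex : QComplex where
  C n := S.obj n →₀ ℚ
  d n := match n with
    | 0 => 0
    | n + 1 => S.bd n
  d_zero := rfl
  d_d n x := match n with
    | 0 => rfl
    | 1 => rfl
    | n + 2 => S.bd_bd n x

@[simp] theorem complex_dS (n : ℕ) : S.complex.dS n = S.bd n := rfl

variable {S}

/-- The subcomplex spanned by a family of simplices stable under faces. -/
def subcomplex (A : ∀ n, Set (S.obj n)) (hA : ∀ n (i : Fin (n + 2)) x, x ∈ A (n + 1) → S.face i x ∈ A n) :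
    S.complex.Sub where
  S n := Finsupp.supported ℚ ℚ (A n)
  d_mem n x hx := by
    cases n with
    | zero => exact zero_mem _
    | succ n =>
      rw [Finsupp.supported_eq_span_single] at hx
      change S.bd n x ∈ Finsupp.supported ℚ ℚ (A n)
      induction hx using Submodule.span_induction with
      | mem x h =>
        obtain ⟨y, hy, rfl⟩ := h
        rw [bd_single]
        exact Submodule.sum_mem _ fun i _ => Submodule.smul_mem _ _
          (Finsupp.single_mem_supported _ _ (hA n i y hy))
      | zero => simp
      | add x y _ _ hx hy => rw [map_add]; exact add_mem hx hy
      | smul a x _ hx => rw [map_smul]; exact Submodule.smul_mem _ _ hx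

/-- Maps commuting with faces commute with the differential. -/
theorem bd_lmapDomain (f : ∀ n, S.obj n → S'.obj n)
    (hf : ∀ n (i : Fin (n + 2)) x, f n (S.face i x) = S'.face i (f (n + 1) x)) (n : ℕ)
    (c : S.obj (n + 1) →₀ ℚ) :
    S'.bd n (Finsupp.lmapDomain ℚ ℚ (f (n + 1)) c) = Finsupp.lmapDomain ℚ ℚ (f n) (S.bd n c) := by
  have : S'.bd n ∘ₗ Finsupp.lmapDomain ℚ ℚ (f (n + 1)) =
      Finsupp.lmapDomain ℚ ℚ (f n) ∘ₗ S.bd n := by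
    refine Finsupp.lhom_ext fun x a => ?_
    rw [LinearMap.comp_apply, LinearMap.comp_apply, bd_single, map_sum, Finsupp.lmapDomain_apply,
      Finsupp.mapDomain_single, bd_single]
    refine Finset.sum_congr rfl fun i _ => ?_
    rw [map_smul, Finsupp.lmapDomain_apply, Finsupp.mapDomain_single, hf]
  exact LinearMap.congr_fun this c

end SemiSimp

/-- A linear map sends chains supported on `A` to a submodule as soon as it does so on simplices. -/
theorem Finsupp.map_mem_of_supported {α M : Type*} [AddCommGroup M] [Module ℚ M]
    (f : (α →₀ ℚ) →ₗ[ℚ] M) (N : Submodule ℚ M) (A : Set α)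
    (h : ∀ x ∈ A, f (Finsupp.single x 1) ∈ N) {c : α →₀ ℚ} (hc : c ∈ Finsupp.supported ℚ ℚ A) :
    f c ∈ N := by
  have : Finsupp.supported ℚ ℚ A ≤ N.comap f := by
    rw [Finsupp.supported_eq_span_single, Submodule.span_le]
    rintro _ ⟨x, hx, rfl⟩
    exact h x hx
  exact this hc

/-! ### Linear chains -/

/-- The semisimplicial set of tuples of vertices in `V`. -/
abbrev tuples (V : Type) : SemiSimp where
  obj n := Fin (n + 1) → V
  face i w := w ∘ i.succAbove
  face_face i j w h := by
    funext k
    simp only [Function.comp_apply]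
    rw [Fin.succAbove_succ_succAbove_of_le h]

/-- Linear chains. -/
abbrev LC (V : Type) (n : ℕ) : Type := (Fin (n + 1) → V) →₀ ℚ

namespace LC

variable {V W W' : Type}

/-- The differential of linear chains. -/
abbrev bd (n : ℕ) : LC V (n + 1) →ₗ[ℚ] LC V n := (tuples V).bd n

theorem bd_single (n : ℕ) (w : Fin (n + 2) → V) (a : ℚ) :
    bd n (Finsupp.single w a) =
      ∑ i : Fin (n + 2), (-1 : ℚ) ^ (i : ℕ) • Finsupp.single (w ∘ i.succAbove) a :=
  (tuples V).bd_single n w a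

theorem bd_bd (n : ℕ) (c : LC V (n + 2)) : bd n (bd (n + 1) c) = 0 := (tuples V).bd_bd n c

/-- The map induced by a map of vertices. -/
def map (f : V → W) (n : ℕ) : LC V n →ₗ[ℚ] LC W n := Finsupp.lmapDomain ℚ ℚ (f ∘ ·)

@[simp] theorem map_single (f : V → W) (n : ℕ) (w : Fin (n + 1) → V) (a : ℚ) :
    map f n (Finsupp.single w a) = Finsupp.single (f ∘ w) a := by
  simp [map]

theorem bd_map (f : V → W) (n : ℕ) (c : LC V (n + 1)) : bd n (map f (n + 1) c) = map f n (bd n c) :=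
  SemiSimp.bd_lmapDomain (S := tuples V) (S' := tuples W) (fun _ => (f ∘ ·)) (fun _ _ _ => rfl) n c

/-- The augmentation. -/
def aug : LC V 0 →ₗ[ℚ] ℚ := Finsupp.linearCombination ℚ (fun _ => 1)

@[simp] theorem aug_single (w : Fin 1 → V) (a : ℚ) : aug (Finsupp.single w a) = a := by
  simp [aug]

theorem aug_bd (c : LC V 1) : aug (bd 0 c) = 0 := by
  have : aug ∘ₗ bd (V := V) 0 = 0 := by
    refine Finsupp.lhom_ext fun x a => ?_
    rw [LinearMap.comp_apply, bd_single, map_sum]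
    simp only [map_smul, aug_single]
    simp
  exact LinearMap.congr_fun this c

/-- The cone with apex `b`. -/
def cone (b : V) (n : ℕ) : LC V n →ₗ[ℚ] LC V (n + 1) :=
  Finsupp.lmapDomain ℚ ℚ (fun w => (Fin.cons b w : Fin (n + 2) → V))

@[simp] theorem cone_single (b : V) (n : ℕ) (w : Fin (n + 1) → V) (a : ℚ) :
    cone b n (Finsupp.single w a) = Finsupp.single (Fin.cons b w : Fin (n + 2) → V) a := by
  simp [cone]

theorem cons_comp_succ {n : ℕ} (b : V) (w : Fin (n + 1) → V) :
    (Fin.cons b w : Fin (n + 2) → V) ∘ Fin.succ = w := by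
  funext k
  simp

theorem cons_comp_succ_succAbove {n : ℕ} (b : V) (w : Fin (n + 2) → V) (i : Fin (n + 2)) :
    (Fin.cons b w : Fin (n + 3) → V) ∘ i.succ.succAbove = Fin.cons b (w ∘ i.succAbove) := by
  funext k
  refine Fin.cases ?_ (fun k => ?_) k
  · simp
  · simp [Fin.succ_succAbove_succ]

/-- Deleting the apex returns the simplex; deleting another vertex gives the cone over a face, with
the sign shifted by one. -/
theorem bd_cone_succ (b : V) (n : ℕ) (c : LC V (n + 1)) :
    bd (n + 1) (cone b (n + 1) c) = c - cone b n (bd n c) := by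
  have : bd (n + 1) ∘ₗ cone b (n + 1) = LinearMap.id - cone b n ∘ₗ bd n := by
    refine Finsupp.lhom_ext fun w a => ?_
    rw [LinearMap.comp_apply, cone_single, bd_single, LinearMap.sub_apply, LinearMap.comp_apply,
      bd_single, Fin.sum_univ_succ]
    simp only [LinearMap.id_apply, map_sum, map_smul, cone_single, Fin.val_zero, pow_zero, one_smul, Fin.succAbove_zero, Fin.val_succ, pow_succ,
      mul_neg_one, neg_smul, Finset.sum_neg_distrib, cons_comp_succ_succAbove, cons_comp_succ,
      sub_eq_add_neg]
  exact LinearMap.congr_fun this c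

/-- For a single vertex the second face of the cone is the apex itself, whence the correction by the
augmentation. -/
theorem bd_cone_zero (b : V) (c : LC V 0) :
    bd 0 (cone b 0 c) = c - aug c • Finsupp.single (fun _ => b) 1 := by
  have : bd 0 ∘ₗ cone b 0 =
      LinearMap.id - (LinearMap.toSpanSingleton ℚ (LC V 0) (Finsupp.single (fun _ => b) 1)) ∘ₗ aug := by
    refine Finsupp.lhom_ext fun w a => ?_
    rw [LinearMap.comp_apply, cone_single, bd_single, LinearMap.sub_apply, LinearMap.comp_apply,
      aug_single, Fin.sum_univ_two]
    have h1 : (Fin.cons b w : Fin 2 → V) ∘ Fin.succAbove 0 = w := cons_comp_succ b w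
    have h2 : (Fin.cons b w : Fin 2 → V) ∘ Fin.succAbove 1 = fun _ => b := by
      funext k
      fin_cases k
      rfl
    simp [h2, sub_eq_add_neg]
  exact LinearMap.congr_fun this c

theorem map_cone (f : V → W) (b : V) (n : ℕ) (c : LC V n) :
    map f (n + 1) (cone b n c) = cone (f b) n (map f n c) := by
  have : map f (n + 1) ∘ₗ cone b n = cone (f b) n ∘ₗ map f n := by
    refine Finsupp.lhom_ext fun w a => ?_
    simp only [LinearMap.comp_apply, cone_single, map_single]
    congr 1
    funext k
    refine Fin.cases ?_ (fun k => ?_) k <;> simp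
  exact LinearMap.congr_fun this c

/-! #### Cone homotopies -/

/-- A homotopy from `0` to `D`, built by coning off with apices `b`. -/
def htpy (D : ∀ n, LC V n →ₗ[ℚ] LC W n) (b : ∀ n, (Fin (n + 1) → V) → W) :
    ∀ n, LC V n →ₗ[ℚ] LC W (n + 1)
  | 0 => Finsupp.linearCombination ℚ fun w => cone (b 0 w) 0 (D 0 (Finsupp.single w 1))
  | n + 1 => Finsupp.linearCombination ℚ fun w => cone (b (n + 1) w) (n + 1)
      (D (n + 1) (Finsupp.single w 1) - htpy D b n (bd n (Finsupp.single w 1)))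

theorem htpy_zero_single (D : ∀ n, LC V n →ₗ[ℚ] LC W n) (b : ∀ n, (Fin (n + 1) → V) → W)
    (w : Fin 1 → V) : htpy D b 0 (Finsupp.single w 1) = cone (b 0 w) 0 (D 0 (Finsupp.single w 1)) := by
  simp [htpy]

theorem htpy_succ_single (D : ∀ n, LC V n →ₗ[ℚ] LC W n) (b : ∀ n, (Fin (n + 1) → V) → W) (n : ℕ)
    (w : Fin (n + 2) → V) : htpy D b (n + 1) (Finsupp.single w 1) = cone (b (n + 1) w) (n + 1)
      (D (n + 1) (Finsupp.single w 1) - htpy D b n (bd n (Finsupp.single w 1))) := by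
  simp [htpy]

theorem ext_single {M : Type*} [AddCommGroup M] [Module ℚ M] {α : Type*} {f g : (α →₀ ℚ) →ₗ[ℚ] M}
    (h : ∀ x, f (Finsupp.single x 1) = g (Finsupp.single x 1)) : f = g := by
  refine Finsupp.lhom_ext fun x a => ?_
  rw [show Finsupp.single x a = a • Finsupp.single x (1 : ℚ) by simp, map_smul, map_smul, h]

theorem bd_htpy_zero {D : ∀ n, LC V n →ₗ[ℚ] LC W n} (b : ∀ n, (Fin (n + 1) → V) → W)
    (h0 : ∀ c, aug (D 0 c) = 0) (c : LC V 0) : bd 0 (htpy D b 0 c) = D 0 c := by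
  have : bd 0 ∘ₗ htpy D b 0 = D 0 := ext_single fun w => by
    rw [LinearMap.comp_apply, htpy_zero_single, bd_cone_zero, h0, zero_smul, sub_zero]
  exact LinearMap.congr_fun this c

/-- The acyclic-models argument: by the formula one degree lower, D - h∂ takes values in cycles, and
the cone over a cycle of positive degree is a primitive of it. -/
theorem bd_htpy_succ {D : ∀ n, LC V n →ₗ[ℚ] LC W n} (b : ∀ n, (Fin (n + 1) → V) → W)
    (h0 : ∀ c, aug (D 0 c) = 0) (hD : ∀ n c, bd n (D (n + 1) c) = D n (bd n c)) (n : ℕ)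
    (c : LC V (n + 1)) : bd (n + 1) (htpy D b (n + 1) c) = D (n + 1) c - htpy D b n (bd n c) := by
  have : bd (n + 1) ∘ₗ htpy D b (n + 1) = D (n + 1) - htpy D b n ∘ₗ bd n := by
    refine ext_single fun w => ?_
    rw [LinearMap.comp_apply, htpy_succ_single, bd_cone_succ, LinearMap.sub_apply,
      LinearMap.comp_apply, map_sub, hD]
    have : bd n (htpy D b n (bd n (Finsupp.single w 1))) = D n (bd n (Finsupp.single w 1)) := by
      cases n with
      | zero => rw [bd_htpy_zero b h0]
      | succ n => rw [bd_htpy_succ b h0 hD n, bd_bd, map_zero, sub_zero]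
    rw [this, sub_self, map_zero, sub_zero]
  exact LinearMap.congr_fun this c

/-- Natural data D and naturally chosen apices give a natural homotopy, by the same recursion on
both sides. Naturality is what lets linear operators pass to singular chains. -/
theorem map_htpy {V' : Type} {D : ∀ n, LC V n →ₗ[ℚ] LC W n} {b : ∀ n, (Fin (n + 1) → V) → W}
    {D' : ∀ n, LC V' n →ₗ[ℚ] LC W' n} {b' : ∀ n, (Fin (n + 1) → V') → W'} (f : V → V') (g : W → W')
    (hD : ∀ n c, map g n (D n c) = D' n (map f n c)) (hb : ∀ n w, g (b n w) = b' n (f ∘ w)) (n : ℕ)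
    (c : LC V n) : map g (n + 1) (htpy D b n c) = htpy D' b' n (map f n c) := by
  have : map g (n + 1) ∘ₗ htpy D b n = htpy D' b' n ∘ₗ map f n := by
    refine ext_single fun w => ?_
    rw [LinearMap.comp_apply, LinearMap.comp_apply, map_single]
    cases n with
    | zero => rw [htpy_zero_single, htpy_zero_single, map_cone, hD, map_single, hb]
    | succ n =>
      rw [htpy_succ_single, htpy_succ_single, map_cone, map_sub, hD, map_single, hb,
        map_htpy f g hD hb n, ← bd_map, map_single]
  exact LinearMap.congr_fun this c

/-! #### Subdivision -/

/-- Subdivision with respect to a choice of centres. -/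
def sd (b : ∀ n, (Fin (n + 1) → V) → V) : ∀ n, LC V n →ₗ[ℚ] LC V n
  | 0 => LinearMap.id
  | n + 1 => Finsupp.linearCombination ℚ fun w => cone (b (n + 1) w) n
      (sd b n (bd n (Finsupp.single w 1)))

theorem sd_succ_single (b : ∀ n, (Fin (n + 1) → V) → V) (n : ℕ) (w : Fin (n + 2) → V) :
    sd b (n + 1) (Finsupp.single w 1) =
      cone (b (n + 1) w) n (sd b n (bd n (Finsupp.single w 1))) := by
  simp [sd]

/-- The subdivided boundary is a cycle by induction (of augmentation zero in the lowest case), so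
the boundary of its cone is itself. -/
theorem bd_sd (b : ∀ n, (Fin (n + 1) → V) → V) (n : ℕ) (c : LC V (n + 1)) :
    bd n (sd b (n + 1) c) = sd b n (bd n c) := by
  have : bd n ∘ₗ sd b (n + 1) = sd b n ∘ₗ bd n := by
    refine ext_single fun w => ?_
    rw [LinearMap.comp_apply, sd_succ_single, LinearMap.comp_apply]
    cases n with
    | zero =>
      rw [bd_cone_zero]
      simp only [sd, LinearMap.id_apply, aug_bd, zero_smul, sub_zero]
    | succ n => rw [bd_cone_succ, bd_sd b n, bd_bd, map_zero, map_zero, sub_zero]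
  exact LinearMap.congr_fun this c

theorem map_sd {b : ∀ n, (Fin (n + 1) → V) → V} {b' : ∀ n, (Fin (n + 1) → W) → W} (f : V → W)
    (hb : ∀ n w, f (b n w) = b' n (f ∘ w)) (n : ℕ) (c : LC V n) :
    map f n (sd b n c) = sd b' n (map f n c) := by
  have : map f n ∘ₗ sd b n = sd b' n ∘ₗ map f n := by
    refine ext_single fun w => ?_
    rw [LinearMap.comp_apply, LinearMap.comp_apply, map_single]
    cases n with
    | zero => simp [sd]
    | succ n =>
      rw [sd_succ_single, sd_succ_single, map_cone, hb, map_sd f hb n, ← bd_map, map_single]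
  exact LinearMap.congr_fun this c

end LC

end

noncomputable section

/-! ### Singular chains -/

/-- The affine map of simplices with given images of the vertices. -/
def affineSimplex {ι κ : Type} [Fintype ι] [Fintype κ] (w : κ → stdSimplex ℝ ι) :
    C(stdSimplex ℝ κ, stdSimplex ℝ ι) where
  toFun t := ⟨∑ k, t k • (w k).1, (convex_stdSimplex ℝ ι).sum_mem (fun k _ => stdSimplex.zero_le t k)
    (stdSimplex.sum_eq_one t) (fun k _ => (w k).2)⟩
  continuous_toFun := by
    refine Continuous.subtype_mk (continuous_finsetSum _ fun k _ => ?_) _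
    exact ((continuous_apply k).comp continuous_subtype_val).smul continuous_const

section affineSimplex

variable {ι κ μ : Type} [Fintype ι] [Fintype κ] [Fintype μ]

theorem affineSimplex_apply (w : κ → stdSimplex ℝ ι) (t : stdSimplex ℝ κ) (x : ι) :
    affineSimplex w t x = ∑ k, t k * w k x := by
  change (∑ k, t k • (w k).1) x = _
  rw [Finset.sum_apply]
  rfl

theorem affineSimplex_comp (w : κ → stdSimplex ℝ ι) (u : μ → stdSimplex ℝ κ) :
    (affineSimplex w).comp (affineSimplex u) = affineSimplex (affineSimplex w ∘ u) := by
  ext t x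
  simp only [ContinuousMap.comp_apply, affineSimplex_apply, Function.comp_apply, Finset.sum_mul,
    Finset.mul_sum]
  rw [Finset.sum_comm]
  simp only [mul_assoc]

variable [DecidableEq κ]

@[simp] theorem affineSimplex_vertex (w : κ → stdSimplex ℝ ι) (k : κ) :
    affineSimplex w (stdSimplex.vertex k) = w k := by
  ext x
  simp [affineSimplex_apply, Pi.single_apply]

theorem affineSimplex_comp_vertex (w : κ → stdSimplex ℝ ι) :
    affineSimplex w ∘ stdSimplex.vertex = w := by
  funext k
  simp

theorem affineSimplex_id : affineSimplex (stdSimplex.vertex (S := ℝ) (X := κ)) = ContinuousMap.id _ := by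
  ext t x
  simp [affineSimplex_apply, Pi.single_apply]

theorem affineSimplex_comp_face (w : κ → stdSimplex ℝ ι) (f : μ → κ) :
    (affineSimplex w).comp (affineSimplex (stdSimplex.vertex ∘ f)) = affineSimplex (w ∘ f) := by
  rw [affineSimplex_comp]
  congr 1
  funext k
  simp

/-- Links the faces used here to `stdSimplex.map`, through which the faces of the singular
simplicial set are defined. -/
theorem affineSimplex_vertex_comp (f : μ → κ) :
    (affineSimplex (stdSimplex.vertex ∘ f) : stdSimplex ℝ μ → stdSimplex ℝ κ) = stdSimplex.map f := by
  funext t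
  ext x
  rw [affineSimplex_apply]
  simp only [Function.comp_apply, stdSimplex.vertex_coe, stdSimplex.map_coe,
    FunOnFinite.linearMap_apply_apply, Finset.sum_filter, Pi.single_apply]
  refine Finset.sum_congr rfl fun k _ => ?_
  by_cases h : f k = x
  · simp [h]
  · simp [h, Ne.symm h]

end affineSimplex

/-- The standard simplex of dimension `n`. -/
abbrev Simplex (n : ℕ) : Type := stdSimplex ℝ (Fin (n + 1))

/-- The singular simplices of a space. -/
abbrev sing (X : Type) [TopologicalSpace X] : SemiSimp where
  obj n := C(Simplex n, X)
  face i σ := σ.comp (affineSimplex (stdSimplex.vertex ∘ i.succAbove))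
  face_face i j σ h := by
    rw [ContinuousMap.comp_assoc, ContinuousMap.comp_assoc, affineSimplex_comp_face,
      affineSimplex_comp_face]
    congr 2
    funext k
    simp only [Function.comp_apply]
    rw [Fin.succAbove_succ_succAbove_of_le h]

/-- Singular chains. -/
abbrev SC (X : Type) [TopologicalSpace X] (n : ℕ) : Type := C(Simplex n, X) →₀ ℚ

namespace SC

variable {X Y Z : Type} [TopologicalSpace X] [TopologicalSpace Y] [TopologicalSpace Z]

/-- The differential of singular chains. -/
abbrev bd (n : ℕ) : SC X (n + 1) →ₗ[ℚ] SC X n := (sing X).bd n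

/-- The map induced by a continuous map. -/
def map (f : C(X, Y)) (n : ℕ) : SC X n →ₗ[ℚ] SC Y n := Finsupp.lmapDomain ℚ ℚ f.comp

@[simp] theorem map_single (f : C(X, Y)) (n : ℕ) (σ : C(Simplex n, X)) (a : ℚ) :
    map f n (Finsupp.single σ a) = Finsupp.single (f.comp σ) a := by
  simp [map]

theorem bd_map (f : C(X, Y)) (n : ℕ) (c : SC X (n + 1)) : bd n (map f (n + 1) c) = map f n (bd n c) :=
  SemiSimp.bd_lmapDomain (S := sing X) (S' := sing Y) (fun _ => f.comp)
    (fun _ _ _ => rfl) n c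

theorem map_map (g : C(Y, Z)) (f : C(X, Y)) (n : ℕ) (c : SC X n) :
    map g n (map f n c) = map (g.comp f) n c := by
  have : map g n ∘ₗ map f n = map (g.comp f) n := by
    refine LC.ext_single fun σ => ?_
    simp [ContinuousMap.comp_assoc]
  exact LinearMap.congr_fun this c

/-- The chain of singular simplices of `X` obtained from linear chains in the domain of `σ`. -/
def realize {ι : Type} [Fintype ι] (σ : C(stdSimplex ℝ ι, X)) (n : ℕ) :
    LC (stdSimplex ℝ ι) n →ₗ[ℚ] SC X n :=
  Finsupp.lmapDomain ℚ ℚ (fun w => σ.comp (affineSimplex w))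

section realize

variable {ι κ : Type} [Fintype ι] [Fintype κ]

@[simp] theorem realize_single (σ : C(stdSimplex ℝ ι, X)) (n : ℕ) (w : Fin (n + 1) → stdSimplex ℝ ι)
    (a : ℚ) : realize σ n (Finsupp.single w a) = Finsupp.single (σ.comp (affineSimplex w)) a := by
  simp [realize]

theorem bd_realize (σ : C(stdSimplex ℝ ι, X)) (n : ℕ) (c : LC (stdSimplex ℝ ι) (n + 1)) :
    bd n (realize σ (n + 1) c) = realize σ n (LC.bd n c) := by
  refine SemiSimp.bd_lmapDomain (S := tuples (stdSimplex ℝ ι)) (S' := sing X)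
    (fun _ w => σ.comp (affineSimplex w)) (fun n i w => ?_) n c
  simp only [ContinuousMap.comp_assoc, affineSimplex_comp_face]

theorem realize_comp (σ : C(stdSimplex ℝ ι, X)) (u : κ → stdSimplex ℝ ι) (n : ℕ)
    (c : LC (stdSimplex ℝ κ) n) :
    realize (σ.comp (affineSimplex u)) n c = realize σ n (LC.map (affineSimplex u) n c) := by
  have : realize (σ.comp (affineSimplex u)) n = realize σ n ∘ₗ LC.map (affineSimplex u) n := by
    refine LC.ext_single fun w => ?_
    simp [ContinuousMap.comp_assoc, affineSimplex_comp]
  exact LinearMap.congr_fun this c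

theorem realize_vertex {n : ℕ} (σ : C(Simplex n, X)) :
    realize σ n (Finsupp.single stdSimplex.vertex 1) = Finsupp.single σ 1 := by
  simp [affineSimplex_id]

end realize

/-- The singular simplices with image in `A`. -/
def sub (A : Set X) : (sing X).complex.Sub :=
  SemiSimp.subcomplex (S := sing X) (fun n => {σ : C(Simplex n, X) | ∀ t, σ t ∈ A})
    (fun _ _ _ h _ => h _)

theorem sub_S (A : Set X) (n : ℕ) :
    (sub A).S n = Finsupp.supported ℚ ℚ {σ : C(Simplex n, X) | ∀ t, σ t ∈ A} := rfl

theorem single_mem_sub {A : Set X} {n : ℕ} {σ : C(Simplex n, X)} (h : ∀ t, σ t ∈ A) (a : ℚ) :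
    (Finsupp.single σ a : SC X n) ∈ (sub A).S n :=
  Finsupp.single_mem_supported _ _ h

theorem map_mem_of_mem_sub {A : Set X} {n : ℕ} {M : Type*} [AddCommGroup M] [Module ℚ M]
    (f : SC X n →ₗ[ℚ] M) (N : Submodule ℚ M)
    (h : ∀ σ : C(Simplex n, X), (∀ t, σ t ∈ A) → f (Finsupp.single σ 1) ∈ N) {c : SC X n}
    (hc : c ∈ (sub A).S n) : f c ∈ N :=
  Finsupp.map_mem_of_supported f N _ h hc

theorem sub_mono {A B : Set X} (h : A ⊆ B) : sub A ≤ sub B :=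
  fun _ => Finsupp.supported_mono fun _ hσ t => h (hσ t)

theorem sub_inter (A B : Set X) : sub (A ∩ B) = sub A ⊓ sub B := by
  have : ∀ n, (sub (A ∩ B)).S n = (sub A ⊓ sub B).S n := fun n => by
    change _ = (sub A).S n ⊓ (sub B).S n
    rw [sub_S, sub_S, sub_S, ← Finsupp.supported_inter]
    congr 1
    ext σ
    exact forall_and
  cases h : sub (A ∩ B)
  cases h' : sub A ⊓ sub B
  congr 1
  funext n
  simpa [h, h'] using this n

theorem map_mem_sub {A : Set X} {B : Set Y} (f : C(X, Y)) (h : ∀ x ∈ A, f x ∈ B) {n : ℕ} {c : SC X n}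
    (hc : c ∈ (sub A).S n) : map f n c ∈ (sub B).S n :=
  map_mem_of_mem_sub _ _ (fun σ hσ => by
    rw [map_single]
    exact single_mem_sub (fun t => h _ (hσ t)) 1) hc

theorem realize_mem_sub {ι : Type} [Fintype ι] {A : Set X} (σ : C(stdSimplex ℝ ι, X)) (h : ∀ t, σ t ∈ A)
    {n : ℕ} (c : LC (stdSimplex ℝ ι) n) : realize σ n c ∈ (sub A).S n := by
  have hc : c ∈ Finsupp.supported ℚ ℚ (Set.univ : Set (Fin (n + 1) → stdSimplex ℝ ι)) := by simp
  refine Finsupp.map_mem_of_supported (realize σ n) ((sub A).S n) _ (fun w _ => ?_) hc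
  rw [realize_single]
  exact single_mem_sub (fun t => h _) 1

open QComplex

theorem map_mem_cyc {A B : Set X} {A' B' : Set Y} (f : C(X, Y)) (hB : ∀ x ∈ B, f x ∈ B')
    (hA : ∀ x ∈ A, f x ∈ A') {n : ℕ} {c : SC X n} (hc : c ∈ cyc (sub B) (sub A) n) :
    map f n c ∈ cyc (sub B') (sub A') n := by
  cases n with
  | zero => exact mem_cyc_zero.2 (map_mem_sub f hB (mem_cyc_zero.1 hc))
  | succ n =>
    refine mem_cyc_succ.2 ⟨map_mem_sub f hB hc.1, ?_⟩
    change bd n (map f (n + 1) c) ∈ _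
    rw [bd_map]
    exact map_mem_sub f hA hc.2

theorem map_mem_bdry {A B : Set X} {A' B' : Set Y} (f : C(X, Y)) (hB : ∀ x ∈ B, f x ∈ B')
    (hA : ∀ x ∈ A, f x ∈ A') {n : ℕ} {c : SC X n} (hc : c ∈ bdry (sub B) (sub A) n) :
    map f n c ∈ bdry (sub B') (sub A') n := by
  obtain ⟨a, ha, b, hb, rfl⟩ := mem_bdry.1 hc
  refine mem_bdry.2 ⟨map f n a, map_mem_sub f hA ha, map f (n + 1) b, map_mem_sub f hB hb, ?_⟩
  rw [map_add]
  congr 1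
  exact bd_map f n b

/-! #### Homotopy invariance -/

section prism

/-- The difference of the two ends of a prism. -/
def ends (V : Type) (n : ℕ) : LC V n →ₗ[ℚ] LC (V × Bool) n :=
  LC.map (·, true) n - LC.map (·, false) n

/-- The prism operator on linear chains. -/
abbrev linPrism (V : Type) (n : ℕ) : LC V n →ₗ[ℚ] LC (V × Bool) (n + 1) :=
  LC.htpy (ends V) (fun _ w => (w 0, false)) n

theorem aug_ends (V : Type) (c : LC V 0) : LC.aug (ends V 0 c) = 0 := by
  have : LC.aug ∘ₗ ends V 0 = 0 := by
    refine LC.ext_single fun w => ?_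
    simp [ends]
  exact LinearMap.congr_fun this c

theorem bd_ends (V : Type) (n : ℕ) (c : LC V (n + 1)) :
    LC.bd n (ends V (n + 1) c) = ends V n (LC.bd n c) := by
  simp only [ends, LinearMap.sub_apply, map_sub, LC.bd_map]

/-- The apex `(w 0, false)` is natural in `w`. -/
theorem map_linPrism {V W : Type} (f : V → W) (n : ℕ) (c : LC V n) :
    LC.map (Prod.map f id) (n + 1) (linPrism V n c) = linPrism W n (LC.map f n c) := by
  refine LC.map_htpy f (Prod.map f id) (fun n c => ?_) (fun n w => rfl) n c
  have : LC.map (Prod.map f id) n ∘ₗ ends V n = ends W n ∘ₗ LC.map f n := by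
    refine LC.ext_single fun w => ?_
    simp [ends]
    rfl
  exact LinearMap.congr_fun this c

/-- The total weight of the second end in a prism. -/
def endWeight {ι : Type} [Fintype ι] : C(stdSimplex ℝ (ι × Bool), unitInterval) where
  toFun s := ⟨∑ i, s (i, true), Finset.sum_nonneg fun i _ => stdSimplex.zero_le s _, by
    rw [← stdSimplex.sum_eq_one s, Fintype.sum_prod_type]
    refine Finset.sum_le_sum fun i _ => ?_
    simp [stdSimplex.zero_le]⟩
  continuous_toFun := Continuous.subtype_mk (continuous_finsetSum _ fun i _ =>
    (continuous_apply (i, true)).comp continuous_subtype_val) _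

theorem endWeight_apply {ι : Type} [Fintype ι] (s : stdSimplex ℝ (ι × Bool)) :
    (endWeight s : ℝ) = ∑ i, s (i, true) := rfl

variable {f g : C(X, Y)} (H : f.Homotopy g)

/-- The restriction of a homotopy to a simplex, as a map on a prism. -/
def prismMap {ι : Type} [Fintype ι] [DecidableEq ι] (σ : C(stdSimplex ℝ ι, X)) :
    C(stdSimplex ℝ (ι × Bool), Y) :=
  H.toContinuousMap.comp
    (endWeight.prodMk (σ.comp (affineSimplex fun p : ι × Bool => stdSimplex.vertex p.1)))

theorem prismMap_apply {ι : Type} [Fintype ι] [DecidableEq ι] (σ : C(stdSimplex ℝ ι, X))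
    (s : stdSimplex ℝ (ι × Bool)) : prismMap H σ s =
      H (endWeight s, σ (affineSimplex (fun p : ι × Bool => stdSimplex.vertex p.1) s)) := rfl

/-- The homotopy is spread over the whole simplex on the vertex set ι × Bool, so no triangulation of
a prism is needed. The weight of the second end and the projection to the base both respect vertex
maps. -/
theorem prismMap_comp {ι κ : Type} [Fintype ι] [Fintype κ] [DecidableEq ι] [DecidableEq κ]
    (σ : C(stdSimplex ℝ ι, X)) (u : κ → ι) :
    prismMap H (σ.comp (affineSimplex (stdSimplex.vertex ∘ u))) =
      (prismMap H σ).comp (affineSimplex (stdSimplex.vertex ∘ Prod.map u id)) := by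
  ext s
  simp only [ContinuousMap.comp_apply, prismMap_apply]
  congr 2
  · ext
    rw [endWeight_apply, endWeight_apply]
    simp only [affineSimplex_apply, Function.comp_apply, stdSimplex.vertex_coe, Pi.single_apply,
      mul_ite, mul_one, mul_zero]
    rw [Finset.sum_comm, Fintype.sum_prod_type]
    refine Finset.sum_congr rfl fun k _ => ?_
    simp [Prod.ext_iff]
  · change σ (((affineSimplex (stdSimplex.vertex ∘ u)).comp (affineSimplex _)) s) =
      σ (((affineSimplex _).comp (affineSimplex _)) s)
    rw [affineSimplex_comp, affineSimplex_comp]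
    congr 3
    funext p
    simp

theorem prismMap_end {n : ℕ} (σ : C(Simplex n, X)) (b : Bool) (t : Simplex n) :
    prismMap H σ (affineSimplex (fun k => stdSimplex.vertex (k, b)) t) =
      H (if b then 1 else 0, σ t) := by
  rw [prismMap_apply]
  congr 2
  · ext
    rw [endWeight_apply]
    simp only [affineSimplex_apply, stdSimplex.vertex_coe, Pi.single_apply, mul_ite, mul_one, mul_zero]
    rw [Finset.sum_comm]
    cases b
    · simp
    · simp
  · congr 1
    rw [← ContinuousMap.comp_apply, affineSimplex_comp]
    have : (affineSimplex fun p : Fin (n + 1) × Bool => stdSimplex.vertex (S := ℝ) p.1) ∘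
        (fun k => stdSimplex.vertex (k, b)) = stdSimplex.vertex := by
      funext k
      simp
    rw [this, affineSimplex_id]
    rfl

/-- The prism operator of a homotopy. -/
def prism (n : ℕ) : SC X n →ₗ[ℚ] SC Y (n + 1) :=
  Finsupp.linearCombination ℚ fun σ => realize (prismMap H σ) (n + 1)
    (LC.map stdSimplex.vertex (n + 1) (linPrism (Fin (n + 1)) n (Finsupp.single id 1)))

theorem prism_single {n : ℕ} (σ : C(Simplex n, X)) : prism H n (Finsupp.single σ 1) =
    realize (prismMap H σ) (n + 1)
      (LC.map stdSimplex.vertex (n + 1) (linPrism (Fin (n + 1)) n (Finsupp.single id 1))) := by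
  simp [prism]

/-- Compatibility of the prism operator with vertex maps of a simplex, in particular with faces; it
carries the linear homotopy formula over to singular chains. -/
theorem prism_realize {m n : ℕ} (σ : C(Simplex m, X)) (c : LC (Fin (m + 1)) n) :
    prism H n (realize σ n (LC.map stdSimplex.vertex n c)) =
      realize (prismMap H σ) (n + 1) (LC.map stdSimplex.vertex (n + 1) (linPrism _ n c)) := by
  have : prism H n ∘ₗ realize σ n ∘ₗ LC.map stdSimplex.vertex n =
      realize (prismMap H σ) (n + 1) ∘ₗ LC.map stdSimplex.vertex (n + 1) ∘ₗ linPrism _ n := by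
    refine LC.ext_single fun u => ?_
    simp only [LinearMap.comp_apply, LC.map_single, realize_single, prism_single]
    rw [prismMap_comp, realize_comp]
    have h : (Finsupp.single u 1 : LC (Fin (m + 1)) n) = LC.map u n (Finsupp.single id 1) := by simp
    rw [h, ← map_linPrism]
    congr 1
    generalize linPrism (Fin (n + 1)) n (Finsupp.single id 1) = c'
    have : LC.map (affineSimplex (stdSimplex.vertex (S := ℝ) ∘ Prod.map u (id : Bool → Bool))) (n + 1) ∘ₗ
          LC.map stdSimplex.vertex (n + 1) =
        LC.map stdSimplex.vertex (n + 1) ∘ₗ LC.map (Prod.map u id) (n + 1) := by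
      refine LC.ext_single fun (w : Fin (n + 2) → Fin (n + 1) × Bool) => ?_
      simp only [LinearMap.comp_apply, LC.map_single]
      congr 1
      funext k
      simp
    exact LinearMap.congr_fun this c'
  exact LinearMap.congr_fun this c

theorem realize_ends {n : ℕ} (σ : C(Simplex n, X)) :
    realize (prismMap H σ) n (LC.map stdSimplex.vertex n (ends _ n (Finsupp.single id 1))) =
      map g n (Finsupp.single σ 1) - map f n (Finsupp.single σ 1) := by
  simp only [ends, LinearMap.sub_apply, map_sub, LC.map_single, realize_single, map_single]
  congr 2
  · ext t
    have := prismMap_end H σ true t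
    rw [if_pos rfl, H.apply_one] at this
    exact this
  · ext t
    have := prismMap_end H σ false t
    rw [if_neg Bool.false_ne_true, H.apply_zero] at this
    exact this

theorem realize_vertex' {n : ℕ} (σ : C(Simplex n, X)) :
    realize σ n (LC.map stdSimplex.vertex n (Finsupp.single id 1)) = Finsupp.single σ 1 := by
  rw [LC.map_single]
  exact realize_vertex σ

theorem bd_prism_zero (c : SC X 0) : bd 0 (prism H 0 c) = map g 0 c - map f 0 c := by
  have : bd 0 ∘ₗ prism H 0 = map g 0 - map f 0 := by
    refine LC.ext_single fun σ => ?_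
    rw [LinearMap.comp_apply, prism_single, bd_realize, LC.bd_map, LC.bd_htpy_zero _ (aug_ends _),
      realize_ends]
    rfl
  exact LinearMap.congr_fun this c

theorem bd_prism_succ (n : ℕ) (c : SC X (n + 1)) :
    bd (n + 1) (prism H (n + 1) c) = map g (n + 1) c - map f (n + 1) c - prism H n (bd n c) := by
  have : bd (n + 1) ∘ₗ prism H (n + 1) = map g (n + 1) - map f (n + 1) - prism H n ∘ₗ bd n := by
    refine LC.ext_single fun σ => ?_
    rw [LinearMap.comp_apply, prism_single, bd_realize, LC.bd_map,
      LC.bd_htpy_succ _ (aug_ends _) (bd_ends _), map_sub, map_sub, realize_ends, ← prism_realize,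
      ← LC.bd_map, ← bd_realize, realize_vertex']
    rfl
  exact LinearMap.congr_fun this c

theorem prism_mem_sub {A : Set X} {B : Set Y} (h : ∀ x ∈ A, ∀ t, H (t, x) ∈ B) {n : ℕ} {c : SC X n}
    (hc : c ∈ (sub A).S n) : prism H n c ∈ (sub B).S (n + 1) :=
  map_mem_of_mem_sub _ _ (fun σ hσ => by
    rw [prism_single]
    exact realize_mem_sub _ (fun s => h _ (hσ _) _) _) hc

/-- Homotopy invariance for pairs: the prism formula writes the difference as a boundary in B' plus
the prism over the boundary of c, which lies in A'. -/
theorem map_sub_map_mem_bdry {A B : Set X} {A' B' : Set Y} (hB : ∀ x ∈ B, ∀ t, H (t, x) ∈ B')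
    (hA : ∀ x ∈ A, ∀ t, H (t, x) ∈ A') {n : ℕ} {c : SC X n} (hc : c ∈ cyc (sub B) (sub A) n) :
    map g n c - map f n c ∈ bdry (sub B') (sub A') n := by
  cases n with
  | zero =>
    rw [← bd_prism_zero H]
    exact dS_mem_bdry (prism_mem_sub H hB hc.1)
  | succ n =>
    have h := bd_prism_succ H n c
    rw [eq_sub_iff_add_eq] at h
    rw [← h]
    exact add_mem (dS_mem_bdry (prism_mem_sub H hB hc.1)) (mem_bdry_of_mem (prism_mem_sub H hA hc.2))

end prism

end SC

end

noncomputable section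

/-! ### Barycentric subdivision -/

section mesh

variable {ι κ : Type} [Fintype ι] [Fintype κ]

/-- The barycentre of a tuple of points of a simplex. -/
def bary (ι : Type) [Fintype ι] (n : ℕ) (w : Fin (n + 1) → stdSimplex ℝ ι) : stdSimplex ℝ ι :=
  affineSimplex w stdSimplex.barycenter

theorem affineSimplex_bary (u : κ → stdSimplex ℝ ι) (n : ℕ) (w : Fin (n + 1) → stdSimplex ℝ κ) :
    affineSimplex u (bary κ n w) = bary ι n (affineSimplex u ∘ w) := by
  rw [bary, bary, ← affineSimplex_comp]
  rfl

/-- Points in the convex hull of a tuple. -/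
def tupleHull {n : ℕ} (w : Fin (n + 1) → stdSimplex ℝ ι) : Set (stdSimplex ℝ ι) :=
  {x | (x : ι → ℝ) ∈ convexHull ℝ (Set.range fun k => (w k : ι → ℝ))}

/-- Tuples of diameter at most `r`. -/
def IsFine {n : ℕ} (r : ℝ) (w : Fin (n + 1) → stdSimplex ℝ ι) : Prop := ∀ i j, dist (w i) (w j) ≤ r

theorem affineSimplex_mem_of_convex {n : ℕ} (w : Fin (n + 1) → stdSimplex ℝ ι) {s : Set (ι → ℝ)}
    (hs : Convex ℝ s) (h : ∀ k, (w k : ι → ℝ) ∈ s) (t : Simplex n) : (affineSimplex w t : ι → ℝ) ∈ s :=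
  hs.sum_mem (fun k _ => stdSimplex.zero_le t k) (stdSimplex.sum_eq_one t) (fun k _ => h k)

theorem affineSimplex_mem_tupleHull {n : ℕ} (w : Fin (n + 1) → stdSimplex ℝ ι) (t : Simplex n) :
    affineSimplex w t ∈ tupleHull w :=
  affineSimplex_mem_of_convex w (convex_convexHull ℝ _) (fun k => subset_convexHull ℝ _ (Set.mem_range_self k)) t

/-- The difference of a vertex and the barycentre is the mean of n + 1 differences of vertices, one
of which is zero; this gives the factor n / (n + 1). Balls are convex, so the bound extends to the
hull. -/
theorem dist_bary_le {n : ℕ} {w : Fin (n + 1) → stdSimplex ℝ ι} {r : ℝ} (hw : IsFine r w)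
    {x : stdSimplex ℝ ι} (hx : x ∈ tupleHull w) : dist x (bary ι n w) ≤ n / (n + 1) * r := by
  have key : convexHull ℝ (Set.range fun k => (w k : ι → ℝ)) ⊆
      Metric.closedBall (bary ι n w : ι → ℝ) (n / (n + 1) * r) := by
    refine convexHull_min ?_ (convex_closedBall _ _)
    rintro _ ⟨k, rfl⟩
    have hn : ((n : ℝ) + 1) ≠ 0 := by positivity
    have h1 : (w k : ι → ℝ) - (bary ι n w : ι → ℝ) =
        ∑ j, ((n : ℝ) + 1)⁻¹ • ((w k : ι → ℝ) - (w j : ι → ℝ)) := by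
      have h2 : (bary ι n w : ι → ℝ) = ∑ j, ((n : ℝ) + 1)⁻¹ • (w j : ι → ℝ) := by
        change ∑ j, (stdSimplex.barycenter : stdSimplex ℝ (Fin (n + 1))) j • (w j : ι → ℝ) = _
        refine Finset.sum_congr rfl fun j _ => ?_
        congr 1
        exact (stdSimplex.barycenter_apply (𝕜 := ℝ) (X := Fin (n + 1)) j).trans (by simp)
      rw [h2]
      simp only [smul_sub, Finset.sum_sub_distrib, Finset.sum_const, Finset.card_univ,
        Fintype.card_fin]
      congr 1
      rw [← Nat.cast_smul_eq_nsmul ℝ, smul_smul]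
      push_cast
      rw [mul_inv_cancel₀ hn, one_smul]
    rw [Metric.mem_closedBall, dist_eq_norm, h1]
    calc ‖∑ j, ((n : ℝ) + 1)⁻¹ • ((w k : ι → ℝ) - (w j : ι → ℝ))‖
        ≤ ∑ j, ((n : ℝ) + 1)⁻¹ * (if k = j then 0 else r) := by
          refine norm_sum_le_of_le _ fun j _ => ?_
          rw [norm_smul, Real.norm_of_nonneg (by positivity)]
          refine mul_le_mul_of_nonneg_left ?_ (by positivity)
          split_ifs with h
          · simp [h]
          · rw [← dist_eq_norm]
            exact hw k j
      _ = n / (n + 1) * r := by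
          rw [← Finset.mul_sum, Finset.sum_ite, Finset.sum_const_zero, zero_add, Finset.sum_const,
            nsmul_eq_mul]
          have : (Finset.univ.filter fun j => ¬ k = j).card = n := by
            rw [show (Finset.univ.filter fun j => ¬ k = j) = Finset.univ.erase k by
              ext j; simp [eq_comm]]
            simp
          rw [this]
          ring
  exact key hx

theorem tupleHull_comp {m n : ℕ} (w : Fin (n + 1) → stdSimplex ℝ ι) (f : Fin (m + 1) → Fin (n + 1)) :
    tupleHull (w ∘ f) ⊆ tupleHull w := fun _ hx =>
  convexHull_mono (by rintro _ ⟨k, rfl⟩; exact ⟨f k, rfl⟩) hx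

/-- Each simplex of the subdivision is the barycentre followed by a simplex of a subdivided face.
Membership in the hull is carried through the induction because `dist_bary_le` needs it. -/
theorem sd_bary_single_mem (n : ℕ) (w : Fin (n + 1) → stdSimplex ℝ ι) {r : ℝ} (hr : 0 ≤ r)
    (hw : IsFine r w) : LC.sd (bary ι) n (Finsupp.single w 1) ∈ Finsupp.supported ℚ ℚ
      {u | (∀ j, u j ∈ tupleHull w) ∧ IsFine (n / (n + 1) * r) u} := by
  induction n with
  | zero =>
    refine Finsupp.single_mem_supported _ _ ⟨fun j => subset_convexHull ℝ _ (Set.mem_range_self j), fun i j => ?_⟩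
    obtain rfl : i = j := Fin.ext (by omega)
    simp
  | succ n ih =>
    rw [LC.sd_succ_single, LC.bd_single, map_sum, map_sum]
    refine Submodule.sum_mem _ fun i _ => ?_
    rw [map_smul, map_smul]
    refine Submodule.smul_mem _ _ ?_
    refine Finsupp.map_mem_of_supported (LC.cone _ n) _ _ (fun u hu => ?_)
      (ih (w ∘ i.succAbove) (fun j k => hw _ _))
    rw [LC.cone_single]
    -- The ratio n / (n + 1) increases with n, so the bound for faces implies the one required.
    have hle : (n : ℝ) / (n + 1) * r ≤ ((n + 1 : ℕ) : ℝ) / ((n + 1 : ℕ) + 1) * r := by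
      refine mul_le_mul_of_nonneg_right ?_ hr
      push_cast
      rw [div_le_div_iff₀ (by positivity) (by positivity)]
      nlinarith
    have hu' : ∀ j, u j ∈ tupleHull w := fun j => tupleHull_comp w _ (hu.1 j)
    refine Finsupp.single_mem_supported _ _ ⟨fun j => ?_, fun j k => ?_⟩
    · refine Fin.cases ?_ (fun j => ?_) j
      · exact affineSimplex_mem_tupleHull w _
      · exact hu' j
    · refine Fin.cases ?_ (fun j => ?_) j <;> refine Fin.cases ?_ (fun k => ?_) k
      · simp only [dist_self]
        positivity
      · simp only [Fin.cons_zero, Fin.cons_succ]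
        rw [dist_comm]
        exact dist_bary_le hw (hu' k)
      · simp only [Fin.cons_zero, Fin.cons_succ]
        exact dist_bary_le hw (hu' j)
      · exact (hu.2 j k).trans hle

theorem sd_bary_iterate_mem (n k : ℕ) (w : Fin (n + 1) → stdSimplex ℝ ι) {r : ℝ} (hr : 0 ≤ r)
    (hw : IsFine r w) : (LC.sd (bary ι) n)^[k] (Finsupp.single w 1) ∈ Finsupp.supported ℚ ℚ
      {u | IsFine ((n / (n + 1)) ^ k * r) u} := by
  induction k with
  | zero => exact Finsupp.single_mem_supported _ _ (by simpa using hw)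
  | succ k ih =>
    rw [Function.iterate_succ_apply']
    refine Finsupp.map_mem_of_supported (LC.sd (bary ι) n) _ _ (fun u hu => ?_) ih
    refine Finsupp.supported_mono ?_ (sd_bary_single_mem n u (by positivity) hu)
    rintro v ⟨-, hv⟩
    rw [pow_succ', mul_assoc]
    exact hv

end mesh

namespace SC

open QComplex

variable {X : Type} [TopologicalSpace X]

section operators

variable {n n' : ℕ} (P : ∀ m, LC (Simplex m) n →ₗ[ℚ] LC (Simplex m) n')

/-- The operator on singular chains defined by a natural operator on linear chains. -/
def op (X : Type) [TopologicalSpace X] : SC X n →ₗ[ℚ] SC X n' :=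
  Finsupp.linearCombination ℚ fun σ => realize σ n' (P n (Finsupp.single stdSimplex.vertex 1))

theorem op_single (σ : C(Simplex n, X)) : op P X (Finsupp.single σ 1) =
    realize σ n' (P n (Finsupp.single stdSimplex.vertex 1)) := by
  simp [op]

/-- An operator on linear chains that is natural for affine maps acts on realized chains
simplexwise, hence its identities with the differential descend. -/
theorem op_realize {P : ∀ m, LC (Simplex m) n →ₗ[ℚ] LC (Simplex m) n'}
    (hP : ∀ m (u : Fin (n + 1) → Simplex m) c,
      LC.map (affineSimplex u) n' (P n c) = P m (LC.map (affineSimplex u) n c))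
    {m : ℕ} (σ : C(Simplex m, X)) (c : LC (Simplex m) n) :
    op P X (realize σ n c) = realize σ n' (P m c) := by
  have : op P X ∘ₗ realize σ n = realize σ n' ∘ₗ P m := by
    refine LC.ext_single fun w => ?_
    rw [LinearMap.comp_apply, realize_single, op_single, realize_comp, hP, LC.map_single,
      affineSimplex_comp_vertex]
    rfl
  exact LinearMap.congr_fun this c

theorem op_mem_sub {A : Set X} {c : SC X n} (hc : c ∈ (sub A).S n) : op P X c ∈ (sub A).S n' :=
  map_mem_of_mem_sub _ _ (fun σ hσ => by
    rw [op_single]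
    exact realize_mem_sub σ hσ _) hc

end operators

/-- Barycentric subdivision of linear chains. -/
abbrev linSd (n m : ℕ) : LC (Simplex m) n →ₗ[ℚ] LC (Simplex m) n := LC.sd (bary (Fin (m + 1))) n

/-- The homotopy from barycentric subdivision to the identity. -/
abbrev linHtpy (n m : ℕ) : LC (Simplex m) n →ₗ[ℚ] LC (Simplex m) (n + 1) :=
  LC.htpy (fun n => LinearMap.id - LC.sd (bary (Fin (m + 1))) n) (bary (Fin (m + 1))) n

theorem map_linSd (n m m' : ℕ) (u : Fin (m' + 1) → Simplex m) (c : LC (Simplex m') n) :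
    LC.map (affineSimplex u) n (linSd n m' c) = linSd n m (LC.map (affineSimplex u) n c) :=
  LC.map_sd _ (affineSimplex_bary u) n c

theorem map_linHtpy (n m m' : ℕ) (u : Fin (m' + 1) → Simplex m) (c : LC (Simplex m') n) :
    LC.map (affineSimplex u) (n + 1) (linHtpy n m' c) =
      linHtpy n m (LC.map (affineSimplex u) n c) :=
  LC.map_htpy _ _ (fun n c => by
    rw [LinearMap.sub_apply, LinearMap.sub_apply, map_sub, LinearMap.id_apply, LinearMap.id_apply]
    congr 1
    exact map_linSd n m m' u c) (affineSimplex_bary u) n c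

/-- Barycentric subdivision of singular chains. -/
def sd (X : Type) [TopologicalSpace X] (n : ℕ) : SC X n →ₗ[ℚ] SC X n := op (linSd n) X

/-- The homotopy from barycentric subdivision to the identity. -/
def sdHtpy (X : Type) [TopologicalSpace X] (n : ℕ) : SC X n →ₗ[ℚ] SC X (n + 1) := op (linHtpy n) X

theorem bd_sdHtpy_zero (c : SC X 0) : bd 0 (sdHtpy X 0 c) = c - sd X 0 c := by
  have : bd 0 ∘ₗ sdHtpy X 0 = LinearMap.id - sd X 0 := by
    refine LC.ext_single fun σ => ?_
    rw [LinearMap.comp_apply, sdHtpy, op_single, bd_realize, LC.bd_htpy_zero _ (fun c => ?_)]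
    · rw [LinearMap.sub_apply, map_sub, LinearMap.sub_apply, sd, op_single, LinearMap.id_apply,
        LinearMap.id_apply, realize_vertex]
    · simp [LC.sd]
  exact LinearMap.congr_fun this c

theorem bd_sdHtpy_succ (n : ℕ) (c : SC X (n + 1)) :
    bd (n + 1) (sdHtpy X (n + 1) c) = c - sd X (n + 1) c - sdHtpy X n (bd n c) := by
  have : bd (n + 1) ∘ₗ sdHtpy X (n + 1) = LinearMap.id - sd X (n + 1) - sdHtpy X n ∘ₗ bd n := by
    refine LC.ext_single fun σ => ?_
    rw [LinearMap.comp_apply, sdHtpy, op_single, bd_realize,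
      LC.bd_htpy_succ _ (fun c => ?_) (fun n c => ?_)]
    · rw [LinearMap.sub_apply, LinearMap.sub_apply, LinearMap.sub_apply, map_sub, map_sub, sd,
        op_single, LinearMap.id_apply, LinearMap.id_apply, realize_vertex, LinearMap.comp_apply,
        sdHtpy, ← op_realize (fun m u c => map_linHtpy n m n u c), ← bd_realize, realize_vertex]
    · simp [LC.sd]
    · simp only [LinearMap.sub_apply, LinearMap.id_apply, map_sub, LC.bd_sd]
  exact LinearMap.congr_fun this c

theorem bd_sd (n : ℕ) (c : SC X (n + 1)) : bd n (sd X (n + 1) c) = sd X n (bd n c) := by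
  have : bd n ∘ₗ sd X (n + 1) = sd X n ∘ₗ bd n := by
    refine LC.ext_single fun σ => ?_
    rw [LinearMap.comp_apply, sd, op_single, bd_realize, LC.bd_sd, LinearMap.comp_apply, sd,
      ← op_realize (fun m u c => map_linSd n m n u c), ← bd_realize, realize_vertex]
  exact LinearMap.congr_fun this c

theorem sd_iterate_single {n : ℕ} (k : ℕ) (σ : C(Simplex n, X)) :
    (sd X n)^[k] (Finsupp.single σ 1) =
      realize σ n ((linSd n n)^[k] (Finsupp.single stdSimplex.vertex 1)) := by
  induction k with
  | zero => exact (realize_vertex σ).symm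
  | succ k ih =>
    rw [Function.iterate_succ_apply', Function.iterate_succ_apply', ih, sd,
      op_realize (fun m u c => map_linSd n m n u c)]

theorem sd_mem_sup {U V : Set X} {n : ℕ} {c : SC X n} (hc : c ∈ (sub U ⊔ sub V).S n) :
    sd X n c ∈ (sub U ⊔ sub V).S n := by
  obtain ⟨a, ha, b, hb, rfl⟩ := Submodule.mem_sup.1 hc
  rw [map_add]
  exact Submodule.add_mem_sup (op_mem_sub _ ha) (op_mem_sub _ hb)

theorem sd_iterate_mem_sup {U V : Set X} {n : ℕ} {c : SC X n} (hc : c ∈ (sub U ⊔ sub V).S n) (k : ℕ) :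
    (sd X n)^[k] c ∈ (sub U ⊔ sub V).S n := by
  induction k with
  | zero => exact hc
  | succ k ih =>
    rw [Function.iterate_succ_apply']
    exact sd_mem_sup ih

/-- Pull the cover back to the compact simplex and take a Lebesgue number: after enough subdivisions
every piece lies in a ball of that radius. -/
theorem exists_sd_iterate_single_mem {U V : Set X} (hU : IsOpen U) (hV : IsOpen V) {n : ℕ}
    (σ : C(Simplex n, X)) (hσ : ∀ t, σ t ∈ U ∪ V) :
    ∃ k, (sd X n)^[k] (Finsupp.single σ 1) ∈ (sub U ⊔ sub V).S n := by
  obtain ⟨δ, hδ, hδ'⟩ := lebesgue_number_lemma_of_metric (s := (Set.univ : Set (Simplex n)))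
    (c := fun b : Bool => σ ⁻¹' (if b then U else V)) isCompact_univ
    (fun b => by
      cases b
      · exact hV.preimage σ.continuous
      · exact hU.preimage σ.continuous)
    (fun t _ => by
      rcases hσ t with h | h
      · exact Set.mem_iUnion.2 ⟨true, h⟩
      · exact Set.mem_iUnion.2 ⟨false, h⟩)
  have hfine : IsFine (Metric.diam (Set.univ : Set (Simplex n)))
      (stdSimplex.vertex (S := ℝ) (X := Fin (n + 1))) := fun i j =>
    Metric.dist_le_diam_of_mem isCompact_univ.isBounded trivial trivial
  set r := Metric.diam (Set.univ : Set (Simplex n))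
  have hr : 0 ≤ r := Metric.diam_nonneg
  have hq : (n : ℝ) / (n + 1) < 1 := by
    rw [div_lt_one (by positivity)]
    linarith
  -- The denominator is `r + 1` because the diameter `r` is zero in dimension 0.
  obtain ⟨k, hk⟩ := exists_pow_lt_of_lt_one (show 0 < δ / (r + 1) by positivity) hq
  refine ⟨k, ?_⟩
  rw [sd_iterate_single]
  refine Finsupp.map_mem_of_supported (realize σ n) ((sub U ⊔ sub V).S n) _ (fun u hu => ?_)
    (sd_bary_iterate_mem n k _ hr hfine)
  rw [realize_single]
  have hlt : ((n : ℝ) / (n + 1)) ^ k * r < δ := by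
    rw [lt_div_iff₀ (by positivity)] at hk
    have : (0 : ℝ) ≤ (n / (n + 1)) ^ k := by positivity
    nlinarith
  have hball : ∀ t, affineSimplex u t ∈ Metric.ball (u 0) δ := fun t => by
    have h := affineSimplex_mem_of_convex u
      (convex_closedBall (u 0 : Fin (n + 1) → ℝ) (((n : ℝ) / (n + 1)) ^ k * r))
      (fun j => Metric.mem_closedBall.2 (hu j 0)) t
    exact lt_of_le_of_lt h hlt
  obtain ⟨b, hb⟩ := hδ' (u 0) trivial
  cases b
  · exact Submodule.mem_sup_right (single_mem_sub (A := V) (σ := σ.comp (affineSimplex u)) (fun t => hb (hball t)) 1)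
  · exact Submodule.mem_sup_left (single_mem_sub (A := U) (σ := σ.comp (affineSimplex u)) (fun t => hb (hball t)) 1)

theorem exists_sd_iterate_mem {U V : Set X} (hU : IsOpen U) (hV : IsOpen V) {n : ℕ} {c : SC X n}
    (hc : c ∈ (sub (U ∪ V)).S n) : ∃ k, (sd X n)^[k] c ∈ (sub U ⊔ sub V).S n := by
  rw [sub_S, Finsupp.supported_eq_span_single] at hc
  induction hc using Submodule.span_induction with
  | mem x h =>
    obtain ⟨σ, hσ, rfl⟩ := h
    exact exists_sd_iterate_single_mem hU hV σ hσ
  | zero => exact ⟨0, zero_mem _⟩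
  | add x y _ _ hx hy =>
    obtain ⟨k, hk⟩ := hx
    obtain ⟨k', hk'⟩ := hy
    -- Small chains stay small under further subdivision, so the sum of the exponents serves both
    -- summands.
    refine ⟨k + k', ?_⟩
    rw [iterate_map_add]
    refine add_mem ?_ ?_
    · rw [add_comm k k', Function.iterate_add_apply]
      exact sd_iterate_mem_sup hk _
    · rw [Function.iterate_add_apply]
      exact sd_iterate_mem_sup hk' _
  | smul a x _ hx =>
    obtain ⟨k, hk⟩ := hx
    refine ⟨k, ?_⟩
    rw [← Module.End.coe_pow, map_smul, Module.End.coe_pow]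
    exact Submodule.smul_mem _ _ hk

theorem sub_sup_le (U V : Set X) : sub U ⊔ sub V ≤ sub (U ∪ V) := fun n =>
  sup_le (sub_mono Set.subset_union_left n) (sub_mono Set.subset_union_right n)

/-- The theorem on small simplices. -/
theorem acyclic_small {U V : Set X} (hU : IsOpen U) (hV : IsOpen V) :
    Acyclic (sub (U ∪ V)) (sub U ⊔ sub V) := by
  intro n
  have hcyc : ∀ c ∈ cyc (sub (U ∪ V)) (sub U ⊔ sub V) n,
      sd X n c ∈ cyc (sub (U ∪ V)) (sub U ⊔ sub V) n := by
    intro c hc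
    cases n with
    | zero => exact mem_cyc_zero.2 (op_mem_sub _ hc.1)
    | succ n =>
      refine mem_cyc_succ.2 ⟨op_mem_sub _ hc.1, ?_⟩
      rw [SemiSimp.complex_dS, bd_sd]
      exact sd_mem_sup hc.2
  have hstep : ∀ c ∈ cyc (sub (U ∪ V)) (sub U ⊔ sub V) n,
      c - sd X n c ∈ bdry (sub (U ∪ V)) (sub U ⊔ sub V) n := by
    intro c hc
    cases n with
    | zero =>
      rw [← bd_sdHtpy_zero]
      exact dS_mem_bdry (op_mem_sub _ hc.1)
    | succ n =>
      have h := bd_sdHtpy_succ n c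
      rw [eq_sub_iff_add_eq] at h
      rw [← h]
      refine add_mem (dS_mem_bdry (op_mem_sub _ hc.1)) (mem_bdry_of_mem ?_)
      obtain ⟨a, ha, b, hb, hab⟩ := Submodule.mem_sup.1 hc.2
      change a + b = bd n c at hab
      rw [← hab, map_add]
      exact Submodule.add_mem_sup (op_mem_sub _ ha) (op_mem_sub _ hb)
  -- Telescoping the homotopy between the identity and one subdivision.
  have hiter : ∀ k, ∀ c ∈ cyc (sub (U ∪ V)) (sub U ⊔ sub V) n,
      c - (sd X n)^[k] c ∈ bdry (sub (U ∪ V)) (sub U ⊔ sub V) n := by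
    intro k
    induction k with
    | zero => intro c _; simp
    | succ k ih =>
      intro c hc
      have := add_mem (hstep c hc) (ih _ (hcyc c hc))
      rw [sub_add_sub_cancel] at this
      exact this
  intro c hc
  obtain ⟨k, hk⟩ := exists_sd_iterate_mem hU hV hc.1
  have := add_mem (hiter k c hc) (mem_bdry_of_mem (B := sub (U ∪ V)) hk)
  rw [sub_add_cancel] at this
  exact this

/-- Excision. -/
theorem nonempty_excision {U V : Set X} (hU : IsOpen U) (hV : IsOpen V) (n : ℕ) :
    Nonempty (Hom (sub U) (sub (U ∩ V)) n ≃ₗ[ℚ] Hom (sub (U ∪ V)) (sub V) n) := by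
  rw [sub_inter]
  obtain ⟨e⟩ := homEquiv_inf_sup (sub U) (sub V) n
  obtain ⟨e'⟩ := homEquiv_of_acyclic_top (A := sub V) (fun n => le_sup_right (a := (sub U).S n))
    (sub_sup_le U V) (acyclic_small hU hV) n
  exact ⟨e.trans e'⟩

end SC

end

noncomputable section

/-! ### Relative homology of pairs of subsets -/

namespace SC

open QComplex

variable {X Y : Type} [TopologicalSpace X] [TopologicalSpace Y]

theorem map_id (n : ℕ) (c : SC X n) : map (ContinuousMap.id X) n c = c := by
  have : map (ContinuousMap.id X) n = LinearMap.id := LC.ext_single fun σ => by simp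
  exact LinearMap.congr_fun this c

/-- The map f acts on H(B, A) as the identity by homotopy and as zero because it sends B into A. -/
theorem acyclic_of_deformation {A B : Set X} {f : C(X, X)} (H : (ContinuousMap.id X).Homotopy f)
    (hB : ∀ x ∈ B, ∀ t, H (t, x) ∈ B) (hA : ∀ x ∈ A, ∀ t, H (t, x) ∈ A) (hf : ∀ x ∈ B, f x ∈ A) :
    Acyclic (sub B) (sub A) := by
  intro n c hc
  have h := sub_mem (mem_bdry_of_mem (B := sub B) (map_mem_sub f hf hc.1))
    (map_sub_map_mem_bdry H hB hA hc)
  rw [sub_sub_cancel, map_id] at h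
  exact h

theorem nonempty_equiv_of_homotopy {A B : Set X} {A' B' : Set Y} {f : C(X, Y)} {g : C(Y, X)}
    (hfB : ∀ x ∈ B, f x ∈ B') (hfA : ∀ x ∈ A, f x ∈ A') (hgB : ∀ y ∈ B', g y ∈ B)
    (hgA : ∀ y ∈ A', g y ∈ A) (H : (g.comp f).Homotopy (ContinuousMap.id X))
    (hHB : ∀ x ∈ B, ∀ t, H (t, x) ∈ B) (hHA : ∀ x ∈ A, ∀ t, H (t, x) ∈ A)
    (H' : (f.comp g).Homotopy (ContinuousMap.id Y)) (hHB' : ∀ y ∈ B', ∀ t, H' (t, y) ∈ B')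
    (hHA' : ∀ y ∈ A', ∀ t, H' (t, y) ∈ A') (n : ℕ) :
    Nonempty (Hom (sub B) (sub A) n ≃ₗ[ℚ] Hom (sub B') (sub A') n) := by
  refine nonempty_homEquiv_of_inverse (map f n) (map g n) (fun z hz => map_mem_cyc f hfB hfA hz)
    (fun z hz => map_mem_bdry f hfB hfA hz) (fun z hz => map_mem_cyc g hgB hgA hz)
    (fun z hz => map_mem_bdry g hgB hgA hz) (fun z hz => ?_) (fun z hz => ?_)
  · have := map_sub_map_mem_bdry H hHB hHA hz
    rwa [map_id, ← map_map] at this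
  · have := map_sub_map_mem_bdry H' hHB' hHA' hz
    rwa [map_id, ← map_map] at this

section embedding

variable {ι : C(Y, X)} (hι : Topology.IsEmbedding ι)

include hι

theorem comp_injective_of_isEmbedding (n : ℕ) :
    Function.Injective (ι.comp : C(Simplex n, Y) → C(Simplex n, X)) := by
  intro σ τ h
  ext t
  exact hι.injective (DFunLike.congr_fun h t)

theorem map_injective (n : ℕ) : Function.Injective (map ι n) :=
  Finsupp.mapDomain_injective (comp_injective_of_isEmbedding hι n)

theorem mem_sub_preimage {A : Set X} {n : ℕ} {c : SC Y n} (h : map ι n c ∈ (sub A).S n) :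
    c ∈ (sub (ι ⁻¹' A)).S n := by
  classical
  have h' := (Finsupp.mem_supported ℚ (Finsupp.mapDomain ι.comp c)).1 h
  rw [Finsupp.mapDomain_support_of_injective (comp_injective_of_isEmbedding hι n)] at h'
  refine (Finsupp.mem_supported ℚ c).2 fun σ hσ t => ?_
  exact h' (Finset.mem_coe.2 (Finset.mem_image_of_mem _ hσ)) t

theorem exists_map_eq {A : Set X} (hA : A ⊆ Set.range ι) {n : ℕ} {c : SC X n}
    (hc : c ∈ (sub A).S n) : ∃ c' ∈ (sub (ι ⁻¹' A)).S n, map ι n c' = c := by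
  have : c ∈ LinearMap.range (map ι n) := by
    refine map_mem_of_mem_sub LinearMap.id _ (fun σ hσ => ?_) hc
    choose τ hτ using fun t => hA (hσ t)
    have hcont : Continuous τ := by
      rw [hι.continuous_iff]
      exact σ.continuous.congr fun t => (hτ t).symm
    refine ⟨Finsupp.single ⟨τ, hcont⟩ 1, ?_⟩
    rw [map_single, LinearMap.id_apply]
    congr 1
    ext t
    exact hτ t
  obtain ⟨c', rfl⟩ := this
  exact ⟨c', mem_sub_preimage hι hc, rfl⟩

/-- Singular simplices inside the image of an embedding lift uniquely, so relative homology does not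
see the ambient space. -/
theorem nonempty_equiv_of_isEmbedding {A B : Set X} (hAB : A ⊆ B) (hB : B ⊆ Set.range ι) (n : ℕ) :
    Nonempty (Hom (sub (ι ⁻¹' B)) (sub (ι ⁻¹' A)) n ≃ₗ[ℚ] Hom (sub B) (sub A) n) := by
  refine nonempty_homEquiv (map ι n) (fun z hz => map_mem_cyc ι (fun _ h => h) (fun _ h => h) hz)
    (fun z _ hz => map_mem_bdry ι (fun _ h => h) (fun _ h => h) hz) (fun z _ hz' => ?_)
    (fun z' hz' => ?_)
  · obtain ⟨a, ha, b, hb, hab⟩ := mem_bdry.1 hz'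
    obtain ⟨a, ha', rfl⟩ := exists_map_eq hι (hAB.trans hB) ha
    obtain ⟨b, hb', rfl⟩ := exists_map_eq hι hB hb
    refine mem_bdry.2 ⟨a, ha', b, hb', map_injective hι n ?_⟩
    rw [map_add, ← hab, SemiSimp.complex_dS, SemiSimp.complex_dS, bd_map]
  · obtain ⟨z, hz, rfl⟩ := exists_map_eq hι hB hz'.1
    refine ⟨z, ?_, by simp⟩
    cases n with
    | zero => exact mem_cyc_zero.2 hz
    | succ n =>
      refine mem_cyc_succ.2 ⟨hz, mem_sub_preimage hι ?_⟩
      rw [SemiSimp.complex_dS, ← bd_map]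
      exact hz'.2

end embedding

/-! #### Suspension and the local homology of Euclidean spaces -/

/-- The relative homology of `(B, A)` is one-dimensional, concentrated in degree `m`. -/
def IsLocalPair (B A : Set X) (m : ℕ) : Prop :=
  HasDims (sub B) (sub A) (fun n => if n = m then 1 else 0)

theorem IsLocalPair.of_equiv {B A : Set X} {B' A' : Set Y} {m : ℕ} (h' : IsLocalPair B' A' m)
    (h : ∀ n, Nonempty (Hom (sub B) (sub A) n ≃ₗ[ℚ] Hom (sub B') (sub A') n)) : IsLocalPair B A m :=
  HasDims.of_equiv h' h

/-- The contraction of E moves only the first coordinate and so preserves the pair. -/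
theorem IsLocalPair.prod {E : Type} [TopologicalSpace E] [ContractibleSpace E] {A : Set Y} {m : ℕ}
    (h : IsLocalPair Set.univ A m) : IsLocalPair (Set.univ : Set (E × Y)) (Prod.snd ⁻¹' A) m := by
  obtain ⟨e₀, ⟨H⟩⟩ := (contractible_iff_id_nullhomotopic E).1 inferInstance
  let f : C(E × Y, Y) := ⟨Prod.snd, continuous_snd⟩
  let g : C(Y, E × Y) := ⟨fun y => (e₀, y), by fun_prop⟩
  let K : (g.comp f).Homotopy (ContinuousMap.id (E × Y)) :=
    { toFun := fun p => (H.symm (p.1, p.2.1), p.2.2)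
      continuous_toFun := by fun_prop
      map_zero_left := fun p => by simp [g, f]
      map_one_left := fun p => by simp }
  refine h.of_equiv fun n => nonempty_equiv_of_homotopy
      (B := Set.univ) (B' := Set.univ) (f := f) (g := g) (fun _ _ => trivial)
    (fun _ h => h) (fun _ _ => trivial) (fun _ h => h) K (fun _ _ _ => trivial) (fun x hx t => hx)
    (ContinuousMap.Homotopy.refl _) (fun _ _ _ => trivial) (fun x hx t => hx) n

/-- Vertical pushing in a product with the line. -/
def push (Y : Type) [TopologicalSpace Y] (s : ℝ) : C(Y × ℝ, Y × ℝ) :=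
  ⟨fun p => (p.1, p.2 + s * (|p.2| + 1)), by fun_prop⟩

/-- The homotopy from the identity to a vertical push. -/
def pushHomotopy (Y : Type) [TopologicalSpace Y] (s : ℝ) :
    (ContinuousMap.id (Y × ℝ)).Homotopy (push Y s) where
  toFun p := (p.2.1, p.2.2 + p.1 * (s * (|p.2.2| + 1)))
  continuous_toFun := by fun_prop
  map_zero_left p := by simp
  map_one_left p := by simp [push]

/-- Raising the height y by |y| + 1 makes it positive, and along the way positive heights stay
positive; `acyclic_lower` is the mirror image. -/
theorem acyclic_upper (A : Set Y) : Acyclic (sub (Set.univ : Set (Y × ℝ)))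
    (sub {p | p.1 ∈ A → 0 < p.2}) := by
  refine acyclic_of_deformation (pushHomotopy Y 1) (fun _ _ _ => trivial) (fun p hp t hA => ?_)
    (fun p _ _ => ?_)
  · change 0 < p.2 + t * (1 * (|p.2| + 1))
    have h1 : 0 < p.2 := hp hA
    have h2 : (0 : ℝ) ≤ t := t.2.1
    positivity
  · change 0 < p.2 + 1 * (|p.2| + 1)
    linarith [neg_abs_le p.2]

theorem acyclic_lower (A : Set Y) : Acyclic (sub (Set.univ : Set (Y × ℝ)))
    (sub {p | p.1 ∈ A → p.2 < 0}) := by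
  refine acyclic_of_deformation (pushHomotopy Y (-1)) (fun _ _ _ => trivial) (fun p hp t hA => ?_)
    (fun p _ _ => ?_)
  · change p.2 + t * (-1 * (|p.2| + 1)) < 0
    have h1 : p.2 < 0 := hp hA
    have h2 : (0 : ℝ) ≤ t := t.2.1
    nlinarith [abs_nonneg p.2]
  · change p.2 + -1 * (|p.2| + 1) < 0
    linarith [le_abs_self p.2]

/-- The complement of A × 0 in Y × ℝ is V ∪ U, with V below and U above, and Y × ℝ is acyclic
relative to each. Hence H_{n+1}(Y × ℝ, V ∪ U) ≅ H_n(V ∪ U, U) ≅ H_n(V, V ∩ U) ≅ H_n(Y × ℝ, V ∩ U),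
and V ∩ U = Aᶜ × ℝ. Closedness of A makes U and V open for the excision in the middle. -/
theorem IsLocalPair.suspension {A : Set Y} (hA : IsClosed A) {m : ℕ}
    (h : IsLocalPair Set.univ Aᶜ m) :
    IsLocalPair (Set.univ : Set (Y × ℝ)) {p | p.1 ∈ A → p.2 ≠ 0} (m + 1) := by
  set U : Set (Y × ℝ) := {p | p.1 ∈ A → 0 < p.2} with hU
  set V : Set (Y × ℝ) := {p | p.1 ∈ A → p.2 < 0} with hV
  have hUo : IsOpen U := by
    have : U = (Prod.fst ⁻¹' Aᶜ) ∪ (Prod.snd ⁻¹' Set.Ioi 0) := by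
      ext p
      simp only [hU, Set.mem_ofPred_eq, Set.mem_union, Set.mem_preimage, Set.mem_compl_iff,
        Set.mem_Ioi, imp_iff_not_or]
    rw [this]
    exact (hA.isOpen_compl.preimage continuous_fst).union (isOpen_Ioi.preimage continuous_snd)
  have hVo : IsOpen V := by
    have : V = (Prod.fst ⁻¹' Aᶜ) ∪ (Prod.snd ⁻¹' Set.Iio 0) := by
      ext p
      simp only [hV, Set.mem_ofPred_eq, Set.mem_union, Set.mem_preimage, Set.mem_compl_iff,
        Set.mem_Iio, imp_iff_not_or]
    rw [this]
    exact (hA.isOpen_compl.preimage continuous_fst).union (isOpen_Iio.preimage continuous_snd)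
  have hsup : {p : Y × ℝ | p.1 ∈ A → p.2 ≠ 0} = V ∪ U := by
    ext p
    simp only [hU, hV, Set.mem_ofPred_eq, Set.mem_union]
    by_cases hp : p.1 ∈ A
    · simp [hp]
    · simp [hp]
  have hinf : V ∩ U = Prod.fst ⁻¹' Aᶜ := by
    ext p
    simp only [hU, hV, Set.mem_ofPred_eq, Set.mem_inter_iff, Set.mem_preimage, Set.mem_compl_iff]
    by_cases hp : p.1 ∈ A
    · simp only [hp, true_implies, not_true_eq_false, iff_false]
      intro h
      linarith [h.1, h.2]
    · simp [hp]
  rw [hsup]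
  have hpair : IsLocalPair (Set.univ : Set (Y × ℝ)) (V ∩ U) m := by
    rw [hinf]
    let f : C(Y × ℝ, Y) := ⟨Prod.fst, continuous_fst⟩
    let g : C(Y, Y × ℝ) := ⟨fun y => (y, 0), by fun_prop⟩
    let K : (g.comp f).Homotopy (ContinuousMap.id (Y × ℝ)) :=
      { toFun := fun p => (p.2.1, p.1 * p.2.2)
        continuous_toFun := by fun_prop
        map_zero_left := fun p => by simp [g, f]
        map_one_left := fun p => by simp }
    exact h.of_equiv fun n => nonempty_equiv_of_homotopy
      (B := Set.univ) (B' := Set.univ) (f := f) (g := g) (fun _ _ => trivial)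
      (fun _ h => h) (fun _ _ => trivial) (fun _ h => h) K (fun _ _ _ => trivial) (fun x hx t => hx)
      (ContinuousMap.Homotopy.refl _) (fun _ _ _ => trivial) (fun x hx t => hx) n
  intro n
  cases n with
  | zero =>
    dsimp only
    rw [if_neg (by omega)]
    exact dims_zero_of_le (cyc_zero_le_bdry (sub_mono Set.subset_union_right) (acyclic_upper A))
  | succ n =>
    dsimp only
    rw [show (if n + 1 = m + 1 then 1 else 0) = if n = m then 1 else 0 by simp]
    obtain ⟨e₁⟩ := homEquiv_connecting (A := sub U) (B := sub (V ∪ U))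
      (D := sub (Set.univ : Set (Y × ℝ))) (sub_mono Set.subset_union_right)
      (sub_mono (Set.subset_univ _)) (acyclic_upper A) n
    obtain ⟨e₂⟩ := nonempty_excision hVo hUo n
    obtain ⟨e₃⟩ := homEquiv_of_acyclic_top (A := sub (V ∩ U)) (B := sub V)
      (D := sub (Set.univ : Set (Y × ℝ))) (sub_mono Set.inter_subset_left)
      (sub_mono (Set.subset_univ _)) (acyclic_lower A) n
    exact (hasDims_iff_of_equiv ⟨(e₁.trans e₂.symm).trans e₃⟩).2 (hpair n)

/-! ### The homology of a point -/

section point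

variable [Unique X]

theorem eq_single_default (n : ℕ) (c : SC X n) : c = Finsupp.single default (c default) := by
  ext σ
  obtain rfl : σ = default := Subsingleton.elim _ _
  simp

/-- All n + 2 faces coincide, so the alternating sum leaves one term or none according to the parity
of n. -/
theorem bd_single_default (n : ℕ) (a : ℚ) :
    bd n (Finsupp.single (default : C(Simplex (n + 1), X)) a) =
      Finsupp.single default (if Even n then 0 else a) := by
  rw [SemiSimp.bd_single]
  have : ∀ i : Fin (n + 2), (sing X).face i (default : C(Simplex (n + 1), X)) = default :=
    fun i => Subsingleton.elim _ _
  rw [Finset.sum_congr rfl fun (i : Fin (n + 2)) _ =>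
    congrArg (fun σ => (-1 : ℚ) ^ (i : ℕ) • Finsupp.single σ a) (this i), ← Finset.sum_smul,
    Finsupp.smul_single, Fin.sum_neg_one_pow]
  congr 1
  by_cases hn : Even n
  · simp [hn, Nat.even_add]
  · simp [hn, Nat.even_add]

theorem isLocalPair_point : IsLocalPair (Set.univ : Set X) ∅ 0 := by
  have hempty : ∀ n, (sub (∅ : Set X)).S n = ⊥ := fun n => by
    rw [sub_S]
    have : {σ : C(Simplex n, X) | ∀ t, σ t ∈ (∅ : Set X)} = ∅ := by
      ext σ
      simp only [Set.mem_empty_iff_false, Set.mem_ofPred_eq, iff_false, not_forall]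
      exact ⟨stdSimplex.vertex 0, not_false⟩
    rw [this, Finsupp.supported_empty]
  have huniv : ∀ n (c : SC X n), c ∈ (sub (Set.univ : Set X)).S n := fun n c => by
    rw [sub_S]
    have : {σ : C(Simplex n, X) | ∀ t, σ t ∈ (Set.univ : Set X)} = Set.univ := by
      ext σ
      simp
    rw [this, Finsupp.supported_univ]
    trivial
  intro n
  cases n with
  | zero =>
    have hb : bdry (sub (Set.univ : Set X)) (sub ∅) 0 = ⊥ := by
      rw [eq_bot_iff]
      intro z hz
      obtain ⟨a, ha, b, hb, rfl⟩ := mem_bdry.1 hz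
      rw [hempty] at ha
      obtain rfl : a = 0 := ha
      rw [SemiSimp.complex_dS, eq_single_default 1 b, bd_single_default]
      simp
    have hc : cyc (sub (Set.univ : Set X)) (sub ∅) 0 = ⊤ := by
      rw [eq_top_iff]
      exact fun z _ => mem_cyc_zero.2 (huniv 0 z)
    have e : Hom (sub (Set.univ : Set X)) (sub ∅) 0 ≃ₗ[ℚ] ℚ := by
      refine (Submodule.quotEquivOfEqBot _ ?_).trans ((LinearEquiv.ofEq _ _ hc).trans
        (Submodule.topEquiv.trans (Finsupp.uniqueLinearEquiv ℚ ℚ (default : C(Simplex 0, X)))))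
      rw [hb, eq_bot_iff]
      rintro ⟨z, hz⟩ hz'
      exact Subtype.ext hz'
    refine ⟨Module.Finite.equiv e.symm, ?_⟩
    rw [e.finrank_eq]
    simp
  | succ n =>
    dsimp only
    rw [if_neg (by omega)]
    refine dims_zero_of_le fun z hz => ?_
    have hz2 := hz.2
    change bd n z ∈ (sub (∅ : Set X)).S n at hz2
    rw [hempty, Submodule.mem_bot, eq_single_default _ z, bd_single_default] at hz2
    by_cases hn : Even n
    · have : z = (sing X).complex.dS (n + 1) (Finsupp.single default (z default)) := by
        rw [SemiSimp.complex_dS, bd_single_default, if_neg (by simpa [Nat.even_add_one] using hn)]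
        exact eq_single_default _ z
      rw [this]
      exact dS_mem_bdry (huniv _ _)
    · rw [if_neg hn, Finsupp.single_eq_zero] at hz2
      rw [eq_single_default _ z, hz2, Finsupp.single_zero]
      exact zero_mem _

end point

theorem IsLocalPair.of_homeomorph (e : X ≃ₜ Y) {A : Set Y} {m : ℕ}
    (h : IsLocalPair (Set.univ : Set X) (e ⁻¹' A) m) : IsLocalPair (Set.univ : Set Y) A m := by
  refine h.of_equiv fun n => ?_
  obtain ⟨f⟩ := nonempty_equiv_of_isEmbedding (ι := (e : C(X, Y))) e.isEmbedding (Set.subset_univ A)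
    (fun y _ => e.surjective y) n
  exact ⟨f.symm⟩

/-- Iterated suspension, starting from the point: in dimension 0 the complement of the origin is
empty. -/
theorem isLocalPair_euclidean (m : ℕ) : IsLocalPair (Set.univ : Set (Fin m → ℝ)) {0}ᶜ m := by
  induction m with
  | zero =>
    have : ({0}ᶜ : Set (Fin 0 → ℝ)) = ∅ := by
      ext x
      simpa using Subsingleton.elim x 0
    rw [this]
    exact isLocalPair_point
  | succ m ih =>
    -- The factors are swapped because `Fin.cons` puts the new coordinate first while the suspension
    -- has it last.
    let e : (Fin m → ℝ) × ℝ ≃ₜ (Fin (m + 1) → ℝ) := (Homeomorph.prodComm _ _).trans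
      (Fin.consEquivL ℝ (fun _ : Fin (m + 1) => ℝ)).toHomeomorph
    refine IsLocalPair.of_homeomorph e ?_
    have he : e ⁻¹' {0}ᶜ = {p | p.1 ∈ ({0} : Set (Fin m → ℝ)) → p.2 ≠ 0} := by
      ext p
      have : e p = Fin.cons p.2 p.1 := rfl
      simp only [Set.mem_preimage, Set.mem_compl_iff, Set.mem_singleton_iff, this, Set.mem_ofPred_eq]
      rw [← not_iff_not]
      simp only [not_not, Classical.not_imp]
      constructor
      · intro h
        exact ⟨funext fun i => congrFun h i.succ, congrFun h 0⟩
      · rintro ⟨h1, h2⟩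
        funext i
        refine Fin.cases ?_ (fun i => ?_) i
        · exact h2
        · exact congrFun h1 i
    rw [he]
    exact ih.suspension isClosed_singleton

/-- The relative homology of a cell. -/
theorem isLocalPair_cell {E : Type} [TopologicalSpace E] [ContractibleSpace E] {U N : Set X}
    (hU : IsOpen U) (hN : IsOpen N) {m : ℕ} (φ : N ≃ₜ E × (Fin m → ℝ))
    (hφ : ∀ x : N, (φ x).2 = 0 ↔ (x : X) ∉ U) : IsLocalPair (N ∪ U) U m := by
  have h1 : IsLocalPair (Set.univ : Set (E × (Fin m → ℝ))) (Prod.snd ⁻¹' {0}ᶜ) m :=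
    (isLocalPair_euclidean m).prod
  let ι : C(E × (Fin m → ℝ), X) := ⟨fun p => (φ.symm p : X), by fun_prop⟩
  have hι : Topology.IsEmbedding ι := Topology.IsEmbedding.subtypeVal.comp φ.symm.isEmbedding
  have hrange : N ⊆ Set.range ι := fun x hx => ⟨φ ⟨x, hx⟩, by simp [ι]⟩
  have hpre : ι ⁻¹' N = Set.univ := Set.eq_univ_of_forall fun p => (φ.symm p).2
  have hpre' : ι ⁻¹' (N ∩ U) = Prod.snd ⁻¹' {0}ᶜ := by
    ext p
    have := hφ (φ.symm p)
    rw [Homeomorph.apply_symm_apply] at this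
    simp only [Set.mem_preimage, Set.mem_compl_iff, Set.mem_singleton_iff, this, not_not]
    exact and_iff_right (φ.symm p).2
  refine h1.of_equiv fun n => ?_
  -- From the model pair to (N, N ∩ U) through the chart, then to (N ∪ U, U) by excision.
  obtain ⟨e⟩ := nonempty_equiv_of_isEmbedding hι (A := N ∩ U) Set.inter_subset_left hrange n
  rw [hpre, hpre'] at e
  obtain ⟨e'⟩ := nonempty_excision hN hU n
  exact ⟨(e.trans e').symm⟩

end SC

end

noncomputable section

/-! ### Comparison with singular cohomology -/

section comparison

open CategoryTheory AlgebraicTopology Simplicial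

variable (X : Type) [TopologicalSpace X]

/-- The singular simplicial set. -/
abbrev singSSet : SSet := TopCat.toSSet.obj (TopCat.of X)

/-- The simplices of the singular simplicial set. -/
def singEquiv (n : ℕ) : (singSSet X) _⦋n⦌ ≃ C(Simplex n, X) :=
  TopCat.toSSetObjEquiv (TopCat.of X) (Opposite.op ⦋n⦌)

theorem singEquiv_δ {n : ℕ} (i : Fin (n + 2)) (x : (singSSet X) _⦋n + 1⦌) :
    singEquiv X n ((singSSet X).δ i x) = (sing X).face i (singEquiv X (n + 1) x) := by
  ext t
  change _ = singEquiv X (n + 1) x (affineSimplex (stdSimplex.vertex ∘ i.succAbove) t)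
  rw [affineSimplex_vertex_comp]
  rfl

/-- The chain of a singular simplex. -/
def simplexChain {n : ℕ} (σ : C(Simplex n, X)) : (ratSingularChains X).X n :=
  ((singSSet X).ιChainComplex (R := ModuleCat.of ℚ ℚ) ((singEquiv X n).symm σ)).hom (1 : ℚ)

theorem d_simplexChain {n : ℕ} (σ : C(Simplex (n + 1), X)) :
    ((ratSingularChains X).d (n + 1) n).hom (simplexChain X σ) =
      ∑ i : Fin (n + 2), (-1 : ℚ) ^ (i : ℕ) • simplexChain X ((sing X).face i σ) := by
  have h := congrArg (fun f => f.hom (1 : ℚ)) ((singSSet X).ιChainComplex_d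
    (ModuleCat.of ℚ ℚ) ((singEquiv X (n + 1)).symm σ))
  refine h.trans ?_
  simp only [ModuleCat.hom_sum, LinearMap.sum_apply]
  refine Finset.sum_congr rfl fun i _ => ?_
  have : (singEquiv X n).symm ((sing X).face i σ) =
      (singSSet X).δ i ((singEquiv X (n + 1)).symm σ) := by
    rw [Equiv.symm_apply_eq, singEquiv_δ, Equiv.apply_symm_apply]
  rw [simplexChain, this]
  rcases Nat.even_or_odd (i : ℕ) with hi | hi
  · rw [hi.neg_one_pow, hi.neg_one_pow, one_smul]
    exact (one_smul ℚ (_ : (ratSingularChains X).X n)).symm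
  · rw [hi.neg_one_pow, hi.neg_one_pow, neg_smul, one_smul]
    exact ((neg_smul (1 : ℚ) (_ : (ratSingularChains X).X n)).trans
      (congrArg Neg.neg (one_smul ℚ _))).symm

/-- From concrete chains to Mathlib's singular chains. -/
def toRat (n : ℕ) : SC X n →ₗ[ℚ] (ratSingularChains X).X n :=
  Finsupp.linearCombination ℚ (simplexChain X)

/-- From Mathlib's singular chains to concrete chains. -/
def ofRat (n : ℕ) : (ratSingularChains X).X n →ₗ[ℚ] SC X n :=
  (Limits.Sigma.desc (fun x : (singSSet X) _⦋n⦌ => ModuleCat.ofHom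
    (LinearMap.toSpanSingleton ℚ (SC X n) (Finsupp.single (singEquiv X n x) 1))) :
      (ratSingularChains X).X n ⟶ ModuleCat.of ℚ (SC X n)).hom

theorem ofRat_simplexChain {n : ℕ} (σ : C(Simplex n, X)) :
    ofRat X n (simplexChain X σ) = Finsupp.single σ 1 := by
  have h := congrArg (fun f => f.hom (1 : ℚ)) (Limits.Sigma.ι_desc
    (fun x : (singSSet X) _⦋n⦌ => ModuleCat.ofHom
      (LinearMap.toSpanSingleton ℚ (SC X n) (Finsupp.single (singEquiv X n x) 1)))
    ((singEquiv X n).symm σ))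
  refine h.trans ?_
  simp

theorem ofRat_toRat (n : ℕ) (c : SC X n) : ofRat X n (toRat X n c) = c := by
  have : ofRat X n ∘ₗ toRat X n = LinearMap.id := LC.ext_single fun σ => by
    simp [toRat, ofRat_simplexChain]
  exact LinearMap.congr_fun this c

/-- The library's chains form a coproduct of copies of ℚ indexed by simplices, so it suffices to
compare on the generators. -/
theorem toRat_ofRat (n : ℕ) (c : (ratSingularChains X).X n) : toRat X n (ofRat X n c) = c := by
  have : ModuleCat.ofHom (toRat X n ∘ₗ ofRat X n) = 𝟙 ((ratSingularChains X).X n) := by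
    refine SSet.chainComplex_hom_ext (X := singSSet X) (R := ModuleCat.of ℚ ℚ) fun x => ?_
    ext
    have h : ((singSSet X).ιChainComplex (R := ModuleCat.of ℚ ℚ) x).hom (1 : ℚ) =
        simplexChain X (singEquiv X n x) := by
      rw [simplexChain, Equiv.symm_apply_apply]
    change toRat X n (ofRat X n (((singSSet X).ιChainComplex (R := ModuleCat.of ℚ ℚ) x).hom (1 : ℚ))) =
      ((singSSet X).ιChainComplex (R := ModuleCat.of ℚ ℚ) x).hom (1 : ℚ)
    rw [h, ofRat_simplexChain]
    simp [toRat]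
  exact congrArg (fun f => f.hom c) this

/-- Mathlib's singular chains are the concrete ones. -/
def ratEquiv (n : ℕ) : SC X n ≃ₗ[ℚ] (ratSingularChains X).X n :=
  LinearEquiv.ofLinearMap (toRat X n) (ofRat X n) (LinearMap.ext (toRat_ofRat X n))
    (LinearMap.ext (ofRat_toRat X n))

theorem d_ratEquiv (n : ℕ) (c : SC X n) :
    ((ratSingularChains X).d n (n - 1)).hom (ratEquiv X n c) =
      ratEquiv X (n - 1) ((sing X).complex.d n c) := by
  cases n with
  | zero =>
    have : (ratSingularChains X).d 0 (0 - 1) = 0 := (ratSingularChains X).shape _ _ (by simp)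
    rw [this]
    simp
  | succ n =>
    have : ((ratSingularChains X).d (n + 1) n).hom ∘ₗ toRat X (n + 1) = toRat X n ∘ₗ SC.bd n := by
      refine LC.ext_single fun σ => ?_
      rw [LinearMap.comp_apply, LinearMap.comp_apply, SemiSimp.bd_single, map_sum]
      simp only [map_smul]
      simp only [toRat, Finsupp.linearCombination_single, one_smul]
      exact d_simplexChain X σ
    exact LinearMap.congr_fun this c

end comparison

open QComplex

variable (X : Type) [TopologicalSpace X]

/-- The absolute homology. -/
abbrev AbsHom (n : ℕ) : Type := Hom (SC.sub (Set.univ : Set X)) (SC.sub (∅ : Set X)) n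

theorem SC.sub_univ_S (n : ℕ) : (SC.sub (Set.univ : Set X)).S n = ⊤ := by
  rw [SC.sub_S, ← Finsupp.supported_univ]
  congr 1
  ext σ
  simp

theorem SC.sub_empty_S (n : ℕ) : (SC.sub (∅ : Set X)).S n = ⊥ := by
  rw [SC.sub_S, ← Finsupp.supported_empty (M := ℚ) (R := ℚ)]
  congr 1
  ext σ
  simp only [Set.mem_empty_iff_false, Set.mem_ofPred_eq, iff_false, not_forall]
  exact ⟨stdSimplex.vertex 0, not_false⟩

theorem mem_abs_cyc {n : ℕ} {c : SC X n} :
    c ∈ cyc (SC.sub (Set.univ : Set X)) (SC.sub ∅) n ↔ (sing X).complex.d n c = 0 := by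
  rw [mem_cyc, SC.sub_univ_S, SC.sub_empty_S]
  simp

theorem mem_abs_bdry {n : ℕ} {c : SC X n} :
    c ∈ bdry (SC.sub (Set.univ : Set X)) (SC.sub ∅) n ↔ ∃ b, SC.bd n b = c := by
  rw [mem_bdry, SC.sub_univ_S, SC.sub_empty_S]
  simp

theorem mem_ratCocycles {n : ℕ} {φ : Module.Dual ℚ ((ratSingularChains X).X n)} :
    φ ∈ ratCocycles X n ↔ ∀ b, φ (ratEquiv X n (SC.bd n b)) = 0 := by
  have h : ∀ b, ((ratSingularChains X).d (n + 1) n).hom (ratEquiv X (n + 1) b) =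
      ratEquiv X n (SC.bd n b) := d_ratEquiv X (n + 1)
  constructor
  · intro hφ b
    rw [← h]
    exact LinearMap.congr_fun hφ (ratEquiv X (n + 1) b)
  · intro hφ
    refine LinearMap.ext fun b => ?_
    obtain ⟨b, rfl⟩ := (ratEquiv X (n + 1)).surjective b
    change φ _ = 0
    rw [h]
    exact hφ b

/-- Evaluation of cocycles on cycles. -/
def evalCocycle (n : ℕ) : ratCocycles X n →ₗ[ℚ] Module.Dual ℚ (AbsHom X n) where
  toFun φ := Submodule.liftQ _ ((φ.1 ∘ₗ (ratEquiv X n).toLinearMap) ∘ₗ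
      (cyc (SC.sub (Set.univ : Set X)) (SC.sub ∅) n).subtype) (by
    rintro ⟨z, hz⟩ hz'
    obtain ⟨b, rfl⟩ := (mem_abs_bdry X).1 hz'
    exact (mem_ratCocycles X).1 φ.2 b)
  map_add' φ ψ := by
    ext z
    simp
  map_smul' a φ := by
    ext z
    simp

theorem evalCocycle_mk {n : ℕ} (φ : ratCocycles X n) (z : SC X n)
    (hz : z ∈ cyc (SC.sub (Set.univ : Set X)) (SC.sub ∅) n) :
    evalCocycle X n φ (Submodule.Quotient.mk ⟨z, hz⟩) = φ.1 (ratEquiv X n z) := rfl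

/-- A cocycle killing all cycles factors through C_n / ker d ≅ im d, and over a field the functional
on im d extends to C_{n-1}; the extension is a primitive. -/
theorem ker_evalCocycle (n : ℕ) : LinearMap.ker (evalCocycle X n) =
    (ratCoboundaries X n).comap (ratCocycles X n).subtype := by
  ext φ
  rw [LinearMap.mem_ker, Submodule.mem_comap]
  constructor
  · intro h
    have h' : ∀ x, ((ratSingularChains X).d n (n - 1)).hom x = 0 → φ.1 x = 0 := by
      intro x hx
      obtain ⟨z, rfl⟩ := (ratEquiv X n).surjective x
      rw [d_ratEquiv] at hx
      have hz : (sing X).complex.d n z = 0 := (ratEquiv X (n - 1)).injective (hx.trans (map_zero _).symm)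
      rw [← evalCocycle_mk X φ z ((mem_abs_cyc X).2 hz), h]
      rfl
    have hle : LinearMap.ker ((ratSingularChains X).d n (n - 1)).hom ≤ LinearMap.ker φ.1 := h'
    obtain ⟨ψ, hψ⟩ := LinearMap.exists_extend
      (((LinearMap.ker ((ratSingularChains X).d n (n - 1)).hom).liftQ φ.1 hle) ∘ₗ
        ((ratSingularChains X).d n (n - 1)).hom.quotKerEquivRange.symm.toLinearMap)
    refine ⟨ψ, LinearMap.ext fun x => ?_⟩
    have := LinearMap.congr_fun hψ (((ratSingularChains X).d n (n - 1)).hom.rangeRestrict x)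
    refine this.trans ?_
    rw [LinearMap.comp_apply]
    have h2 : ((ratSingularChains X).d n (n - 1)).hom.quotKerEquivRange.symm
        (((ratSingularChains X).d n (n - 1)).hom.rangeRestrict x) = Submodule.Quotient.mk x := by
      rw [LinearEquiv.symm_apply_eq]
      rfl
    erw [h2]
    rfl
  · rintro ⟨ψ, hψ⟩
    refine LinearMap.ext fun z => ?_
    obtain ⟨⟨z, hz⟩, rfl⟩ := Submodule.Quotient.mk_surjective _ z
    rw [evalCocycle_mk]
    have := LinearMap.congr_fun hψ (ratEquiv X n z)
    refine this.symm.trans ?_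
    change ψ (((ratSingularChains X).d n (n - 1)).hom (ratEquiv X n z)) = 0
    rw [d_ratEquiv, (mem_abs_cyc X).1 hz, map_zero, map_zero]

/-- A functional on homology, seen as one on cycles, extends to all chains over a field; it vanishes
on boundaries and is thus a cocycle. -/
theorem evalCocycle_surjective (n : ℕ) : Function.Surjective (evalCocycle X n) := by
  intro f
  obtain ⟨ψ, hψ⟩ := LinearMap.exists_extend (f ∘ₗ Submodule.mkQ _ :
    cyc (SC.sub (Set.univ : Set X)) (SC.sub ∅) n →ₗ[ℚ] ℚ)
  have hψ' : ∀ z (hz : z ∈ cyc (SC.sub (Set.univ : Set X)) (SC.sub ∅) n),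
      ψ z = f (Submodule.Quotient.mk ⟨z, hz⟩) := fun z hz => LinearMap.congr_fun hψ ⟨z, hz⟩
  refine ⟨⟨ψ ∘ₗ (ratEquiv X n).symm.toLinearMap, (mem_ratCocycles X).2 fun b => ?_⟩, ?_⟩
  · have hb : SC.bd n b ∈ bdry (SC.sub (Set.univ : Set X)) (SC.sub ∅) n := (mem_abs_bdry X).2 ⟨b, rfl⟩
    have hb' := bdry_le_cyc (SC.sub_mono (Set.empty_subset Set.univ)) n hb
    rw [LinearMap.comp_apply, LinearEquiv.coe_coe, LinearEquiv.symm_apply_apply, hψ' _ hb',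
      (hom_mk_eq_zero _ hb').2 hb, map_zero]
  · refine LinearMap.ext fun z => ?_
    obtain ⟨⟨z, hz⟩, rfl⟩ := Submodule.Quotient.mk_surjective _ z
    rw [evalCocycle_mk, ← hψ' z hz]
    simp

/-- Singular cohomology is dual to singular homology. -/
def cohomologyEquiv (n : ℕ) : RatCohomology X n ≃ₗ[ℚ] Module.Dual ℚ (AbsHom X n) :=
  (Submodule.quotEquivOfEq _ _ (ker_evalCocycle X n).symm).trans
    ((evalCocycle X n).quotKerEquivOfSurjective (evalCocycle_surjective X n))

theorem isPoincarePolynomial_of_hasDims {f : ℕ → ℕ}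
    (h : HasDims (SC.sub (Set.univ : Set X)) (SC.sub ∅) f) {a : ℚ[X]}
    (ha : ∀ n, a.coeff n = f n) : IsPoincarePolynomial X a := by
  intro n
  obtain ⟨hF, hn⟩ := h n
  refine ⟨Module.Finite.equiv (cohomologyEquiv X n).symm, ?_⟩
  rw [(cohomologyEquiv X n).finrank_eq, Subspace.dual_finrank_eq, hn, ha]

end

noncomputable section

/-! ### Spaces paved by affine cells -/

/-- A paving of `X` by affine cells: open sets `N i` with charts `N i ≃ ℂ^S × ℂ^T` such that the
points of `N i` in no earlier `N j` are those with vanishing second coordinate. The cell with index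
`i` has complex codimension `b i`. -/
structure Paving (X : Type) [TopologicalSpace X] (ι : Type) [LinearOrder ι] (b : ι → ℕ) where
  N : ι → Set X
  isOpen : ∀ i, IsOpen (N i)
  cover : ∀ x, ∃ i, x ∈ N i
  S : ι → Type
  T : ι → Type
  [fin : ∀ i, Fintype (T i)]
  card_T : ∀ i, Fintype.card (T i) = b i
  chart : ∀ i, N i ≃ₜ (S i → ℂ) × (T i → ℂ)
  zero_iff : ∀ i (x : N i), (chart i x).2 = 0 ↔ ∀ j < i, (x : X) ∉ N j

attribute [instance] Paving.fin

namespace Paving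

open QComplex

variable {X : Type} [TopologicalSpace X] {ι : Type} [LinearOrder ι] {b : ι → ℕ}

/-- Complex coordinates as real ones. -/
theorem nonempty_realCoords (T : Type) [Fintype T] :
    Nonempty ((T → ℂ) ≃L[ℝ] (Fin (2 * Fintype.card T) → ℝ)) := by
  refine ⟨ContinuousLinearEquiv.ofFinrankEq ?_⟩
  rw [Module.finrank_pi_fintype]
  simp [Complex.finrank_real_complex, mul_comm]

/-- Charts are attached in increasing order. Since s is a lower set, its largest index has exactly
the other members before it, so attaching it adds one class in degree 2 b; evenness of all degrees
lets `HasDims.add` apply. -/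
theorem hasDims_union (P : Paving X ι b) (s : Finset ι) (hs : IsLowerSet (s : Set ι)) :
    HasDims (SC.sub (⋃ i ∈ s, P.N i)) (SC.sub ∅) (fun n => (s.filter fun i => 2 * b i = n).card) := by
  induction s using Finset.induction_on_max with
  | empty =>
    intro n
    have h : (⋃ i ∈ (∅ : Finset ι), P.N i) = ∅ := by simp
    rw [h]
    exact dims_zero_of_le fun z hz => mem_bdry_of_mem hz.1
  | insert a s ha ih =>
    have hlt : ∀ j, j < a → j ∈ s := fun j hj => by
      have : j ∈ insert a s := hs hj.le (Finset.mem_insert_self a s)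
      exact (Finset.mem_insert.1 this).resolve_left hj.ne
    have hs' : IsLowerSet (s : Set ι) := fun i j hij hi =>
      hlt j (lt_of_le_of_lt hij (ha i hi))
    have hU : IsOpen (⋃ i ∈ s, P.N i) := isOpen_biUnion fun i _ => P.isOpen i
    obtain ⟨e⟩ := nonempty_realCoords (P.T a)
    have hcell : SC.IsLocalPair (P.N a ∪ ⋃ i ∈ s, P.N i) (⋃ i ∈ s, P.N i)
        (2 * Fintype.card (P.T a)) := by
      refine SC.isLocalPair_cell hU (P.isOpen a)
        ((P.chart a).trans ((Homeomorph.refl _).prodCongr e.toHomeomorph)) fun x => ?_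
      change e (P.chart a x).2 = 0 ↔ _
      rw [map_eq_zero_iff e e.injective, P.zero_iff]
      simp only [Set.mem_iUnion, not_exists]
      exact ⟨fun h j hj => h j (ha j hj), fun h j hj => h j (hlt j hj)⟩
    rw [Finset.set_biUnion_insert]
    have hodd : ∀ m n : ℕ, Odd n → n ≠ 2 * m := fun m n hn h => by
      rw [h] at hn
      exact (Nat.not_odd_iff_even.2 (even_two_mul m)) hn
    have := HasDims.add (SC.sub_mono (Set.empty_subset _)) (SC.sub_mono Set.subset_union_right)
      (ih hs') hcell (fun n hn => ?_) (fun n hn => if_neg (hodd _ n hn))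
    · intro n
      have h := this n
      rw [P.card_T] at h
      dsimp only at h ⊢
      rw [Finset.filter_insert]
      have ha' : a ∉ s := fun h => lt_irrefl a (ha a h)
      split_ifs with hn
      · rw [Finset.card_insert_of_notMem (by simp [ha'])]
        simpa [hn] using h
      · simpa [Ne.symm hn] using h
    · rw [Finset.card_eq_zero, Finset.filter_eq_empty_iff]
      exact fun i _ h => hodd _ n hn h.symm

theorem isPoincarePolynomial [Fintype ι] (P : Paving X ι b) :
    IsPoincarePolynomial X (∑ i, Polynomial.X ^ (2 * b i)) := by
  have h := P.hasDims_union Finset.univ (by simp [isLowerSet_univ])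
  have hU : (⋃ i ∈ (Finset.univ : Finset ι), P.N i) = Set.univ := by
    refine Set.eq_univ_of_forall fun x => ?_
    obtain ⟨i, hi⟩ := P.cover x
    exact Set.mem_biUnion (Finset.mem_coe.2 (Finset.mem_univ i)) hi
  rw [hU] at h
  refine isPoincarePolynomial_of_hasDims X h fun n => ?_
  rw [Polynomial.finsetSum_coeff]
  simp only [Polynomial.coeff_X_pow]
  rw [Finset.card_filter]
  push_cast
  exact Finset.sum_congr rfl fun i _ => by simp [eq_comm]

/-- Transport along a homeomorphism. -/
def ofHomeomorph {Y : Type} [TopologicalSpace Y] (P : Paving X ι b) (e : Y ≃ₜ X) : Paving Y ι b where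
  N i := e ⁻¹' P.N i
  isOpen i := (P.isOpen i).preimage e.continuous
  cover x := P.cover (e x)
  S := P.S
  T := P.T
  card_T := P.card_T
  chart i := (e.sets rfl).trans (P.chart i)
  zero_iff i x := P.zero_iff i ((e.sets rfl) x)

/-- The one-point space. -/
def point [Unique X] [Unique ι] (hb : b default = 0) : Paving X ι b where
  N _ := Set.univ
  isOpen _ := isOpen_univ
  cover _ := ⟨default, trivial⟩
  S _ := Empty
  T _ := Empty
  card_T i := by rw [Unique.eq_default i, hb]; rfl
  chart _ := (Homeomorph.Set.univ X).trans
    { toFun := fun _ => (0, 0)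
      invFun := fun _ => default
      left_inv := fun _ => Subsingleton.elim _ _
      right_inv := fun _ => Subsingleton.elim _ _
      continuous_toFun := continuous_const
      continuous_invFun := continuous_const }
  zero_iff i x := by
    refine iff_of_true (Subsingleton.elim _ _) fun j hj => ?_
    rw [Subsingleton.elim j i] at hj
    exact absurd hj (lt_irrefl i)

/-! ### Bundles trivialised over the charts of a paved base -/

section bundle

variable {E B : Type} [TopologicalSpace E] [TopologicalSpace B] {f : E → B} {N : Set B} {F : Type}
  [TopologicalSpace F]

/-- The part of a trivialised bundle over `N` lying over `N × M`. -/
def bundleSet (t : f ⁻¹' N ≃ₜ N × F) (M : Set F) : Set E :=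
  Subtype.val '' ((fun x => (t x).2) ⁻¹' M)

theorem mem_bundleSet {t : f ⁻¹' N ≃ₜ N × F} {M : Set F} {x : E} :
    x ∈ bundleSet t M ↔ ∃ h : f x ∈ N, (t ⟨x, h⟩).2 ∈ M := by
  constructor
  · rintro ⟨⟨y, hy⟩, hM, rfl⟩
    exact ⟨hy, hM⟩
  · rintro ⟨h, hM⟩
    exact ⟨⟨x, h⟩, hM, rfl⟩

theorem isOpen_bundleSet (hf : Continuous f) (hN : IsOpen N) (t : f ⁻¹' N ≃ₜ N × F) {M : Set F}
    (hM : IsOpen M) : IsOpen (bundleSet t M) :=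
  (hN.preimage hf).isOpenMap_subtype_val _ (hM.preimage (by fun_prop))

/-- The part over `N × M` is `N × M`. -/
def bundleHomeomorph (t : f ⁻¹' N ≃ₜ N × F) (M : Set F) : bundleSet t M ≃ₜ N × M where
  toFun x := ((t ⟨x, (mem_bundleSet.1 x.2).1⟩).1,
    ⟨(t ⟨x, (mem_bundleSet.1 x.2).1⟩).2, (mem_bundleSet.1 x.2).2⟩)
  invFun p := ⟨t.symm (p.1, p.2), mem_bundleSet.2 ⟨(t.symm (p.1, p.2)).2, by simp⟩⟩
  left_inv x := by
    apply Subtype.ext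
    change ((t.symm (t ⟨x, _⟩) : f ⁻¹' N) : E) = x
    rw [t.symm_apply_apply]
  right_inv p := by
    ext <;> simp
  continuous_toFun := by fun_prop
  continuous_invFun := by fun_prop

end bundle

/-- Sorting coordinates. -/
def coordsHomeomorph (S T S' T' : Type) :
    ((S → ℂ) × (T → ℂ)) × ((S' → ℂ) × (T' → ℂ)) ≃ₜ (S ⊕ S' → ℂ) × (T ⊕ T' → ℂ) :=
  (Homeomorph.prodProdProdComm _ _ _ _).trans
    (Homeomorph.sumArrowHomeomorphProdArrow.symm.prodCongr
      Homeomorph.sumArrowHomeomorphProdArrow.symm)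

theorem coordsHomeomorph_snd_eq_zero {S T S' T' : Type}
    (p : ((S → ℂ) × (T → ℂ)) × ((S' → ℂ) × (T' → ℂ))) :
    (coordsHomeomorph S T S' T' p).2 = 0 ↔ p.1.2 = 0 ∧ p.2.2 = 0 := by
  have : (coordsHomeomorph S T S' T' p).2 = Sum.elim p.1.2 p.2.2 := rfl
  rw [this]
  constructor
  · intro h
    exact ⟨funext fun i => congrFun h (Sum.inl i), funext fun i => congrFun h (Sum.inr i)⟩
  · rintro ⟨h1, h2⟩
    rw [h1, h2]
    funext i
    cases i <;> rfl

/-- The total space of a bundle trivialised over the charts of the base. -/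
def bundle {E B : Type} [TopologicalSpace E] [TopologicalSpace B] {f : E → B} (hf : Continuous f)
    (P : Paving B ι b) {κ : Type} [LinearOrder κ] {c : κ → ℕ} {F : ι → Type}
    [∀ i, TopologicalSpace (F i)] (Q : ∀ i, Paving (F i) κ c)
    (t : ∀ i, f ⁻¹' P.N i ≃ₜ P.N i × F i) (ht : ∀ i x, ((t i x).1 : B) = f x) :
    Paving E (ι ×ₗ κ) (fun p => b (ofLex p).1 + c (ofLex p).2) where
  N p := bundleSet (t (ofLex p).1) ((Q _).N (ofLex p).2)
  isOpen p := isOpen_bundleSet hf (P.isOpen _) _ ((Q _).isOpen _)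
  cover x := by
    obtain ⟨i, hi⟩ := P.cover (f x)
    obtain ⟨j, hj⟩ := (Q i).cover (t i ⟨x, hi⟩).2
    exact ⟨toLex (i, j), mem_bundleSet.2 ⟨hi, hj⟩⟩
  S p := P.S (ofLex p).1 ⊕ (Q (ofLex p).1).S (ofLex p).2
  T p := P.T (ofLex p).1 ⊕ (Q (ofLex p).1).T (ofLex p).2
  card_T p := by rw [Fintype.card_sum, P.card_T, (Q _).card_T]
  chart p := (bundleHomeomorph _ _).trans
    (((P.chart _).prodCongr ((Q _).chart _)).trans (coordsHomeomorph _ _ _ _))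
  zero_iff p x := by
    obtain ⟨i, j⟩ := p
    obtain ⟨hi, hj⟩ := mem_bundleSet.1 x.2
    refine (coordsHomeomorph_snd_eq_zero _).trans ?_
    refine (and_congr (P.zero_iff i _) ((Q i).zero_iff j _)).trans ?_
    have hfx : (((t i) ⟨x, hi⟩).1 : B) = f x := ht i _
    constructor
    · rintro ⟨h1, h2⟩ ⟨i', j'⟩ hlt hx
      obtain ⟨hi', hj'⟩ := mem_bundleSet.1 hx
      rcases (Prod.Lex.lt_iff).1 hlt with h | ⟨h, h'⟩
      · exact h1 i' h (hfx ▸ hi')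
      · obtain rfl : i' = i := h
        exact h2 j' h' hj'
    · intro h
      refine ⟨fun i' hi' hx => ?_, fun j' hj' hx => ?_⟩
      · have hx' : f x ∈ P.N i' := hfx ▸ hx
        -- The fibre charts over an earlier base chart cover everything above it, so avoiding all of
        -- them means avoiding that base chart.
        obtain ⟨j', hj'⟩ := (Q i').cover (t i' ⟨x, hx'⟩).2
        exact h (toLex (i', j')) (Prod.Lex.lt_iff.2 (Or.inl hi')) (mem_bundleSet.2 ⟨hx', hj'⟩)
      · exact h (toLex (i, j')) (Prod.Lex.lt_iff.2 (Or.inr ⟨rfl, hj'⟩)) (mem_bundleSet.2 ⟨hi, hx⟩)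

end Paving

end

noncomputable section

/-! ### Topology of Grassmannians -/

/-- Hermitian space of dimension `l`. -/
abbrev Eu (l : ℕ) : Type := EuclideanSpace ℂ (Fin l)

/-- Endomorphisms of the Hermitian space. -/
abbrev EuEnd (l : ℕ) : Type := Eu l →L[ℂ] Eu l

namespace EuEnd

variable {l : ℕ}

theorem isUnit_of_injective {M : EuEnd l} (h : ∀ x, M x = 0 → x = 0) : IsUnit M := by
  have hinj : Function.Injective M := (injective_iff_map_eq_zero M).2 h
  have hsurj : Function.Surjective M := LinearMap.surjective_of_injective (f := (M : Eu l →ₗ[ℂ] Eu l)) hinj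
  let e := ContinuousLinearEquiv.ofBijective M (LinearMap.ker_eq_bot.2 hinj) (LinearMap.range_eq_top.2 hsurj)
  refine ⟨ContinuousLinearEquiv.toUnit e, ?_⟩
  ext x
  rfl

theorem inverse_apply_self {M : EuEnd l} (h : IsUnit M) (x : Eu l) : Ring.inverse M (M x) = x :=
  DFunLike.congr_fun (Ring.inverse_mul_cancel M h) x

theorem apply_inverse_self {M : EuEnd l} (h : IsUnit M) (x : Eu l) : M (Ring.inverse M x) = x :=
  DFunLike.congr_fun (Ring.mul_inverse_cancel M h) x

theorem continuous_inverse {Y : Type*} [TopologicalSpace Y] {M : Y → EuEnd l} (hM : Continuous M)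
    (h : ∀ y, IsUnit (M y)) : Continuous fun y => Ring.inverse (M y) := by
  rw [continuous_iff_continuousAt]
  intro y
  obtain ⟨u, hu⟩ := h y
  have := NormedRing.inverse_continuousAt u
  rw [hu] at this
  exact ContinuousAt.comp (g := Ring.inverse) (f := M) this hM.continuousAt

/-- The operator Q - Q* is skew-adjoint, so the real part of ⟨x, (1 + Q - Q*) x⟩ is ‖x‖² and the
kernel is zero. -/
theorem isUnit_one_add_sub_adjoint (Q : EuEnd l) :
    IsUnit (1 + Q - ContinuousLinearMap.adjoint Q) := by
  refine isUnit_of_injective fun x hx => ?_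
  have h1 : inner ℂ x ((1 + Q - ContinuousLinearMap.adjoint Q) x) = 0 := by rw [hx, inner_zero_right]
  have h2 : inner ℂ x ((1 + Q - ContinuousLinearMap.adjoint Q) x) =
      inner ℂ x x + inner ℂ x (Q x) - inner ℂ (Q x) x := by
    rw [← ContinuousLinearMap.adjoint_inner_right, ← inner_add_right, ← inner_sub_right]
    rfl
  rw [h2, ← inner_conj_symm (Q x) x] at h1
  have h3 := congrArg Complex.re h1
  simp only [Complex.sub_re, Complex.add_re, Complex.conj_re, Complex.zero_re,
    add_sub_cancel_right] at h3
  have h4 : RCLike.re (inner ℂ x x) = 0 := h3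
  rw [inner_self_eq_norm_sq] at h4
  simpa using h4

/-- The orthogonal projection in terms of an arbitrary projection with the same range. -/
theorem starProjection_eq {V : Submodule ℂ (Eu l)} {Q : EuEnd l} (h1 : ∀ x, Q x ∈ V)
    (h2 : ∀ x ∈ V, Q x = x) :
    V.starProjection = Q * Ring.inverse (1 + Q - ContinuousLinearMap.adjoint Q) := by
  have hPQ : V.starProjection * Q = Q := by
    ext1 x
    exact Submodule.starProjection_eq_self_iff.2 (h1 x)
  have hQP : Q * V.starProjection = V.starProjection := by
    ext1 x
    exact h2 _ (V.starProjection_apply_mem x)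
  have hP : star V.starProjection = V.starProjection := isSelfAdjoint_starProjection V
  have hPQ' : V.starProjection * ContinuousLinearMap.adjoint Q = V.starProjection := by
    have := congrArg star hQP
    rw [star_mul, hP] at this
    exact this
  -- With P the orthogonal projection, PQ = Q, and the adjoint of QP = P gives PQ* = P; so P(1 + Q -
  -- Q*) = Q.
  have hR : V.starProjection * (1 + Q - ContinuousLinearMap.adjoint Q) = Q := by
    rw [mul_sub, mul_add, mul_one, hPQ, hPQ']
    abel
  have h := congrArg (· * Ring.inverse (1 + Q - ContinuousLinearMap.adjoint Q)) hR
  rwa [mul_assoc, Ring.mul_inverse_cancel _ (isUnit_one_add_sub_adjoint Q), mul_one] at h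

end EuEnd

namespace Gr

variable {l k : ℕ}

/-- The orthogonal projection. -/
abbrev P (Z : Gr k l) : EuEnd l := Z.space.starProjection

theorem continuous_P : Continuous (P : Gr k l → EuEnd l) := continuous_induced_dom

theorem continuous_iff {Y : Type*} [TopologicalSpace Y] {f : Y → Gr k l} :
    Continuous f ↔ Continuous fun y => (f y).P := continuous_induced_rng

theorem ext {Z Z' : Gr k l} (h : Z.space = Z'.space) : Z = Z' := Subtype.ext h

theorem eq_of_le {Z Z' : Gr k l} (h : Z.space ≤ Z'.space) : Z = Z' :=
  ext (Submodule.eq_of_le_of_finrank_eq h (Z.2.trans Z'.2.symm))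

/-- A family of subspaces is continuous as soon as it is the family of ranges of a continuous family
of projections. -/
theorem continuous_of_projections {Y : Type*} [TopologicalSpace Y] {f : Y → Gr k l}
    {Q : Y → EuEnd l} (hQ : Continuous Q) (h1 : ∀ y x, Q y x ∈ (f y).space)
    (h2 : ∀ y, ∀ x ∈ (f y).space, Q y x = x) : Continuous f := by
  rw [continuous_iff]
  have : (fun y => (f y).P) =
      fun y => Q y * Ring.inverse (1 + Q y - ContinuousLinearMap.adjoint (Q y)) :=
    funext fun y => EuEnd.starProjection_eq (h1 y) (h2 y)
  rw [this]
  refine hQ.mul (EuEnd.continuous_inverse ?_ fun y => EuEnd.isUnit_one_add_sub_adjoint _)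
  exact (continuous_const.add hQ).sub (ContinuousLinearMap.adjoint.continuous.comp hQ)

/-- The image of a subspace under an automorphism. -/
def image (g h : EuEnd l) (hg : h * g = 1) (Z : Gr k l) : Gr k l :=
  ⟨Z.space.map (g : Eu l →ₗ[ℂ] Eu l), by
    have hinj : Function.Injective (g : Eu l →ₗ[ℂ] Eu l) := fun x y hxy => by
      have := congrArg h hxy
      exact (DFunLike.congr_fun hg x).symm.trans (this.trans (DFunLike.congr_fun hg y))
    exact (LinearEquiv.finrank_eq (Submodule.equivMapOfInjective _ hinj Z.space)).symm.trans Z.2⟩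

theorem mem_image {g h : EuEnd l} {hg : h * g = 1} {Z : Gr k l} {x : Eu l} :
    x ∈ (Z.image g h hg).space ↔ ∃ z ∈ Z.space, g z = x := Iff.rfl

theorem continuous_image {Y : Type*} [TopologicalSpace Y] {g h : Y → EuEnd l} (hg : Continuous g)
    (hh : Continuous h) (hgh : ∀ y, h y * g y = 1) {f : Y → Gr k l} (hf : Continuous f) :
    Continuous fun y => (f y).image (g y) (h y) (hgh y) := by
  refine continuous_of_projections (Q := fun y => g y * (f y).P * h y)
    ((hg.mul (continuous_P.comp hf)).mul hh) (fun y x => ?_) (fun y x hx => ?_)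
  · exact ⟨_, (f y).space.starProjection_apply_mem _, rfl⟩
  · obtain ⟨z, hz, rfl⟩ := mem_image.1 hx
    have h1 : h y (g y z) = z := DFunLike.congr_fun (hgh y) z
    change g y ((f y).P (h y (g y z))) = g y z
    rw [h1, Submodule.starProjection_eq_self_iff.2 hz]

end Gr

end

noncomputable section

/-! ### Transverse subspaces and oblique projections -/

namespace Gr

variable {l k : ℕ}

theorem P_mem (Z : Gr k l) (x : Eu l) : Z.P x ∈ Z.space := Z.space.starProjection_apply_mem x

theorem P_eq_self {Z : Gr k l} {x : Eu l} (h : x ∈ Z.space) : Z.P x = x :=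
  Submodule.starProjection_eq_self_iff.2 h

theorem P_eq_zero {Z : Gr k l} {x : Eu l} : Z.P x = 0 ↔ x ∈ Z.spaceᗮ :=
  Submodule.starProjection_apply_eq_zero_iff _

/-- `Z` meets the orthogonal complement of `L` trivially. -/
def Transverse (Z L : Gr k l) : Prop := ∀ z ∈ Z.space, z ∈ L.spaceᗮ → z = 0

/-- The operator that projects `Z` to `L` and the complement of `Z` to the complement of `L`. -/
def mix (Z L : Gr k l) : EuEnd l := L.P * Z.P + (1 - L.P) * (1 - Z.P)

theorem mix_apply (Z L : Gr k l) (x : Eu l) :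
    Z.mix L x = L.P (Z.P x) + ((x - Z.P x) - L.P (x - Z.P x)) := rfl

theorem P_mix (Z L : Gr k l) (x : Eu l) : L.P (Z.mix L x) = L.P (Z.P x) := by
  rw [mix_apply, map_add, map_sub, P_eq_self (L.P_mem _), P_eq_self (L.P_mem _), sub_self, add_zero]

theorem Transverse.exists_P_eq {Z L : Gr k l} (h : Z.Transverse L) {x : Eu l} (hx : x ∈ L.space) :
    ∃ z ∈ Z.space, L.P z = x := by
  let φ : Z.space →ₗ[ℂ] L.space :=
    ((L.P : Eu l →ₗ[ℂ] Eu l).comp Z.space.subtype).codRestrict L.space fun z => L.P_mem z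
  have hφ : Function.Injective φ := by
    rw [injective_iff_map_eq_zero]
    intro z hz
    exact Subtype.ext (h z z.2 (P_eq_zero.1 (congrArg Subtype.val hz)))
  obtain ⟨z, hz⟩ := (LinearMap.injective_iff_surjective_of_finrank_eq_finrank
    (Z.2.trans L.2.symm)).1 hφ ⟨x, hx⟩
  exact ⟨z, z.2, congrArg Subtype.val hz⟩

/-- Transversality becomes invertibility of an operator continuous in Z, which is an open condition
with continuous inverse. A vector x killed by `mix` lies in L and is orthogonal to Z; being the
projection to L of some z in Z, it is orthogonal to itself. Conversely `mix` kills Z ∩ Lᗮ. -/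
theorem transverse_iff_isUnit {Z L : Gr k l} : Z.Transverse L ↔ IsUnit (Z.mix L) := by
  constructor
  · intro h
    refine EuEnd.isUnit_of_injective fun x hx => ?_
    have h1 : L.P (Z.P x) = 0 := by rw [← P_mix, hx, map_zero]
    have h2 : Z.P x = 0 := h _ (Z.P_mem x) (P_eq_zero.1 h1)
    rw [mix_apply, h2, map_zero, zero_add, sub_zero, sub_eq_zero] at hx
    obtain ⟨z, hz, hzx⟩ := h.exists_P_eq (show x ∈ L.space from hx.symm ▸ L.P_mem x)
    have h3 : inner ℂ x x = (0 : ℂ) := by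
      nth_rewrite 1 [← hzx]
      rw [Submodule.inner_starProjection_left_eq_right, ← hx]
      exact P_eq_zero.1 h2 z hz
    exact inner_self_eq_zero.1 h3
  · intro h z hz hL
    rw [← EuEnd.inverse_apply_self h z, mix_apply, P_eq_self hz, P_eq_zero.2 hL]
    simp

/-- The projection onto `Z` with kernel the orthogonal complement of `L`. -/
def oblique (Z L : Gr k l) : EuEnd l := Z.P * Ring.inverse (Z.mix L) * L.P

theorem oblique_mem (Z L : Gr k l) (x : Eu l) : Z.oblique L x ∈ Z.space := Z.P_mem _

theorem Transverse.P_oblique {Z L : Gr k l} (h : Z.Transverse L) (x : Eu l) :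
    L.P (Z.oblique L x) = L.P x := by
  change L.P (Z.P (Ring.inverse (Z.mix L) (L.P x))) = L.P x
  rw [← P_mix, EuEnd.apply_inverse_self (transverse_iff_isUnit.1 h), P_eq_self (L.P_mem x)]

theorem Transverse.oblique_eq {Z L : Gr k l} (h : Z.Transverse L) {x z : Eu l} (hz : z ∈ Z.space)
    (hx : L.P z = L.P x) : Z.oblique L x = z := by
  rw [← sub_eq_zero]
  refine h _ (sub_mem (Z.oblique_mem L x) hz) (P_eq_zero.1 ?_)
  rw [map_sub, h.P_oblique, hx, sub_self]

theorem Transverse.inner_oblique {Z L : Gr k l} (h : Z.Transverse L) {y : Eu l} (hy : y ∈ L.space)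
    (x : Eu l) : inner ℂ y (Z.oblique L x) = inner ℂ y x := by
  rw [← P_eq_self hy, Submodule.inner_starProjection_left_eq_right, h.P_oblique,
    ← Submodule.inner_starProjection_left_eq_right]

theorem isOpen_transverse (L : Gr k l) : IsOpen {Z : Gr k l | Z.Transverse L} := by
  have : {Z : Gr k l | Z.Transverse L} = (fun Z => Z.mix L) ⁻¹' {M | IsUnit M} :=
    Set.ext fun Z => transverse_iff_isUnit
  rw [this]
  refine Units.isOpen.preimage ?_
  have := continuous_P (k := k) (l := l)
  unfold mix
  fun_prop

theorem continuous_oblique {Y : Type*} [TopologicalSpace Y] {f : Y → Gr k l} (hf : Continuous f)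
    {L : Gr k l} (h : ∀ y, (f y).Transverse L) : Continuous fun y => (f y).oblique L := by
  have hP := continuous_P.comp hf
  have hM : Continuous fun y => (f y).mix L :=
    (continuous_const.mul hP).add (continuous_const.mul (continuous_const.sub hP))
  exact (hP.mul (EuEnd.continuous_inverse hM fun y => transverse_iff_isUnit.1 (h y))).mul
    continuous_const

/-- The operator whose graph over `L` is `Z`. -/
def slope (Z L : Gr k l) : EuEnd l := Z.oblique L - L.P

theorem slope_apply (Z L : Gr k l) (x : Eu l) : Z.slope L x = Z.oblique L x - L.P x := rfl

/-- The slope takes values in Lᗮ and depends only on the projection of its argument to L. -/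
theorem Transverse.slope_mul_slope {Z L : Gr k l} (h : Z.Transverse L) :
    Z.slope L * Z.slope L = 0 := by
  ext1 x
  change Z.slope L (Z.slope L x) = 0
  rw [slope_apply, slope_apply, map_sub, map_sub, h.P_oblique, P_eq_self (L.P_mem x),
    h.oblique_eq (Z.oblique_mem L x) rfl,
    h.oblique_eq (Z.oblique_mem L x) ((h.P_oblique x).trans (P_eq_self (L.P_mem x)).symm)]
  abel

theorem add_slope (Z : Gr k l) {L : Gr k l} {x : Eu l} (hx : x ∈ L.space) :
    x + Z.slope L x = Z.oblique L x := by
  rw [slope_apply, P_eq_self hx]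
  abel

theorem slope_mem {Z L : Gr k l} {W : Submodule ℂ (Eu l)} (hZ : Z.space ≤ W) (hL : L.space ≤ W)
    (x : Eu l) : Z.slope L x ∈ W :=
  sub_mem (hZ (Z.oblique_mem L x)) (hL (L.P_mem x))

theorem continuous_slope {Y : Type*} [TopologicalSpace Y] {f : Y → Gr k l} (hf : Continuous f)
    {L : Gr k l} (h : ∀ y, (f y).Transverse L) : Continuous fun y => (f y).slope L :=
  (continuous_oblique hf h).sub continuous_const

end Gr

/-- `1 + T` and `1 - T` are inverse to each other when `T² = 0`. -/
theorem EuEnd.one_sub_mul_one_add {l : ℕ} {T : EuEnd l} (h : T * T = 0) : (1 - T) * (1 + T) = 1 := by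
  rw [sub_mul, mul_add, mul_add, h]
  simp

theorem EuEnd.one_add_mul_one_sub {l : ℕ} {T : EuEnd l} (h : T * T = 0) : (1 + T) * (1 - T) = 1 := by
  rw [add_mul, mul_sub, mul_sub, h]
  simp

end

noncomputable section

/-! ### The cells of a relative Grassmannian -/

/-- An orthonormal basis of the orthogonal complement of `A` in `W`. -/
structure AdaptedFrame {l : ℕ} (A W : Submodule ℂ (Eu l)) (N : ℕ) where
  vec : Fin N → Eu l
  orthonormal : Orthonormal ℂ vec
  le : A ≤ W
  mem : ∀ i, vec i ∈ W
  perp : ∀ a ∈ A, ∀ i, inner ℂ a (vec i) = 0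
  eq_zero : ∀ w ∈ W, (∀ a ∈ A, inner ℂ a w = 0) → (∀ i, inner ℂ (vec i) w = 0) → w = 0

/-- The subspaces of dimension `r` between `A` and `W`. -/
abbrev RelGr {l : ℕ} (A W : Submodule ℂ (Eu l)) (r : ℕ) : Type :=
  {Z : Gr r l // A ≤ Z.space ∧ Z.space ≤ W}

namespace AdaptedFrame

variable {l : ℕ} {A W : Submodule ℂ (Eu l)} {N : ℕ}

theorem nonempty (h : A ≤ W) (hN : Module.finrank ℂ A + N = Module.finrank ℂ W) :
    Nonempty (AdaptedFrame A W N) := by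
  have hd := Submodule.finrank_add_inf_finrank_orthogonal' h hN
  let u := (stdOrthonormalBasis ℂ (Aᗮ ⊓ W : Submodule ℂ (Eu l))).reindex (finCongr hd)
  refine ⟨⟨fun i => u i, ?_, h, fun i => (u i).2.2, fun a ha i => (u i).2.1 a ha, ?_⟩⟩
  · exact u.orthonormal.comp_linearIsometry (Aᗮ ⊓ W : Submodule ℂ (Eu l)).subtypeₗᵢ
  · intro w hw hA hu
    have h0 : (⟨w, hA, hw⟩ : (Aᗮ ⊓ W : Submodule ℂ (Eu l))) = 0 := by
      rw [← u.sum_repr' ⟨w, hA, hw⟩]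
      exact Finset.sum_eq_zero fun i _ => by
        rw [show inner ℂ (u i) ⟨w, hA, hw⟩ = 0 from hu i, zero_smul]
    exact congrArg Subtype.val h0

variable (e : AdaptedFrame A W N)

theorem inner_vec (i j : Fin N) : inner ℂ (e.vec i) (e.vec j) = if i = j then (1 : ℂ) else 0 :=
  orthonormal_iff_ite.1 e.orthonormal i j

theorem perp' {a : Eu l} (ha : a ∈ A) (i : Fin N) : inner ℂ (e.vec i) a = 0 :=
  inner_eq_zero_symm.1 (e.perp a ha i)

/-- The subspace spanned by `A` and the frame vectors with indices in `I`. -/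
def coordSpace (I : Finset (Fin N)) : Submodule ℂ (Eu l) :=
  A ⊔ Submodule.span ℂ (e.vec '' I)

variable {e}

theorem le_coordSpace {I : Finset (Fin N)} : A ≤ e.coordSpace I := le_sup_left

theorem vec_mem_coordSpace {I : Finset (Fin N)} {i : Fin N} (hi : i ∈ I) :
    e.vec i ∈ e.coordSpace I :=
  Submodule.mem_sup_right (Submodule.subset_span ⟨i, hi, rfl⟩)

theorem coordSpace_le_iff {I : Finset (Fin N)} {U : Submodule ℂ (Eu l)} :
    e.coordSpace I ≤ U ↔ A ≤ U ∧ ∀ i ∈ I, e.vec i ∈ U := by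
  rw [coordSpace, sup_le_iff, Submodule.span_le, Set.image_subset_iff]
  rfl

theorem coordSpace_le {I : Finset (Fin N)} : e.coordSpace I ≤ W :=
  coordSpace_le_iff.2 ⟨e.le, fun i _ => e.mem i⟩

theorem mem_orthogonal_coordSpace {I : Finset (Fin N)} {x : Eu l} :
    x ∈ (e.coordSpace I)ᗮ ↔ (∀ a ∈ A, inner ℂ a x = 0) ∧ ∀ i ∈ I, inner ℂ (e.vec i) x = 0 := by
  constructor
  · intro h
    exact ⟨fun a ha => h a (le_coordSpace ha), fun i hi => h _ (vec_mem_coordSpace hi)⟩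
  · rintro ⟨h1, h2⟩
    have : e.coordSpace I ≤ (Submodule.span ℂ {x})ᗮ := by
      refine coordSpace_le_iff.2 ⟨fun a ha => ?_, fun i hi => ?_⟩
      · exact Submodule.mem_orthogonal_singleton_iff_inner_left.2 (h1 a ha)
      · exact Submodule.mem_orthogonal_singleton_iff_inner_left.2 (h2 i hi)
    intro y hy
    exact Submodule.mem_orthogonal_singleton_iff_inner_left.1 (this hy)

theorem finrank_coordSpace (I : Finset (Fin N)) :
    Module.finrank ℂ (e.coordSpace I) = Module.finrank ℂ A + I.card := by
  have hinf : A ⊓ Submodule.span ℂ (e.vec '' I) = ⊥ := by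
    rw [eq_bot_iff]
    rintro x ⟨hA, hI⟩
    have : Submodule.span ℂ (e.vec '' I) ≤ Aᗮ := by
      rw [Submodule.span_le]
      rintro _ ⟨i, -, rfl⟩
      exact fun a ha => e.perp a ha i
    exact inner_self_eq_zero.1 (this hI x hA)
  have h := Submodule.finrank_sup_add_finrank_inf_eq A (Submodule.span ℂ (e.vec '' I))
  rw [hinf, finrank_bot, add_zero] at h
  rw [coordSpace, h]
  congr 1
  have hli : LinearIndependent ℂ (fun i : I => e.vec i) :=
    e.orthonormal.linearIndependent.comp _ Subtype.val_injective
  have := finrank_span_eq_card hli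
  rw [Fintype.card_coe] at this
  rw [← this]
  rw [Set.image_eq_range]
  rfl

theorem eq_sum {w : Eu l} (hw : w ∈ W) (hA : ∀ a ∈ A, inner ℂ a w = 0) :
    w = ∑ i, inner ℂ (e.vec i) w • e.vec i := by
  rw [← sub_eq_zero]
  refine e.eq_zero _ (sub_mem hw (sum_mem fun i _ => W.smul_mem _ (e.mem i))) (fun a ha => ?_)
    fun j => ?_
  · rw [inner_sub_right, hA a ha, inner_sum]
    simp [inner_smul_right, e.perp a ha]
  · rw [inner_sub_right, inner_sum]
    simp [inner_smul_right, e.inner_vec]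

end AdaptedFrame

/-- The indices of the cells: the `s`-element subsets of an `N`-element set, in reversed
colexicographic order. -/
abbrev CellIndex (N s : ℕ) : Type :=
  {I : (Colex (Finset (Fin N)))ᵒᵈ // (ofColex (OrderDual.ofDual I)).card = s}

namespace CellIndex

variable {N s : ℕ}

/-- The underlying finite set. -/
def set (I : CellIndex N s) : Finset (Fin N) := ofColex (OrderDual.ofDual I.1)

theorem card_set (I : CellIndex N s) : I.set.card = s := I.2

/-- The index with a given underlying set. -/
def ofSet (I : Finset (Fin N)) (h : I.card = s) : CellIndex N s :=
  ⟨OrderDual.toDual (toColex I), h⟩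

/-- The earlier index is the colexicographically larger set; thus the cell of codimension 0, for the
last s indices, comes first. -/
theorem lt_iff {I J : CellIndex N s} :
    J < I ↔ ∃ w ∈ J.set, w ∉ I.set ∧ ∀ i ∈ I.set, i ∉ J.set → i < w :=
  Finset.Colex.lt_iff_exists_forall_lt (s := OrderDual.ofDual I.1) (t := OrderDual.ofDual J.1)

/-- The coordinates normal to the cell. -/
abbrev Normal (I : CellIndex N s) : Type :=
  {p : Fin N × Fin N // p.1 ∈ I.set ∧ p.2 ∉ I.set ∧ p.1 < p.2}

/-- The coordinates along the cell. -/
abbrev Tangent (I : CellIndex N s) : Type :=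
  {p : Fin N × Fin N // p.1 ∈ I.set ∧ p.2 ∉ I.set ∧ p.2 < p.1}

/-- The codimension of the cell. -/
def codim (I : CellIndex N s) : ℕ := Fintype.card I.Normal

end CellIndex

namespace AdaptedFrame

variable {l : ℕ} {A W : Submodule ℂ (Eu l)} {N s r : ℕ} (e : AdaptedFrame A W N)
  (hr : Module.finrank ℂ A + s = r)

/-- The centre of a cell. -/
def centre (I : CellIndex N s) : Gr r l :=
  ⟨e.coordSpace I.set, by rw [finrank_coordSpace, I.card_set, hr]⟩

theorem centre_space (I : CellIndex N s) : (e.centre hr I).space = e.coordSpace I.set := rfl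

/-- The chart domain around a cell. -/
def chartSet (I : CellIndex N s) : Set (RelGr A W r) := {Z | Z.1.Transverse (e.centre hr I)}

theorem isOpen_chartSet (I : CellIndex N s) : IsOpen (e.chartSet hr I) :=
  (Gr.isOpen_transverse (e.centre hr I)).preimage continuous_subtype_val

variable {e} {hr}

theorem mem_chartSet {I : CellIndex N s} {Z : RelGr A W r} : Z ∈ e.chartSet hr I ↔
    ∀ z ∈ Z.1.space, (∀ a ∈ A, inner ℂ a z = 0) → (∀ i ∈ I.set, inner ℂ (e.vec i) z = 0) → z = 0 :=
  forall₂_congr fun z _ => by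
    rw [centre_space, mem_orthogonal_coordSpace, and_imp]

/-- Greedy choice of coordinates: as long as Z contains a nonzero vector orthogonal to A and to the
chosen frame vectors, some further frame vector pairs nontrivially with it, and adding that index
lowers the dimension of what is left. -/
theorem exists_mem_chartSet (Z : RelGr A W r) : ∃ I, Z ∈ e.chartSet hr I := by
  have hZ : Module.finrank ℂ A + s = Module.finrank ℂ Z.1.space := hr.trans Z.1.2.symm
  let K : Finset (Fin N) → Submodule ℂ (Eu l) := fun I => Z.1.space ⊓ (e.coordSpace I)ᗮ
  have key : ∀ n ≤ s, ∃ I : Finset (Fin N), I.card ≤ n ∧ Module.finrank ℂ (K I) + n ≤ s := by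
    intro n
    induction n with
    | zero =>
      refine fun _ => ⟨∅, le_rfl, ?_⟩
      have h0 : K ∅ = Aᗮ ⊓ Z.1.space := by
        change _ ⊓ _ = _
        rw [inf_comm]
        simp [coordSpace]
      rw [h0, Submodule.finrank_add_inf_finrank_orthogonal' Z.2.1 hZ, add_zero]
    | succ n ih =>
      intro hn
      obtain ⟨I, hI, hd⟩ := ih (Nat.le_of_succ_le hn)
      by_cases hK : K I = ⊥
      · refine ⟨I, hI.trans n.le_succ, ?_⟩
        rw [hK, finrank_bot, zero_add]
        exact hn
      · obtain ⟨z, hz, hz0⟩ := Submodule.exists_mem_ne_zero_of_ne_bot hK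
        obtain ⟨hzA, hzI⟩ := mem_orthogonal_coordSpace.1 hz.2
        have : ∃ i, inner ℂ (e.vec i) z ≠ 0 := by
          by_contra! h
          exact hz0 (e.eq_zero z (Z.2.2 hz.1) hzA h)
        obtain ⟨i, hi⟩ := this
        refine ⟨insert i I, (Finset.card_insert_le _ _).trans (Nat.succ_le_succ hI), ?_⟩
        have hlt : K (insert i I) < K I := by
          refine lt_of_le_of_ne (inf_le_inf_left _ (Submodule.orthogonal_le ?_)) fun h => ?_
          · exact coordSpace_le_iff.2 ⟨le_coordSpace, fun j hj =>
              vec_mem_coordSpace (Finset.mem_insert_of_mem hj)⟩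
          · have h1 : z ∈ K (insert i I) := h.symm ▸ hz
            exact hi ((mem_orthogonal_coordSpace.1 h1.2).2 i (Finset.mem_insert_self i I))
        have := Submodule.finrank_lt_finrank_of_lt hlt
        omega
  obtain ⟨I, hI, hd⟩ := key s le_rfl
  -- Needed to enlarge `I` to exactly s indices. It holds since Z lies in the span of A and the
  -- whole frame.
  have hsN : s ≤ Fintype.card (Fin N) := by
    have h1 : Module.finrank ℂ Z.1.space ≤ Module.finrank ℂ (e.coordSpace Finset.univ) := by
      refine Submodule.finrank_mono fun z hz => ?_
      have hp := Submodule.starProjection_add_starProjection_orthogonal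
        (K := e.coordSpace Finset.univ) z
      have hmem : (e.coordSpace Finset.univ)ᗮ.starProjection z ∈ (e.coordSpace Finset.univ)ᗮ :=
        Submodule.starProjection_apply_mem _ _
      have hW : (e.coordSpace Finset.univ)ᗮ.starProjection z ∈ W := by
        rw [← add_sub_cancel_left ((e.coordSpace Finset.univ).starProjection z)
          ((e.coordSpace Finset.univ)ᗮ.starProjection z), hp]
        exact sub_mem (Z.2.2 hz) (coordSpace_le (Submodule.starProjection_apply_mem _ _))
      obtain ⟨h1, h2⟩ := mem_orthogonal_coordSpace.1 hmem
      rw [e.eq_zero _ hW h1 fun i => h2 i (Finset.mem_univ i), add_zero] at hp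
      rw [← hp]
      exact Submodule.starProjection_apply_mem _ _
    rw [finrank_coordSpace, Finset.card_univ] at h1
    omega
  obtain ⟨J, hIJ, hJ⟩ := Finset.exists_superset_card_eq hI hsN
  refine ⟨CellIndex.ofSet J hJ, mem_chartSet.2 fun z hz hA hzJ => ?_⟩
  have hK : K I = ⊥ := Submodule.finrank_eq_zero.1 (by omega)
  have : z ∈ K I := ⟨hz, mem_orthogonal_coordSpace.2 ⟨hA, fun i hi => hzJ i (hIJ hi)⟩⟩
  rw [hK] at this
  exact this

/-- The entries of the matrix describing `Z` in the chart around the cell with index `I`. -/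
def entry (e : AdaptedFrame A W N) (hr : Module.finrank ℂ A + s = r) (I : CellIndex N s)
    (Z : Gr r l) (p : Fin N × Fin N) : ℂ :=
  inner ℂ (e.vec p.2) (Z.oblique (e.centre hr I) (e.vec p.1))

section

variable {I : CellIndex N s} {Z : RelGr A W r} (hZ : Z ∈ e.chartSet hr I)
include hZ

theorem inner_left_oblique {a : Eu l} (ha : a ∈ A) (i : Fin N) :
    inner ℂ a (Z.1.oblique (e.centre hr I) (e.vec i)) = 0 := by
  rw [Gr.Transverse.inner_oblique hZ (le_coordSpace ha), e.perp a ha]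

theorem inner_vec_oblique {j : Fin N} (hj : j ∈ I.set) (i : Fin N) :
    inner ℂ (e.vec j) (Z.1.oblique (e.centre hr I) (e.vec i)) = if j = i then (1 : ℂ) else 0 := by
  rw [Gr.Transverse.inner_oblique hZ (vec_mem_coordSpace hj), e.inner_vec]

theorem eq_sum_oblique {z : Eu l} (hz : z ∈ Z.1.space) (hA : ∀ a ∈ A, inner ℂ a z = 0) :
    z = ∑ i ∈ I.set, inner ℂ (e.vec i) z • Z.1.oblique (e.centre hr I) (e.vec i) := by
  rw [← sub_eq_zero]
  refine mem_chartSet.1 hZ _ (sub_mem hz (sum_mem fun i _ =>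
    Z.1.space.smul_mem _ (Gr.oblique_mem _ _ _))) (fun a ha => ?_) fun j hj => ?_
  · rw [inner_sub_right, hA a ha, inner_sum, zero_sub, neg_eq_zero]
    exact Finset.sum_eq_zero fun i _ => by
      rw [inner_smul_right, inner_left_oblique hZ ha, mul_zero]
  · rw [inner_sub_right, inner_sum, sub_eq_zero]
    simp only [inner_smul_right, inner_vec_oblique hZ hj]
    simp [hj]

/-- The points of the cell are those in no earlier chart. -/
theorem entry_eq_zero_iff : (∀ p : I.Normal, e.entry hr I Z.1 p = 0) ↔
    ∀ J < I, Z ∉ e.chartSet hr J := by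
  constructor
  -- Let w be the largest index where J and I differ; it belongs to J. The vector u of Z with
  -- J-coordinates 1 at w and 0 elsewhere is expanded in the basis of Z given by I. At the
  -- coordinate w, indices i < w contribute zero entries, and indices i > w lie in J, where u
  -- vanishes; this gives 1 = 0.
  · intro h J hJ hZJ
    obtain ⟨w, hwJ, hwI, hw⟩ := CellIndex.lt_iff.1 hJ
    set u := Z.1.oblique (e.centre hr J) (e.vec w)
    have h1 := congrArg (inner ℂ (e.vec w)) (eq_sum_oblique hZ (Gr.oblique_mem _ _ _)
      fun a ha => inner_left_oblique hZJ ha w)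
    rw [inner_vec_oblique hZJ hwJ, if_pos rfl, inner_sum] at h1
    refine one_ne_zero (h1.trans (Finset.sum_eq_zero fun i hi => ?_))
    rw [inner_smul_right]
    have hne : i ≠ w := fun h => hwI (h ▸ hi)
    by_cases hiw : i < w
    · have h2 : inner ℂ (e.vec w) (Z.1.oblique (e.centre hr I) (e.vec i)) = 0 :=
        h ⟨(i, w), hi, hwI, hiw⟩
      rw [h2, mul_zero]
    · have hiJ : i ∈ J.set := by
        by_contra hiJ
        exact hiw (hw i hi hiJ)
      rw [inner_vec_oblique hZJ hiJ, if_neg hne, zero_mul]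
  -- If the entry (i, j) with i < j is nonzero, exchanging i for j in I gives an earlier chart that
  -- still contains Z.
  · rintro h ⟨⟨i, j⟩, hi, hj, hij⟩
    by_contra hne
    have hcard : (insert j (I.set.erase i)).card = s := by
      rw [Finset.card_insert_of_notMem fun h => hj (Finset.mem_of_mem_erase h),
        Finset.card_erase_add_one hi, I.card_set]
    refine h (CellIndex.ofSet _ hcard) ?_ (mem_chartSet.2 fun z hz hA hJ => ?_)
    · refine CellIndex.lt_iff.2 ⟨j, Finset.mem_insert_self _ _, hj, fun x hx hx' => ?_⟩
      have : x = i := by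
        by_contra hxi
        exact hx' (Finset.mem_insert_of_mem (Finset.mem_erase.2 ⟨hxi, hx⟩))
      exact this ▸ hij
    · have h1 := eq_sum_oblique hZ hz hA
      rw [Finset.sum_eq_single_of_mem i hi fun x hx hxi => by
        rw [hJ x (Finset.mem_insert_of_mem (Finset.mem_erase.2 ⟨hxi, hx⟩)), zero_smul]] at h1
      have h2 := hJ j (Finset.mem_insert_self _ _)
      rw [h1, inner_smul_right] at h2
      rw [h1, (mul_eq_zero.1 h2).resolve_right hne, zero_smul]

end

end AdaptedFrame

end

noncomputable section

/-! ### The paving of a relative Grassmannian -/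

namespace CellIndex

variable {N s : ℕ}

/-- The matrix with given coordinates. -/
def fill (I : CellIndex N s) (c : (I.Tangent → ℂ) × (I.Normal → ℂ)) (p : Fin N × Fin N) : ℂ :=
  if h : p.1 ∈ I.set ∧ p.2 ∉ I.set ∧ p.2 < p.1 then c.1 ⟨p, h⟩
  else if h : p.1 ∈ I.set ∧ p.2 ∉ I.set ∧ p.1 < p.2 then c.2 ⟨p, h⟩ else 0

theorem fill_tangent (I : CellIndex N s) (c : (I.Tangent → ℂ) × (I.Normal → ℂ)) (p : I.Tangent) :
    I.fill c p = c.1 p := dif_pos p.2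

theorem fill_normal (I : CellIndex N s) (c : (I.Tangent → ℂ) × (I.Normal → ℂ)) (p : I.Normal) :
    I.fill c p = c.2 p :=
  (dif_neg fun h => lt_asymm h.2.2 p.2.2.2).trans (dif_pos p.2)

theorem fill_restrict (I : CellIndex N s) (m : Fin N × Fin N → ℂ) {p : Fin N × Fin N}
    (h1 : p.1 ∈ I.set) (h2 : p.2 ∉ I.set) : I.fill (fun q => m q, fun q => m q) p = m p := by
  rcases lt_trichotomy p.1 p.2 with h | h | h
  · exact I.fill_normal (fun q => m q, fun q => m q) ⟨p, h1, h2, h⟩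
  · exact absurd (h ▸ h1) h2
  · exact I.fill_tangent (fun q => m q, fun q => m q) ⟨p, h1, h2, h⟩

theorem continuous_fill (I : CellIndex N s) (p : Fin N × Fin N) :
    Continuous fun c : (I.Tangent → ℂ) × (I.Normal → ℂ) => I.fill c p := by
  unfold fill
  split_ifs <;> fun_prop

end CellIndex

namespace AdaptedFrame

variable {l : ℕ} {A W : Submodule ℂ (Eu l)} {N s r : ℕ} (e : AdaptedFrame A W N)

/-- The operator with a given matrix between the coordinates in `I` and the others. -/
def ofMatrix (I : Finset (Fin N)) (m : Fin N × Fin N → ℂ) : EuEnd l :=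
  ∑ i ∈ I, ∑ j ∈ Iᶜ, m (i, j) • (innerSL ℂ (e.vec i)).smulRight (e.vec j)

theorem ofMatrix_apply (I : Finset (Fin N)) (m : Fin N × Fin N → ℂ) (x : Eu l) :
    e.ofMatrix I m x = ∑ i ∈ I, ∑ j ∈ Iᶜ, m (i, j) • inner ℂ (e.vec i) x • e.vec j := by
  simp only [ofMatrix, sum_apply]
  rfl

variable {I : Finset (Fin N)} {m : Fin N × Fin N → ℂ}

theorem ofMatrix_mem (x : Eu l) : e.ofMatrix I m x ∈ W := by
  rw [ofMatrix_apply]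
  exact sum_mem fun i _ => sum_mem fun j _ => W.smul_mem _ (W.smul_mem _ (e.mem j))

theorem ofMatrix_eq_zero {x : Eu l} (h : ∀ i ∈ I, inner ℂ (e.vec i) x = 0) :
    e.ofMatrix I m x = 0 := by
  rw [ofMatrix_apply]
  exact Finset.sum_eq_zero fun i hi => Finset.sum_eq_zero fun j _ => by
    rw [h i hi, zero_smul, smul_zero]

theorem ofMatrix_vec {i : Fin N} (hi : i ∈ I) :
    e.ofMatrix I m (e.vec i) = ∑ j ∈ Iᶜ, m (i, j) • e.vec j := by
  rw [ofMatrix_apply, Finset.sum_eq_single_of_mem i hi fun x _ hx => ?_]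
  · exact Finset.sum_congr rfl fun j _ => by rw [e.inner_vec, if_pos rfl, one_smul]
  · exact Finset.sum_eq_zero fun j _ => by rw [e.inner_vec, if_neg hx, zero_smul, smul_zero]

theorem ofMatrix_mem_orthogonal (x : Eu l) : e.ofMatrix I m x ∈ (e.coordSpace I)ᗮ := by
  rw [ofMatrix_apply]
  refine sum_mem fun i _ => sum_mem fun j hj => Submodule.smul_mem _ _ (Submodule.smul_mem _ _ ?_)
  refine mem_orthogonal_coordSpace.2 ⟨fun a ha => e.perp a ha j, fun i hi => ?_⟩
  rw [e.inner_vec, if_neg]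
  rintro rfl
  exact Finset.mem_compl.1 hj hi

/-- The image is orthogonal to the coordinate space, and the operator kills everything orthogonal to
the frame vectors in `I`. -/
theorem ofMatrix_mul_self : e.ofMatrix I m * e.ofMatrix I m = 0 := by
  ext1 x
  exact e.ofMatrix_eq_zero (mem_orthogonal_coordSpace.1 (e.ofMatrix_mem_orthogonal x)).2

theorem continuous_ofMatrix {Y : Type*} [TopologicalSpace Y] {m : Y → Fin N × Fin N → ℂ}
    (hm : ∀ p, Continuous fun y => m y p) : Continuous fun y => e.ofMatrix I (m y) := by
  unfold ofMatrix
  exact continuous_finsetSum _ fun i _ => continuous_finsetSum _ fun j _ =>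
    (hm _).smul continuous_const

variable (hr : Module.finrank ℂ A + s = r) (I : CellIndex N s)

/-- The subspace with given matrix in the chart around a cell. -/
def graph (m : Fin N × Fin N → ℂ) : Gr r l :=
  (e.centre hr I).image _ _ (EuEnd.one_sub_mul_one_add (e.ofMatrix_mul_self (I := I.set) (m := m)))

variable {e hr I}

theorem mem_graph {m : Fin N × Fin N → ℂ} {x : Eu l} :
    x ∈ (e.graph hr I m).space ↔ ∃ y ∈ e.coordSpace I.set, y + e.ofMatrix I.set m y = x := Iff.rfl

variable (e hr I)

theorem le_graph (m : Fin N × Fin N → ℂ) : A ≤ (e.graph hr I m).space := fun a ha =>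
  mem_graph.2 ⟨a, le_coordSpace ha, by rw [e.ofMatrix_eq_zero fun i _ => e.perp' ha i, add_zero]⟩

theorem graph_le (m : Fin N × Fin N → ℂ) : (e.graph hr I m).space ≤ W := fun x hx => by
  obtain ⟨y, hy, rfl⟩ := mem_graph.1 hx
  exact add_mem (coordSpace_le hy) (e.ofMatrix_mem y)

theorem transverse_graph (m : Fin N × Fin N → ℂ) :
    (e.graph hr I m).Transverse (e.centre hr I) := by
  intro x hx hL
  obtain ⟨y, hy, rfl⟩ := mem_graph.1 hx
  have h1 : y ∈ (e.coordSpace I.set)ᗮ := by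
    rw [← add_sub_cancel_right y (e.ofMatrix I.set m y)]
    exact sub_mem hL (e.ofMatrix_mem_orthogonal y)
  have h2 : y = 0 := inner_self_eq_zero.1 (h1 y hy)
  rw [h2, map_zero, add_zero]

theorem entry_graph (m : Fin N × Fin N → ℂ) {p : Fin N × Fin N} (h1 : p.1 ∈ I.set)
    (h2 : p.2 ∉ I.set) : e.entry hr I (e.graph hr I m) p = m p := by
  have h : (e.graph hr I m).oblique (e.centre hr I) (e.vec p.1) =
      e.vec p.1 + e.ofMatrix I.set m (e.vec p.1) := by
    refine (e.transverse_graph hr I m).oblique_eq ?_ ?_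
    · exact mem_graph.2 ⟨e.vec p.1, vec_mem_coordSpace h1, rfl⟩
    · have h0 : (e.centre hr I).P (e.ofMatrix I.set m (e.vec p.1)) = 0 :=
        Gr.P_eq_zero.2 (e.ofMatrix_mem_orthogonal _)
      rw [map_add, h0, add_zero]
  rw [entry, h, e.ofMatrix_vec h1, inner_add_right, inner_sum, e.inner_vec,
    if_neg fun h : p.2 = p.1 => h2 (h ▸ h1), zero_add]
  simp [inner_smul_right, e.inner_vec, h2]

theorem continuous_graph {Y : Type*} [TopologicalSpace Y] {m : Y → Fin N × Fin N → ℂ}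
    (hm : ∀ p, Continuous fun y => m y p) : Continuous fun y => e.graph hr I (m y) := by
  have h := e.continuous_ofMatrix (I := I.set) hm
  exact Gr.continuous_image (continuous_const.add h) (continuous_const.sub h)
    (fun y => EuEnd.one_sub_mul_one_add e.ofMatrix_mul_self) continuous_const

variable {e hr I}

/-- Both spaces have dimension r, so one inclusion suffices, checked on A and the frame vectors: the
basis vector of Z over `vec i` is `vec i` plus its entries outside I. -/
theorem graph_eq {Z : RelGr A W r} (hZ : Z ∈ e.chartSet hr I) {m : Fin N × Fin N → ℂ}
    (hm : ∀ i ∈ I.set, ∀ j ∉ I.set, m (i, j) = e.entry hr I Z.1 (i, j)) :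
    e.graph hr I m = Z.1 := by
  refine Gr.eq_of_le fun x hx => ?_
  obtain ⟨y, hy, rfl⟩ := mem_graph.1 hx
  have : e.coordSpace I.set ≤
      Z.1.space.comap ((1 + e.ofMatrix I.set m : EuEnd l) : Eu l →ₗ[ℂ] Eu l) := by
    refine coordSpace_le_iff.2 ⟨fun a ha => ?_, fun i hi => ?_⟩
    · change a + e.ofMatrix I.set m a ∈ Z.1.space
      rw [e.ofMatrix_eq_zero fun i _ => e.perp' ha i, add_zero]
      exact Z.2.1 ha
    · change e.vec i + e.ofMatrix I.set m (e.vec i) ∈ Z.1.space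
      have h1 := e.eq_sum (Z.2.2 (Gr.oblique_mem Z.1 (e.centre hr I) (e.vec i)))
        fun a ha => inner_left_oblique hZ ha i
      rw [← Finset.sum_add_sum_compl I.set] at h1
      have h2 : ∑ j ∈ I.set, inner ℂ (e.vec j) (Z.1.oblique (e.centre hr I) (e.vec i)) • e.vec j =
          e.vec i := by
        rw [Finset.sum_eq_single_of_mem i hi fun j hj hji => by
          rw [inner_vec_oblique hZ hj, if_neg hji, zero_smul]]
        rw [inner_vec_oblique hZ hi, if_pos rfl, one_smul]
      rw [h2] at h1
      rw [e.ofMatrix_vec hi, Finset.sum_congr rfl fun j hj => by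
        rw [hm i hi j (Finset.mem_compl.1 hj)]]
      exact h1 ▸ Gr.oblique_mem Z.1 (e.centre hr I) (e.vec i)
  exact this hy

variable (e hr I)

/-- The chart around a cell. -/
def chart : e.chartSet hr I ≃ₜ (I.Tangent → ℂ) × (I.Normal → ℂ) where
  toFun Z := (fun p => e.entry hr I Z.1.1 p, fun p => e.entry hr I Z.1.1 p)
  invFun c := ⟨⟨e.graph hr I (I.fill c), e.le_graph hr I _, e.graph_le hr I _⟩,
    e.transverse_graph hr I _⟩
  left_inv Z := Subtype.ext (Subtype.ext (graph_eq Z.2 fun i hi j hj =>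
    I.fill_restrict (e.entry hr I Z.1.1) hi hj))
  right_inv c := by
    refine Prod.ext (funext fun p => ?_) (funext fun p => ?_)
    · exact (e.entry_graph hr I _ p.2.1 p.2.2.1).trans (I.fill_tangent c p)
    · exact (e.entry_graph hr I _ p.2.1 p.2.2.1).trans (I.fill_normal c p)
  continuous_toFun := by
    have h : Continuous fun Z : e.chartSet hr I => Z.1.1.oblique (e.centre hr I) :=
      Gr.continuous_oblique (continuous_subtype_val.comp continuous_subtype_val) fun Z => Z.2
    have h2 : ∀ p, Continuous fun Z : e.chartSet hr I => e.entry hr I Z.1.1 p := fun p =>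
      continuous_const.inner (h.clm_apply continuous_const)
    exact (continuous_pi fun p : I.Tangent => h2 p.1).prodMk
      (continuous_pi fun p : I.Normal => h2 p.1)
  continuous_invFun := by
    refine Continuous.subtype_mk (Continuous.subtype_mk ?_ _) _
    exact e.continuous_graph hr I I.continuous_fill

/-- The paving of a relative Grassmannian by Schubert cells. -/
def paving : Paving (RelGr A W r) (CellIndex N s) CellIndex.codim where
  N := e.chartSet hr
  isOpen := e.isOpen_chartSet hr
  cover := exists_mem_chartSet
  S I := I.Tangent
  T I := I.Normal
  card_T _ := rfl
  chart := e.chart hr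
  zero_iff I Z := by
    rw [← entry_eq_zero_iff Z.2]
    exact funext_iff

end AdaptedFrame

end

noncomputable section

/-! ### Towers of relative Grassmannians -/

namespace Gr

variable {l k : ℕ}

theorem image_image {g h : EuEnd l} (hg : h * g = 1) (hh : g * h = 1) (Z : Gr k l) :
    (Z.image g h hg).image h g hh = Z := by
  refine eq_of_le fun x hx => ?_
  obtain ⟨y, hy, rfl⟩ := mem_image.1 hx
  obtain ⟨z, hz, rfl⟩ := mem_image.1 hy
  have : h (g z) = z := DFunLike.congr_fun hg z
  rwa [this]

theorem image_mono {k' : ℕ} {g h : EuEnd l} {hg : h * g = 1} {Z : Gr k l} {Z' : Gr k' l}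
    (hZ : Z.space ≤ Z'.space) : (Z.image g h hg).space ≤ (Z'.image g h hg).space :=
  Submodule.map_mono hZ

/-- The shear carrying `L` to `Z`. -/
def push {j : ℕ} {Z L : Gr k l} (h : Z.Transverse L) (Y : Gr j l) : Gr j l :=
  Y.image (1 + Z.slope L) (1 - Z.slope L) (EuEnd.one_sub_mul_one_add h.slope_mul_slope)

/-- The shear carrying `Z` to `L`. -/
def pull {j : ℕ} {Z L : Gr k l} (h : Z.Transverse L) (Y : Gr j l) : Gr j l :=
  Y.image (1 - Z.slope L) (1 + Z.slope L) (EuEnd.one_add_mul_one_sub h.slope_mul_slope)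

variable {j : ℕ} {Z L : Gr k l} (h : Z.Transverse L) {Y : Gr j l}

theorem push_pull : push h (pull h Y) = Y := image_image _ _ _

theorem pull_push : pull h (push h Y) = Y := image_image _ _ _

/-- On L the shear 1 + slope is the oblique projection onto Z; its inverse therefore carries Z back
to L. -/
theorem le_pull (hY : Z.space ≤ Y.space) : L.space ≤ (pull h Y).space := fun x hx => by
  refine mem_image.2 ⟨x + Z.slope L x, hY ?_, ?_⟩
  · rw [add_slope Z hx]
    exact Z.oblique_mem L x
  · exact DFunLike.congr_fun (EuEnd.one_sub_mul_one_add h.slope_mul_slope) x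

theorem le_push (hY : L.space ≤ Y.space) : Z.space ≤ (push h Y).space := fun x hx => by
  refine mem_image.2 ⟨L.P x, hY (L.P_mem x), ?_⟩
  change L.P x + Z.slope L (L.P x) = x
  rw [add_slope Z (L.P_mem x)]
  exact h.oblique_eq hx (P_eq_self (L.P_mem x)).symm

theorem push_mono {j' : ℕ} {Y' : Gr j' l} (hY : Y.space ≤ Y'.space) :
    (push h Y).space ≤ (push h Y').space := image_mono hY

theorem push_le {W : Submodule ℂ (Eu l)} (hY : Y.space ≤ W) (hT : ∀ x, Z.slope L x ∈ W) :
    (push h Y).space ≤ W := fun x hx => by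
  obtain ⟨z, hz, rfl⟩ := mem_image.1 hx
  exact add_mem (hY hz) (hT z)

theorem pull_le {W : Submodule ℂ (Eu l)} (hY : Y.space ≤ W) (hT : ∀ x, Z.slope L x ∈ W) :
    (pull h Y).space ≤ W := fun x hx => by
  obtain ⟨z, hz, rfl⟩ := mem_image.1 hx
  exact sub_mem (hY hz) (hT z)

theorem continuous_push {B : Type*} [TopologicalSpace B] {f : B → Gr k l} (hf : Continuous f)
    (h : ∀ y, (f y).Transverse L) {Y : B → Gr j l} (hY : Continuous Y) :
    Continuous fun y => push (h y) (Y y) := by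
  have hs := continuous_slope hf h
  exact continuous_image (continuous_const.add hs) (continuous_const.sub hs) _ hY

theorem continuous_pull {B : Type*} [TopologicalSpace B] {f : B → Gr k l} (hf : Continuous f)
    (h : ∀ y, (f y).Transverse L) {Y : B → Gr j l} (hY : Continuous Y) :
    Continuous fun y => pull (h y) (Y y) := by
  have hs := continuous_slope hf h
  exact continuous_image (continuous_const.sub hs) (continuous_const.add hs) _ hY

end Gr

/-- The space of flags `A ≤ Z_1 ≤ ⋯ ≤ Z_n` with `Z_α ≤ W_α` and `dim Z_α = r_α`. -/
abbrev Tower {l n : ℕ} (A : Submodule ℂ (Eu l)) (W : Fin n → Submodule ℂ (Eu l)) (r : Fin n → ℕ) :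
    Type :=
  {x : ∀ α, Gr (r α) l // (∀ α, A ≤ (x α).space) ∧ (∀ α, (x α).space ≤ W α) ∧
    ∀ α β, α ≤ β → (x α).space ≤ (x β).space}

namespace Tower

variable {l n : ℕ} {A : Submodule ℂ (Eu l)} {W : Fin (n + 1) → Submodule ℂ (Eu l)}
  {r : Fin (n + 1) → ℕ}

/-- The first subspace of the flag. -/
def first (x : Tower A W r) : RelGr A (W 0) (r 0) := ⟨x.1 0, x.2.1 0, x.2.2.1 0⟩

theorem continuous_first : Continuous (first : Tower A W r → _) :=
  ((continuous_apply 0).comp continuous_subtype_val).subtype_mk _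

variable {N s : ℕ} (e : AdaptedFrame A (W 0) N) (hr : Module.finrank ℂ A + s = r 0)
  (hW : Monotone W) (I : CellIndex N s)

variable {Z : RelGr A (W 0) (r 0)} (hZ : Z ∈ e.chartSet hr I)
  (y : Tower (e.coordSpace I.set) (fun α : Fin n => W α.succ) (fun α => r α.succ))

/-- The flag starting with `Z` that corresponds to a flag starting with the centre of the chart. -/
def extend : Tower A W r := by
  refine ⟨Fin.cons (α := fun α => Gr (r α) l) Z.1 fun α => Gr.push hZ (y.1 α),
    Fin.cases Z.2.1 fun α => Z.2.1.trans (Gr.le_push hZ (y.2.1 α)),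
    Fin.cases Z.2.2 fun α => Gr.push_le hZ (y.2.2.1 α) fun z => hW (Fin.zero_le _)
      (Gr.slope_mem Z.2.2 AdaptedFrame.coordSpace_le z), fun α β hαβ => ?_⟩
  induction α using Fin.cases with
  | zero =>
    induction β using Fin.cases with
    | zero => exact le_rfl
    | succ β => exact Gr.le_push hZ (y.2.1 β)
  | succ α =>
    induction β using Fin.cases with
    | zero => exact absurd hαβ (not_le.2 (Fin.succ_pos α))
    | succ β => exact Gr.push_mono hZ (y.2.2.2 _ _ (Fin.succ_le_succ_iff.1 hαβ))

/-- The tower over a chart of the first Grassmannian is a product. -/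
def trivialisation : first ⁻¹' e.chartSet hr I ≃ₜ e.chartSet hr I ×
    Tower (e.coordSpace I.set) (fun α : Fin n => W α.succ) (fun α => r α.succ) where
  toFun x := (⟨first x.1, x.2⟩, ⟨fun α => Gr.pull (Z := x.1.1 0) x.2 (x.1.1 α.succ),
    fun α => Gr.le_pull (L := e.centre hr I) x.2 (x.1.2.2.2 _ _ (Fin.zero_le _)),
    -- The shear moves vectors by elements of W_0, hence preserves every W_α containing it.
    fun α => Gr.pull_le (L := e.centre hr I) x.2 (x.1.2.2.1 _) fun y => hW (Fin.zero_le _)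
      (Gr.slope_mem (x.1.2.2.1 0) AdaptedFrame.coordSpace_le y),
    fun α β h => Gr.image_mono (x.1.2.2.2 _ _ (Fin.succ_le_succ_iff.2 h))⟩)
  invFun y := ⟨extend e hr hW I y.1.2 y.2, y.1.2⟩
  left_inv x := by
    refine Subtype.ext (Subtype.ext (funext fun α => ?_))
    induction α using Fin.cases with
    | zero => rfl
    | succ α => exact Gr.push_pull (Z := x.1.1 0) (L := e.centre hr I) x.2
  right_inv y := by
    refine Prod.ext rfl (Subtype.ext (funext fun α => ?_))
    exact Gr.pull_push (Z := y.1.1.1) (L := e.centre hr I) y.1.2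
  continuous_toFun := by
    have h : ∀ α, Continuous fun x : first ⁻¹' e.chartSet hr I => x.1.1 α := fun α =>
      (continuous_apply α).comp (continuous_subtype_val.comp continuous_subtype_val)
    refine Continuous.prodMk ?_ (Continuous.subtype_mk (continuous_pi fun α => ?_) _)
    · exact (continuous_first.comp continuous_subtype_val).subtype_mk _
    · exact Gr.continuous_pull (h 0) (fun x => x.2) (h α.succ)
  continuous_invFun := by
    refine Continuous.subtype_mk (Continuous.subtype_mk (continuous_pi fun α => ?_) _) _
    have h0 : Continuous fun y : e.chartSet hr I ×
        Tower (e.coordSpace I.set) (fun α : Fin n => W α.succ) (fun α => r α.succ) => y.1.1.1 :=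
      continuous_subtype_val.comp (continuous_subtype_val.comp continuous_fst)
    induction α using Fin.cases with
    | zero => exact h0
    | succ α =>
      exact Gr.continuous_push h0 (fun y => y.1.2)
        ((continuous_apply α).comp (continuous_subtype_val.comp continuous_snd))

end Tower

/-- The indices of the cells as finite sets. -/
def CellIndex.equiv (N s : ℕ) : {I : Finset (Fin N) // I.card = s} ≃ CellIndex N s where
  toFun I := CellIndex.ofSet I.1 I.2
  invFun I := ⟨I.set, I.card_set⟩

instance (N s : ℕ) : Fintype (CellIndex N s) := Fintype.ofEquiv _ (CellIndex.equiv N s)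

/-- The Poincaré polynomial of the Grassmannian of `s`-dimensional subspaces of `ℂ^N`. -/
def cellPoly (N s : ℕ) : ℚ[X] := ∑ I : CellIndex N s, X ^ (2 * I.codim)

/-- Induction on the length: over a chart of the first space, the tower is a product with a shorter
tower starting at the centre of the chart. The index type and codimensions are chosen before `l`,
`A` and `W`, because the bundle construction needs the same ones for the fibres over all charts. The
entry of `Fin.cons a r` at `α.castSucc` is the dimension of the space preceding Z_α. -/
theorem Tower.exists_paving (n : ℕ) : ∀ (a : ℕ) (d r : Fin n → ℕ), (∀ α, a ≤ r α) → Monotone r →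
    ∃ (ι : Type) (_ : LinearOrder ι) (_ : Fintype ι) (b : ι → ℕ),
      ∑ i, (X : ℚ[X]) ^ (2 * b i) = ∏ α : Fin n,
        cellPoly (d α - (Fin.cons a r : Fin (n + 1) → ℕ) α.castSucc)
          (r α - (Fin.cons a r : Fin (n + 1) → ℕ) α.castSucc) ∧
      ∀ (l : ℕ) (A : Submodule ℂ (Eu l)) (W : Fin n → Submodule ℂ (Eu l)),
        Module.finrank ℂ A = a → (∀ α, Module.finrank ℂ (W α) = d α) → (∀ α, A ≤ W α) →
        Monotone W → Nonempty (Paving (Tower A W r) ι b) := by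
  induction n with
  | zero =>
    intro a d r _ _
    refine ⟨Unit, inferInstance, inferInstance, fun _ => 0, by simp, fun l A W _ _ _ _ => ?_⟩
    have : Unique (Tower A W r) :=
      { default := ⟨fun α => α.elim0, fun α => α.elim0, fun α => α.elim0, fun α => α.elim0⟩
        uniq := fun x => Subtype.ext (funext fun α => α.elim0) }
    exact ⟨Paving.point rfl⟩
  | succ n ih =>
    intro a d r ha hr
    obtain ⟨κ, _, _, c, hc, H⟩ := ih (r 0) (fun α => d α.succ) (fun α => r α.succ)
      (fun α => hr (Fin.zero_le _)) fun α β h => hr (Fin.succ_le_succ_iff.2 h)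
    refine ⟨CellIndex (d 0 - a) (r 0 - a) ×ₗ κ, inferInstance,
      inferInstanceAs (Fintype (CellIndex (d 0 - a) (r 0 - a) × κ)),
      fun p => (ofLex p).1.codim + c (ofLex p).2, ?_, fun l A W hA hW hAW hWm => ?_⟩
    · let _ : Fintype (CellIndex (d 0 - a) (r 0 - a) ×ₗ κ) :=
        inferInstanceAs (Fintype (CellIndex (d 0 - a) (r 0 - a) × κ))
      have h1 : ∑ p : CellIndex (d 0 - a) (r 0 - a) ×ₗ κ,
          (X : ℚ[X]) ^ (2 * ((ofLex p).1.codim + c (ofLex p).2)) =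
          ∑ p : CellIndex (d 0 - a) (r 0 - a) × κ, X ^ (2 * p.1.codim) * X ^ (2 * c p.2) :=
        Fintype.sum_equiv ofLex _ _ fun p => by rw [mul_add, pow_add]
      refine h1.trans ?_
      rw [Fintype.sum_prod_type]
      dsimp only
      rw [← Finset.sum_mul_sum, hc, Fin.prod_univ_succ]
      congr 1
      refine Finset.prod_congr rfl fun α _ => ?_
      have h2 : (Fin.cons a r : Fin (n + 2) → ℕ) α.succ.castSucc = r α.castSucc := by
        rw [← Fin.succ_castSucc, Fin.cons_succ]
      have h3 : (Fin.cons (r 0) (fun α : Fin n => r α.succ) : Fin (n + 1) → ℕ) = r :=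
        Fin.cons_self_tail r
      rw [h2, h3]
    · have had : a ≤ d 0 := by
        rw [← hA, ← hW 0]
        exact Submodule.finrank_mono (hAW 0)
      obtain ⟨e⟩ := AdaptedFrame.nonempty (N := d 0 - a) (hAW 0) (by rw [hA, hW 0]; omega)
      have hs : Module.finrank ℂ A + (r 0 - a) = r 0 := by
        have := ha 0
        omega
      have Q : ∀ I : CellIndex (d 0 - a) (r 0 - a), Nonempty (Paving
          (Tower (e.coordSpace I.set) (fun α : Fin n => W α.succ) fun α => r α.succ) κ c) :=
        fun I => H l _ _ ((e.centre hs I).2) (fun α => hW α.succ)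
          (fun α => AdaptedFrame.coordSpace_le.trans (hWm (Fin.zero_le _)))
          fun α β h => hWm (Fin.succ_le_succ_iff.2 h)
      exact ⟨Paving.bundle Tower.continuous_first (e.paving hs) (fun I => (Q I).some)
        (fun I => Tower.trivialisation e hs hWm I) fun I x => rfl⟩

/-- The fibre of the resolution over `V` as a tower. -/
def ResolutionFibre.homeomorph {k l n : ℕ} (F : Fin n → Submodule ℂ (Eu l)) (r : Fin n → ℕ)
    (V : Gr k l) : ResolutionFibre k F r V ≃ₜ Tower ⊥ (fun α => V.space ⊓ F α) r where
  toFun x := ⟨x.1.1.1, fun _ => bot_le,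
    fun α => le_inf ((x.1.2.2.2 α).trans_eq (congrArg Gr.space x.2)) (x.1.2.1 α), x.1.2.2.1⟩
  invFun y := ⟨⟨(y.1, V), fun α => (y.2.2.1 α).trans inf_le_right, y.2.2.2,
    fun α => (y.2.2.1 α).trans inf_le_left⟩, rfl⟩
  left_inv x := Subtype.ext (Subtype.ext (Prod.ext rfl x.2.symm))
  right_inv y := rfl
  continuous_toFun := by fun_prop
  continuous_invFun := by fun_prop

end

noncomputable section

/-! ### Gaussian binomial coefficients -/

/-- The number of pairs `i < j` with `i ∈ I` and `j ∉ I`. -/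
def Finset.inversions {N : ℕ} (I : Finset (Fin N)) : ℕ :=
  ∑ i, ∑ j, if i ∈ I ∧ j ∉ I ∧ i < j then 1 else 0

/-- A new largest index outside the set forms an inversion with each element of the set. -/
theorem Finset.inversions_map {N : ℕ} (I : Finset (Fin N)) :
    (I.map Fin.castSuccEmb).inversions = I.inversions + I.card := by
  have hl : Fin.last N ∉ I.map Fin.castSuccEmb := by
    simp [Fin.castSucc_ne_last]
  have hc : ∀ i : Fin N, i.castSucc ∈ I.map Fin.castSuccEmb ↔ i ∈ I := fun i => by simp
  simp only [Finset.inversions, Fin.sum_univ_castSucc, hl, hc, Fin.castSucc_lt_castSucc_iff,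
    Fin.castSucc_lt_last, false_and, not_false_eq_true, and_true, true_and, if_false,
    Finset.sum_const_zero, add_zero, Finset.sum_add_distrib]
  simp

/-- A new largest index inside the set has nothing above it and is not a missing index, so no
inversion involves it. -/
theorem Finset.inversions_insert {N : ℕ} (I : Finset (Fin N)) :
    (insert (Fin.last N) (I.map Fin.castSuccEmb)).inversions = I.inversions := by
  have hl : Fin.last N ∈ insert (Fin.last N) (I.map Fin.castSuccEmb) :=
    Finset.mem_insert_self _ _
  have hc : ∀ i : Fin N, i.castSucc ∈ insert (Fin.last N) (I.map Fin.castSuccEmb) ↔ i ∈ I :=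
    fun i => by simp [Fin.castSucc_ne_last]
  have hn : ∀ i : Fin N, ¬ Fin.last N < i.castSucc := fun i => not_lt.2 (Fin.le_last _)
  simp only [Finset.inversions, Fin.sum_univ_castSucc, hl, hc, hn, Fin.castSucc_lt_castSucc_iff,
    not_true_eq_false, false_and, and_false, if_false, Finset.sum_const_zero, add_zero]

theorem CellIndex.codim_eq {N s : ℕ} (I : CellIndex N s) : I.codim = I.set.inversions := by
  rw [CellIndex.codim, Fintype.card_subtype, Finset.card_filter, Fintype.sum_prod_type]
  rfl

theorem cellPoly_eq (N s : ℕ) :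
    cellPoly N s = ∑ I ∈ Finset.powersetCard s (Finset.univ : Finset (Fin N)),
      X ^ (2 * I.inversions) := by
  rw [cellPoly, ← (CellIndex.equiv N s).sum_comp]
  simp only [CellIndex.codim_eq]
  refine (Finset.sum_subtype _ (fun I => ?_) fun I : Finset (Fin N) =>
    (X : ℚ[X]) ^ (2 * I.inversions)).symm
  simp [Finset.mem_powersetCard]

theorem cellPoly_zero_right (N : ℕ) : cellPoly N 0 = 1 := by
  rw [cellPoly_eq, Finset.powersetCard_zero, Finset.sum_singleton]
  simp [Finset.inversions]

theorem cellPoly_eq_zero {N s : ℕ} (h : N < s) : cellPoly N s = 0 := by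
  rw [cellPoly_eq, Finset.powersetCard_eq_empty.2 (by simpa using h), Finset.sum_empty]

/-- The Pascal rule for q = t²: subsets are sorted by whether they contain the last index. -/
theorem cellPoly_succ_succ (N s : ℕ) :
    cellPoly (N + 1) (s + 1) = cellPoly N s + X ^ (2 * (s + 1)) * cellPoly N (s + 1) := by
  have hl : ∀ I : Finset (Fin N), Fin.last N ∉ I.map Fin.castSuccEmb := fun I => by
    simp [Fin.castSucc_ne_last]
  have hu : (Finset.univ : Finset (Fin (N + 1))) =
      insert (Fin.last N) (Finset.univ.map Fin.castSuccEmb) := by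
    rw [Fin.univ_castSuccEmb, Finset.cons_eq_insert]
  simp only [cellPoly_eq]
  rw [hu, Finset.powersetCard_succ_insert (hl _), Finset.sum_union, Finset.powersetCard_map,
    Finset.powersetCard_map, Finset.sum_map, Finset.sum_image, Finset.sum_map, add_comm]
  · congr 1
    · exact Finset.sum_congr rfl fun I _ => by
        rw [show (Finset.mapEmbedding Fin.castSuccEmb).toEmbedding I = I.map Fin.castSuccEmb from rfl,
          Finset.inversions_insert]
    · rw [Finset.mul_sum]
      refine Finset.sum_congr rfl fun I hI => ?_
      rw [show (Finset.mapEmbedding Fin.castSuccEmb).toEmbedding I = I.map Fin.castSuccEmb from rfl,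
        Finset.inversions_map, (Finset.mem_powersetCard.1 hI).2,
        ← pow_add]
      congr 1
      ring
  · intro I hI J hJ h
    have key : ∀ I ∈ (Finset.powersetCard s (Finset.univ : Finset (Fin N))).map
        (Finset.mapEmbedding Fin.castSuccEmb).toEmbedding, Fin.last N ∉ I := fun I hI => by
      obtain ⟨I', -, rfl⟩ := Finset.mem_map.1 hI
      exact hl I'
    rw [← Finset.erase_insert (key I hI), ← Finset.erase_insert (key J hJ), h]
  · rw [Finset.disjoint_left]
    intro I hI hI'
    obtain ⟨J, -, rfl⟩ := Finset.mem_image.1 hI'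
    have := (Finset.mem_powersetCard.1 hI).1 (Finset.mem_insert_self _ _)
    exact hl _ this

theorem hPoly_add (a b : ℕ) : hPoly (a + b + 1) = hPoly a + X ^ (2 * (a + 1)) * hPoly b := by
  rw [hPoly, show a + b + 1 + 1 = (a + 1) + (b + 1) by ring, Finset.sum_range_add, hPoly, hPoly,
    Finset.mul_sum]
  congr 1
  exact Finset.sum_congr rfl fun i _ => by rw [← pow_add]; ring

theorem PPoly_natCast (n : ℕ) : PPoly n = ∏ β ∈ Finset.range n, hPoly β := by
  rw [PPoly, if_neg (by omega), Int.toNat_natCast]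

theorem PPoly_succ (n : ℕ) : PPoly (n + 1 : ℕ) = PPoly n * hPoly n := by
  rw [PPoly_natCast, PPoly_natCast, Finset.prod_range_succ]

theorem PPoly_zero : PPoly (0 : ℕ) = 1 := by
  rw [PPoly_natCast, Finset.prod_range_zero]

theorem hPoly_ne_zero (n : ℕ) : hPoly n ≠ 0 := by
  intro h
  have h1 := congrArg (eval 1) h
  rw [hPoly, eval_finsetSum] at h1
  -- At t = 1 the polynomial takes the value n + 1.
  simp at h1
  exact absurd h1 (by positivity)

theorem PPoly_ne_zero (n : ℕ) : PPoly n ≠ 0 := by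
  rw [PPoly_natCast]
  exact Finset.prod_ne_zero_iff.2 fun i _ => hPoly_ne_zero i

/-- The Gaussian binomial formula with denominators cleared. The Pascal rule reproduces the
splitting h_{a+b+1} = h_a + t^(2(a+1)) h_b of the new factor of P_{n+1}. -/
theorem cellPoly_mul (n : ℕ) : ∀ a b : ℕ, a + b = n →
    cellPoly n a * (PPoly a * PPoly b) = PPoly n := by
  induction n with
  | zero =>
    intro a b h
    obtain ⟨rfl, rfl⟩ : a = 0 ∧ b = 0 := by omega
    rw [cellPoly_zero_right, PPoly_zero, one_mul, one_mul]
  | succ n ih =>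
    rintro (_ | a) b h
    · obtain rfl : b = n + 1 := by omega
      rw [cellPoly_zero_right, PPoly_zero, one_mul, one_mul]
    · rw [cellPoly_succ_succ]
      have h1 := ih a b (by omega)
      rcases b with _ | b
      · obtain rfl : a = n := by omega
        -- At the edge b = 0 the second Pascal term is an empty sum.
        rw [cellPoly_eq_zero (Nat.lt_succ_self a), mul_zero, add_zero, PPoly_succ]
        linear_combination hPoly a * h1
      · have h2 := ih (a + 1) b (by omega)
        obtain rfl : n = a + b + 1 := by omega
        rw [PPoly_succ a] at h2 ⊢
        rw [PPoly_succ b] at h1 ⊢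
        rw [PPoly_succ (a + b + 1), hPoly_add]
        linear_combination hPoly a * h1 + X ^ (2 * (a + 1)) * hPoly b * h2

theorem PRat_natCast_ne_zero (n : ℕ) : PRat n ≠ 0 :=
  (map_ne_zero_iff _ (RatFunc.algebraMap_injective ℚ)).2 (PPoly_ne_zero n)

theorem algebraMap_cellPoly (a b : ℕ) :
    algebraMap ℚ[X] (RatFunc ℚ) (cellPoly (a + b) a) =
      PRat (a + b : ℕ) / (PRat a * PRat b) := by
  rw [eq_div_iff (mul_ne_zero (PRat_natCast_ne_zero a) (PRat_natCast_ne_zero b))]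
  simp only [PRat]
  rw [← map_mul, ← map_mul, cellPoly_mul _ a b rfl]

end

/-! ### The Poincaré polynomial of the fibre -/

noncomputable section

/-- Bridges the truncated differences of dimensions that index `cellPoly` and the integer arguments
of `PRat`. -/
theorem algebraMap_cellPoly_eq {N s : ℕ} {x y z : ℤ} (hx : x = N) (hy : y = s) (hz : y + z = x)
    (hs : s ≤ N) : algebraMap ℚ[X] (RatFunc ℚ) (cellPoly N s) = PRat x / (PRat y * PRat z) := by
  obtain ⟨b, rfl⟩ := Nat.exists_eq_add_of_le hs
  obtain rfl : z = b := by
    push_cast at hx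
    omega
  rw [hx, hy, algebraMap_cellPoly]

end

theorem proposition3p6 {k l ω m : ℕ}
    -- the flag and the tuple defining the Schubert variety
    (F : Fin ω → Submodule ℂ (EuclideanSpace ℂ (Fin l))) (I : Fin ω → ℕ)
    (hF : IsPartialFlag F) (hS : (schubertVariety k F I).Nonempty)
    (hess : IsEssential k F I) (hI : ∀ α, 0 < I α ∧ I α < k)
    -- the two varieties `Δ_q ⊆ Δ_p`, and the essential pair of `Δ_p`
    (p q : SVariety k F I) (hpq : q.points ⊆ p.points) (e : p.EssentialPair (m + 1))
    -- the conditions of `Δ_q` at the positions of the essential flag of `Δ_p`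
    (d : Fin (m + 1) → Fin q.len) (hd : ∀ α, q.pos (d α) = p.pos (e.idx α))
    -- the vector `q^p`
    (qp : Fin (m + 1) → ℕ) (hqp : ∀ α, qp α = q.vec (d α))
    -- a point of the base of the fibration
    (V : Gr k l) (hVq : V ∈ q.points)
    (hV : V ∈ schubertStratum k e.flag (fun α => e.ind α + qp α)) :
    ∃ a : Polynomial ℚ,
      IsPoincarePolynomial (ResolutionFibre k e.flag (fun α => e.ind α + e.bar α) V) a ∧
      algebraMap (Polynomial ℚ) (RatFunc ℚ) a =
        PRat (e.ind 0 + qp 0) / (PRat (e.ind 0 + e.bar 0) * PRat ((qp 0 : ℤ) - e.bar 0)) *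
        ∏ α : Fin m,
          PRat ((e.ind α.succ : ℤ) + qp α.succ - e.ind α.castSucc - e.bar α.castSucc) /
            (PRat ((e.ind α.succ : ℤ) + e.bar α.succ - e.ind α.castSucc - e.bar α.castSucc) *
              PRat ((qp α.succ : ℤ) - e.bar α.succ)) := by
  -- V lies in Δ_q, hence in Δ_p; this forces p̄_α ≤ q_α and keeps all the differences below
  -- nonnegative.
  have hVp : ∀ α, e.ind α + e.bar α ≤ e.ind α + qp α := fun α =>
    (hpq hVq (e.idx α)).trans_eq (hV α)
  have hr : Monotone fun α => e.ind α + e.bar α := fun α β h =>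
    p.weak.monotone (e.idx.monotone h)
  have hW : Monotone fun α => V.space ⊓ e.flag α := fun α β h =>
    inf_le_inf_left _ (hF.strictMono.monotone (p.pos.monotone (e.idx.monotone h)))
  obtain ⟨ι, _, _, b, hb, H⟩ := Tower.exists_paving (m + 1) 0 (fun α => e.ind α + qp α)
    (fun α => e.ind α + e.bar α) (fun _ => Nat.zero_le _) hr
  -- The stratum condition `hV` is literally the value of dim (V ∩ F_α) that the tower requires.
  obtain ⟨P⟩ := H l ⊥ (fun α => V.space ⊓ e.flag α) (finrank_bot ℂ _) hV (fun _ => bot_le) hW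
  refine ⟨∑ i, X ^ (2 * b i),
    (P.ofHomeomorph (ResolutionFibre.homeomorph e.flag _ V)).isPoincarePolynomial, ?_⟩
  rw [hb, map_prod, Fin.prod_univ_succ]
  refine congrArg₂ _ ?_ (Finset.prod_congr rfl fun α _ => ?_)
  · have h := hVp 0
    -- The tower starts from the zero space, so nothing is subtracted in the first factor.
    rw [Fin.castSucc_zero, Fin.cons_zero]
    exact algebraMap_cellPoly_eq (by omega) (by omega) (by ring) (by omega)
  · have h := hVp α.succ
    have h1 : e.ind α.castSucc + e.bar α.castSucc ≤ e.ind α.succ + e.bar α.succ :=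
      hr α.castSucc_le_succ
    rw [← Fin.succ_castSucc, Fin.cons_succ]
    exact algebraMap_cellPoly_eq (by omega) (by omega) (by ring) (by omega)
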